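/- **Theorem.** There is a single algorithm $P$, a finite program whose steps on complex numbers are the constants $0,1,i$, addition, negation, multiplication, real and imaginary parts, equality tests and Gauss(–Jordan) elimination of matrices (the only operation that divides), combined with list bookkeeping, case distinction and bounded repetition (recursion along natural numbers and lists), such that the following holds for all $n,k\ge 0$, all abelian Lie subalgebras $\mathfrak h\subset gl(n,\mathbb R)$, all generators $A_1,\dots,A_k$ of $\mathfrak h$, and all finite lists $\sigma_1,\dots,\sigma_k$ of complex numbers such that the set of entries of $\sigma_j$ is the set of complex eigenvalues of $A_j$. On input $n,(A_1,\sigma_1),\dots,(A_k,\sigma_k)$ the program $P$ outputs: 1. a matrix $B\in GL(n,\mathbb R)$ and a list of blocks $(\mathbb K_r,d_r)$, $r=1,\dots,\ell$, with $\mathbb K_r\in\{\mathbb R,\mathbb C\}$, $d_r\ge 1$, $\sum_r d_r\dim_{\mathbb R}\mathbb K_r=n$, such that $$B\mathfrak hB^{-1}\subset\mathcal A=\{\operatorname{diag}(B_1,\dots,B_\ell): B_r\in\mathbb K_r\cdot\mathbf 1_{d_r}+\mathcal N(d_r,\mathbb K_r)\},$$ where $\mathcal N(d,\mathbb K)$ denotes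 the strictly upper triangular $d\times d$ matrices over $\mathbb K$, and every complex entry $z$ is read as the real $2\times2$ matrix $\begin{pmatrix}\operatorname{Re}z&-\operatorname{Im}z\\ \operatorname{Im}z&\operatorname{Re}z\end{pmatrix}$; 2. vectors $v_1,\dots,v_m\in\mathbb R^\ell$ in Gauss–Jordan row echelon form which are a basis of $\mathfrak h_0=\{X\in\mathfrak h: BXB^{-1}\in\mathcal I\}$. Here $\mathcal I\subset\mathcal A$ is the space of matrices with blocks $i\theta_r\mathbf 1_{d_r}$, where $\theta_r\in\mathbb R$ and $\theta_r=0$ if $\mathbb K_r=\mathbb R$ (that is, the range of $\mathrm{Id}-P_{\mathcal E}$, where $P_{\mathcal E}:\mathcal A\to\mathcal A$ discards the imaginary parts on the diagonal), and $X\in\mathfrak h_0$ is identified with the vector $(\theta_1,\dots,\theta_\ell)$ of $BXB^{-1}$. Moreover, $H=\exp(\mathfrak h)$ is closed in $GL(n,\mathbb R)$ if and only if all entries of $v_1,\dots,v_m$ are rational. (Vectors $v_1,\dots,v_m$ are in Gauss–Jordan row echelon form if there are indices $i_1<\dots<i_m$ such that $v_j(r)=0$ for $r<i_j$, $v_j(i_j)=1$,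 and $v_j(i_s)=0$ for $s\ne j$.) -/

import Mathlib

attribute [local instance 100] LieRing.ofAssociativeRing

namespace AbelianExp

/-! ### Gauss elimination on matrices given as lists of rows -/

section Gauss

variable {K : Type} [Field K] [DecidableEq K]

/-- Treat column `c`. The state consists of the pivot rows found so far and of all remaining rows.
If some remaining row has a nonzero entry in column `c`, the first such row is normalized to have
pivot element `1`, it is used to eliminate the entries of column `c` in all other rows, and it is
appended to the pivot rows. (The chosen row itself becomes the zero row among the remaining ones.) -/
def gaussStep (st : List (List K) × List (List K)) (c : ℕ) : List (List K) × List (List K) :=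
  match st.2.find? (fun r => decide (r.getD c 0 ≠ 0)) with
  | none => st
  | some p =>
    let p' := p.map (fun x => x / p.getD c 0)
    let clear : List K → List K := fun r => List.zipWith (fun x y => x - r.getD c 0 * y) r p'
    (st.1.map clear ++ [p'], st.2.map clear)

/-- Gauss-Jordan elimination: run through the columns from left to right; the result is the list of
the (nonzero) rows of the reduced row echelon form. -/
def gaussJordan (rows : List (List K)) : List (List K) :=
  ((List.range ((rows.map List.length).foldr max 0)).foldl gaussStep ([], rows)).1

end Gauss

/-! ### Programs whose arithmetic consists of ring operations and Gauss elimination -/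

/-- The data types on which the programs operate. -/
inductive Ty : Type
  | num : Ty
  | nat : Ty
  | bool : Ty
  | prod : Ty → Ty → Ty
  | list : Ty → Ty

/-- The values of a data type; `num` stands for exact complex numbers. -/
@[reducible] def Ty.Val : Ty → Type
  | .num => ℂ
  | .nat => ℕ
  | .bool => Bool
  | .prod a b => a.Val × b.Val
  | .list a => List a.Val

/-- Programs with input type the first and output type the second index. They are finite syntactic
objects built from the constants `0`, `1`, `i`, addition, negation and multiplication of numbers,
real and imaginary parts, the equality test, Gauss elimination (the only operation that divides),
bookkeeping for pairs, Booleans, natural numbers and lists, case distinction, and bounded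
repetition (recursion along a natural number or along a list). In particular every program
terminates on every input. -/
inductive Prog : Ty → Ty → Type
  | id {a : Ty} : Prog a a
  | comp {a b c : Ty} (g : Prog b c) (f : Prog a b) : Prog a c
  | pair {a b c : Ty} (f : Prog a b) (g : Prog a c) : Prog a (.prod b c)
  | fst {a b : Ty} : Prog (.prod a b) a
  | snd {a b : Ty} : Prog (.prod a b) b
  | tt {a : Ty} : Prog a .bool
  | ff {a : Ty} : Prog a .bool
  | cond {a b : Ty} (t : Prog a .bool) (f g : Prog a b) : Prog a b
  | zero {a : Ty} : Prog a .nat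
  | succ : Prog .nat .nat
  | natRec {a b : Ty} (m : Prog a .nat) (init : Prog a b)
      (step : Prog (.prod a (.prod .nat b)) b) : Prog a b
  | nil {a b : Ty} : Prog a (.list b)
  | cons {a : Ty} : Prog (.prod a (.list a)) (.list a)
  | listRec {a b c : Ty} (l : Prog a (.list c)) (init : Prog a b)
      (step : Prog (.prod a (.prod c (.prod (.list c) b))) b) : Prog a b
  | numZero {a : Ty} : Prog a .num
  | numOne {a : Ty} : Prog a .num
  | numI {a : Ty} : Prog a .num
  | add : Prog (.prod .num .num) .num
  | neg : Prog .num .num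
  | mul : Prog (.prod .num .num) .num
  | re : Prog .num .num
  | im : Prog .num .num
  | eqTest : Prog (.prod .num .num) .bool
  | gauss : Prog (.list (.list .num)) (.list (.list .num))

/-- The output of a program on an input. -/
noncomputable def Prog.eval : {a b : Ty} → Prog a b → a.Val → b.Val
  | _, _, .id, x => x
  | _, _, .comp g f, x => g.eval (f.eval x)
  | _, _, .pair f g, x => (f.eval x, g.eval x)
  | _, _, .fst, x => x.1
  | _, _, .snd, x => x.2
  | _, _, .tt, _ => true
  | _, _, .ff, _ => false
  | _, _, .cond t f g, x => if t.eval x = true then f.eval x else g.eval x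
  | _, _, .zero, _ => (0 : ℕ)
  | _, _, .succ, m => Nat.succ m
  | _, _, .natRec m init step, x =>
      Nat.rec (init.eval x) (fun i y => step.eval (x, (i, y))) (m.eval x)
  | _, _, .nil, _ => []
  | _, _, .cons, x => List.cons x.1 x.2
  | _, _, .listRec l init step, x =>
      List.rec (init.eval x) (fun h t y => step.eval (x, (h, (t, y)))) (l.eval x)
  | _, _, .numZero, _ => (0 : ℂ)
  | _, _, .numOne, _ => (1 : ℂ)
  | _, _, .numI, _ => Complex.I
  | _, _, .add, x => x.1 + x.2
  | _, _, .neg, x => -x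
  | _, _, .mul, x => x.1 * x.2
  | _, _, .re, x => ((Complex.re x : ℝ) : ℂ)
  | _, _, .im, x => ((Complex.im x : ℝ) : ℂ)
  | _, _, .eqTest, x => decide (x.1 = x.2)
  | _, _, .gauss, x => gaussJordan x

/-- A matrix as data: a list of rows. -/
abbrev Ty.mat : Ty := .list (.list .num)

/-- The encoding of a real matrix as a list of rows. -/
noncomputable def encodeMatrix {m n : ℕ} (M : Fin m → Fin n → ℝ) : Ty.mat.Val :=
  List.ofFn fun i => List.ofFn fun j => ((M i j : ℝ) : ℂ)

/-- Inputs: the size `n`, and a list of generators, each with a list of its eigenvalues. -/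
abbrev inputTy : Ty := .prod .nat (.list (.prod .mat (.list .num)))

/-- Outputs: a base change matrix `B`, a list of blocks (a Boolean telling whether the block is
complex, and the size of the block), and a list of vectors. -/
abbrev outputTy : Ty := .prod .mat (.prod (.list (.prod .bool .nat)) .mat)

/-- The input that belongs to generators `A₁, …, A_k` with lists of eigenvalues `σ₁, …, σ_k`. -/
noncomputable def encodeInput {n k : ℕ} (A : Fin k → Matrix (Fin n) (Fin n) ℝ)
    (σ : Fin k → List ℂ) : inputTy.Val :=
  (n, List.ofFn fun j => (encodeMatrix (A j), σ j))

/-! ### Block decompositions -/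

/-- The real dimension of the field `𝕂`, which is `ℂ` if the Boolean is `true` and else `ℝ`. -/
@[reducible] def fieldDim : Bool → ℕ
  | true => 2
  | false => 1

/-- An element of `𝕂` as a real matrix; a real number is a `1 × 1` matrix. -/
def scalarMatrix : (c : Bool) → ℂ → Matrix (Fin (fieldDim c)) (Fin (fieldDim c)) ℝ
  | true, z => !![z.re, -z.im; z.im, z.re]
  | false, z => !![z.re]

/-- The real matrix obtained from a `d × d` matrix over `𝕂` by replacing each entry by the
corresponding real matrix. -/
def realize (c : Bool) {d : ℕ} (T : Matrix (Fin d) (Fin d) ℂ) :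
    Matrix (Fin d × Fin (fieldDim c)) (Fin d × Fin (fieldDim c)) ℝ :=
  Matrix.of fun p q => scalarMatrix c (T p.1 q.1) p.2 q.2

/-- The set `𝕂 ⬝ 1 + 𝒩(d, 𝕂)`, where `𝒩(d, 𝕂)` consists of the proper upper triangular matrices. -/
def scalarPlusNilpotent (c : Bool) (d : ℕ) : Set (Matrix (Fin d) (Fin d) ℂ) :=
  {T | (c = false → ∀ a b, (T a b).im = 0) ∧
    ∃ (α : ℂ) (N : Matrix (Fin d) (Fin d) ℂ), (∀ a b, b ≤ a → N a b = 0) ∧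
      T = α • (1 : Matrix (Fin d) (Fin d) ℂ) + N}

/-- A matrix `B ∈ GL(n, ℝ)` together with a list of blocks `(𝕂_r, d_r)`, `r = 1, …, ℓ`, with
`d_r ≥ 1` and `∑ d_r ⬝ dim 𝕂_r = n`. -/
structure BlockDecomposition (n : ℕ) where
  B : GL (Fin n) ℝ
  blocks : List (Bool × ℕ)
  size_pos : ∀ b ∈ blocks, 0 < b.2
  dim_eq : ∑ r : Fin blocks.length, blocks[r].2 * fieldDim blocks[r].1 = n

namespace BlockDecomposition

variable {n : ℕ} (D : BlockDecomposition n)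

/-- The number `ℓ` of blocks. -/
abbrev numBlocks : ℕ := D.blocks.length

/-- Whether `𝕂_r = ℂ`. -/
abbrev cplx (r : Fin D.numBlocks) : Bool := D.blocks[r].1

/-- The size `d_r` of the `r`-th block, as a matrix over `𝕂_r`. -/
abbrev size (r : Fin D.numBlocks) : ℕ := D.blocks[r].2

/-- The lexicographic numbering of the rows and columns. -/
def indexEquiv :
    (Σ r : Fin D.numBlocks, Fin (D.size r) × Fin (fieldDim (D.cplx r))) ≃ Fin n :=
  (Equiv.sigmaCongrRight fun _ => finProdFinEquiv).trans
    (finSigmaFinEquiv.trans (finCongr D.dim_eq))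

/-- Families of blocks. -/
abbrev Family : Type := ∀ r : Fin D.numBlocks, Matrix (Fin (D.size r)) (Fin (D.size r)) ℂ

/-- The real block diagonal `n × n` matrix with the given blocks. -/
def toMatrix (T : D.Family) : Matrix (Fin n) (Fin n) ℝ :=
  Matrix.reindex D.indexEquiv D.indexEquiv
    (Matrix.blockDiagonal' fun r => realize (D.cplx r) (T r))

/-- The block families that make up the algebra `𝒜`. -/
def admissible : Set D.Family :=
  {T | ∀ r, T r ∈ scalarPlusNilpotent (D.cplx r) (D.size r)}

/-- The algebra `𝒜` of block diagonal matrices with blocks in `𝕂_r ⬝ 1 + 𝒩(d_r, 𝕂_r)`. -/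
def 𝒜 : Set (Matrix (Fin n) (Fin n) ℝ) := D.toMatrix '' D.admissible

/-- The map `P_ℰ` that discards the imaginary parts on the diagonal. -/
def discardIm (T : D.Family) : D.Family :=
  fun r => Matrix.of fun a b => if a = b then ((T r a b).re : ℂ) else T r a b

/-- The range `ℐ` of `Id - P_ℰ` on `𝒜`. -/
def ℐ : Set (Matrix (Fin n) (Fin n) ℝ) :=
  {M | ∃ T ∈ D.admissible, M = D.toMatrix (T - D.discardIm T)}

/-- The matrix `X` in the new coordinates, `B X B⁻¹`. -/
def conj (X : Matrix (Fin n) (Fin n) ℝ) : Matrix (Fin n) (Fin n) ℝ :=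
  (D.B : Matrix (Fin n) (Fin n) ℝ) * X * ((D.B⁻¹ : GL (Fin n) ℝ) : Matrix (Fin n) (Fin n) ℝ)

/-- In the new coordinates `𝔥` is contained in `𝒜`. -/
def IsAdapted (𝔥 : LieSubalgebra ℝ (Matrix (Fin n) (Fin n) ℝ)) : Prop :=
  ∀ X ∈ 𝔥, D.conj X ∈ D.𝒜

/-- The space `𝔥₀` of those elements of `𝔥` which in the new coordinates belong to `ℐ`. -/
def 𝔥₀ (𝔥 : LieSubalgebra ℝ (Matrix (Fin n) (Fin n) ℝ)) : Set (Matrix (Fin n) (Fin n) ℝ) :=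
  {X | X ∈ 𝔥 ∧ D.conj X ∈ D.ℐ}

/-- The space `𝔥₀` as a set of vectors in `ℝ^ℓ`: the element with blocks `i θ_r ⬝ 1` corresponds to
the vector `θ` of the imaginary parts on the diagonal (and `θ_r = 0` if `𝕂_r = ℝ`). -/
def 𝔥₀Coords (𝔥 : LieSubalgebra ℝ (Matrix (Fin n) (Fin n) ℝ)) : Set (Fin D.numBlocks → ℝ) :=
  {θ | ∃ X ∈ D.𝔥₀ 𝔥, ∃ T ∈ D.admissible, D.conj X = D.toMatrix T ∧ ∀ r a, (T r a a).im = θ r}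

end BlockDecomposition

/-- Vectors `v₁, …, v_m ∈ ℝ^d` in Gauss-Jordan row echelon form. -/
def IsGaussJordan {m d : ℕ} (v : Fin m → Fin d → ℝ) : Prop :=
  ∃ p : Fin m → Fin d, StrictMono p ∧
    ∀ j, (∀ r, r < p j → v j r = 0) ∧ v j (p j) = 1 ∧ ∀ i, i ≠ j → v j (p i) = 0

/-- The subset `exp(𝔥)` of `GL(n, ℝ)`. -/
def expImage {n : ℕ} (𝔥 : LieSubalgebra ℝ (Matrix (Fin n) (Fin n) ℝ)) : Set (GL (Fin n) ℝ) :=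
  {g | ∃ X ∈ 𝔥, (g : Matrix (Fin n) (Fin n) ℝ) = NormedSpace.exp X}

end AbelianExp

/-!
The program avoids root finding because the eigenvalues are part of the input. A joint eigenvalue
`χ` of the commuting matrices `A_j`, acting on complex row vectors, is one of the finitely many
choices `χ_j ∈ σ_j`. The joint generalized eigenspace of `χ` is exhausted by the flag whose next
member consists of all `u` with `u A_j - χ_j u` in the previous one (`flag_eq_weightSpace`). Each
step of the flag is a system of linear equations, so Gauss elimination produces a basis along the
flag, in which all `A_j` are triangular with the scalar `χ_j` on the diagonal (`block_spec`). If `χ`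
is real, elimination with real input produces a real basis; otherwise the conjugate basis belongs
to the conjugate eigenvalue. Keeping one eigenvalue of each conjugate pair, the real and imaginary
parts of the basis vectors are the rows of `B` (`EigenSystem`, `eigenBlocks_spec`). As the
generalized eigenspaces decompose `ℂ^n`, the number of these rows is `n` and `B` is invertible.

An abelian Lie algebra is the linear span of its generators. Thus `∑ c_j A_j` belongs to `𝔥₀` if and
only if `∑ c_j (ξ A_j - i Im(χ_j) ξ) = 0` for all basis vectors `ξ`
(`EigenSystem.mem_𝔥₀Coords_iff`), and the coordinates of such elements are `∑ c_j Im(χ_j)`. These are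
linear equations again, and elimination returns an echelon basis of the coordinate space.

For the closedness criterion, let `X ∈ 𝔥`. In every block, `B X B⁻¹` is the sum of a scalar and a
strictly upper triangular matrix, and `exp X` determines the latter and the real part of the scalar
continuously, because on strictly upper triangular matrices the exponential has a polynomial
inverse (`exists_log_weights`). These data determine `X` up to an element of `𝔥₀`.

If the echelon basis `v` is rational, then suitable multiples of the `v_j` are periods of the
exponential map, so `X` can be changed by periods to lie in a compact set that depends only on a
bound for `exp X` and its inverse. Hence `exp 𝔥` is closed
(`BlockDecomposition.isClosed_expImage_of_rational`).

Conversely, if `exp 𝔥` is closed, its inverse image under the parametrization of the torus `exp ℐ` by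
the angles is closed, and so is `𝔥₀ + 2πℤ^ℓ`. The elements of this group that vanish at all pivots of
`v` form a closed subgroup, which is countable since each of them is determined by its lattice part.
By Baire's theorem it is discrete. The multiples of `v_j` modulo the lattice form a sequence in a
compact set, so that two of the multiples coincide modulo the lattice, which makes `v_j` rational
(`rational_of_isClosed`, `BlockDecomposition.rational_of_isClosed_expImage`).
-/

namespace AbelianExp

/-! ### Gauss elimination -/

section GaussSpec

variable {K : Type} [Field K] {d : ℕ}

/-- Subtract from `r` the multiple of `q` that cancels the entry in column `c`, if `q c = 1`. -/
def clearCol (c : Fin d) (q r : Fin d → K) : Fin d → K := r - r c • q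

lemma zipWith_clear_ofFn (c : Fin d) (q r : Fin d → K) :
    List.zipWith (fun x y => x - (List.ofFn r).getD c 0 * y) (List.ofFn r) (List.ofFn q) =
      List.ofFn (clearCol c q r) := by
  apply List.ext_getElem
  · simp
  · intro i h1 h2
    simp [clearCol, List.getD]

lemma gaussStep_ofFn [DecidableEq K] (P R : List (Fin d → K)) (c : Fin d) :
    gaussStep (P.map List.ofFn, R.map List.ofFn) (c : ℕ) =
      match R.find? (fun r => decide (r c ≠ 0)) with
      | none => (P.map List.ofFn, R.map List.ofFn)
      | some p => ((P.map (clearCol c ((p c)⁻¹ • p)) ++ [(p c)⁻¹ • p]).map List.ofFn,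
          (R.map (clearCol c ((p c)⁻¹ • p))).map List.ofFn) := by
  have hget : ∀ r : Fin d → K, (List.ofFn r).getD (c : ℕ) 0 = r c := by
    intro r; simp [List.getD]
  have hp : ((fun r : List K => decide (r.getD (c : ℕ) 0 ≠ 0)) ∘ List.ofFn) =
      fun r : Fin d → K => decide (r c ≠ 0) := by
    funext r; simp only [Function.comp, hget]
  unfold gaussStep
  simp only [List.find?_map, hp]
  cases h : R.find? (fun r => decide (r c ≠ 0)) with
  | none => rfl
  | some p =>
    have hn : (List.ofFn p).map (fun x => x / (List.ofFn p).getD (c : ℕ) 0) =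
        List.ofFn ((p c)⁻¹ • p) := by
      rw [hget, List.map_ofFn]
      congr 1
      funext i
      simp [div_eq_inv_mul]
    simp only [Option.map_some, hn, List.map_map, List.map_append, List.map_cons, List.map_nil]
    refine Prod.ext ?_ ?_
    · simp only [List.append_cancel_right_eq]
      refine List.map_congr_left fun r _ => ?_
      exact zipWith_clear_ofFn c _ r
    · refine List.map_congr_left fun r _ => ?_
      exact zipWith_clear_ofFn c _ r

/-- A list of vectors in reduced row echelon form, each paired with the index of its pivot. -/
structure IsEchelon (L : List (Fin d × (Fin d → K))) : Prop where
  sorted : L.Pairwise fun a b => a.1 < b.1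
  pivot : ∀ a ∈ L, ∀ b ∈ L, a.2 b.1 = if a.1 = b.1 then 1 else 0
  lead : ∀ a ∈ L, ∀ r, r < a.1 → a.2 r = 0

lemma span_clearCol (S : Set (Fin d → K)) (c : Fin d) (q : Fin d → K) :
    Submodule.span K (clearCol c q '' S ∪ {q}) = Submodule.span K (S ∪ {q}) := by
  apply le_antisymm <;> rw [Submodule.span_le]
  · rintro _ (⟨r, hr, rfl⟩ | rfl)
    · exact sub_mem (Submodule.subset_span (Or.inl hr))
        (Submodule.smul_mem _ _ (Submodule.subset_span (Or.inr rfl)))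
    · exact Submodule.subset_span (Or.inr rfl)
  · rintro r (hr | rfl)
    · have : r = clearCol c q r + r c • q := by simp [clearCol]
      rw [this]
      exact add_mem (Submodule.subset_span (Or.inl ⟨r, hr, rfl⟩))
        (Submodule.smul_mem _ _ (Submodule.subset_span (Or.inr rfl)))
    · exact Submodule.subset_span (Or.inr rfl)

/-- The invariant of the elimination: after the columns `< c`, the pivot rows are in echelon form,
the remaining rows vanish in these columns, and the span has not changed. -/
lemma foldl_gaussStep [DecidableEq K] (rows : List (Fin d → K)) (c : ℕ) (hc : c ≤ d) :
    ∃ (L : List (Fin d × (Fin d → K))) (R : List (Fin d → K)),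
      (List.range c).foldl gaussStep ([], rows.map List.ofFn) =
        ((L.map Prod.snd).map List.ofFn, R.map List.ofFn) ∧
      IsEchelon L ∧ (∀ a ∈ L, a.1.1 < c) ∧ (∀ r ∈ R, ∀ i : Fin d, i.1 < c → r i = 0) ∧
      Submodule.span K ({x | x ∈ L.map Prod.snd} ∪ {x | x ∈ R}) =
        Submodule.span K {x | x ∈ rows} := by
  induction c with
  | zero =>
    refine ⟨[], rows, by simp, ⟨by simp, by simp, by simp⟩, by simp, by simp, by simp⟩
  | succ c ih =>
    obtain ⟨L, R, h, hE, hlt, hR, hspan⟩ := ih (by omega)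
    rw [List.range_succ, List.foldl_append, h]
    simp only [List.foldl_cons, List.foldl_nil]
    have key := gaussStep_ofFn (L.map Prod.snd) R ⟨c, hc⟩
    simp only at key
    cases hf : R.find? (fun r => decide (r ⟨c, hc⟩ ≠ 0)) with
    | none =>
      rw [hf] at key
      refine ⟨L, R, key, hE, fun a ha => (hlt a ha).trans (Nat.lt_succ_self c), ?_, hspan⟩
      intro r hr i hi
      rcases Nat.lt_succ_iff_lt_or_eq.mp hi with h1 | h1
      · exact hR r hr i h1
      · have := List.find?_eq_none.mp hf r hr
        obtain rfl : i = ⟨c, hc⟩ := Fin.ext h1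
        simpa using this
    | some p =>
      rw [hf] at key
      have hpR : p ∈ R := List.mem_of_find?_eq_some hf
      have hpc : p ⟨c, hc⟩ ≠ 0 := by simpa using List.find?_some hf
      set cc : Fin d := ⟨c, hc⟩ with hcc
      set q : Fin d → K := (p cc)⁻¹ • p with hq
      have hqc : q cc = 1 := by simp [hq, hpc]
      have hq0 : ∀ i : Fin d, i.1 < c → q i = 0 := by
        intro i hi; simp [hq, hR p hpR i hi]
      have hcl : ∀ (r : Fin d → K) (i : Fin d), i.1 < c → clearCol cc q r i = r i := by
        intro r i hi; simp [clearCol, hq0 i hi]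
      have hclc : ∀ r : Fin d → K, clearCol cc q r cc = 0 := by
        intro r; simp [clearCol, hqc]
      refine ⟨L.map (fun a => (a.1, clearCol cc q a.2)) ++ [(cc, q)], R.map (clearCol cc q), ?_,
        ⟨?_, ?_, ?_⟩, ?_, ?_, ?_⟩
      · rw [key]
        simp only [List.map_append, List.map_map, List.map_cons, List.map_nil, ← hq]
        rfl
      · rw [List.pairwise_append]
        refine ⟨?_, by simp, ?_⟩
        · rw [List.pairwise_map]; exact hE.sorted
        · intro a ha b hb
          simp only [List.mem_singleton] at hb
          obtain ⟨a', ha', rfl⟩ := List.mem_map.mp ha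
          subst hb
          exact hlt a' ha'
      · intro a ha b hb
        simp only [List.mem_append, List.mem_map, List.mem_singleton] at ha hb
        rcases ha with ⟨a, ha, rfl⟩ | rfl <;> rcases hb with ⟨b, hb, rfl⟩ | rfl
        · rw [← hE.pivot a ha b hb]; exact hcl _ _ (hlt b hb)
        · have : a.1 ≠ cc := fun h => by have := hlt a ha; simp [h, hcc] at this
          simp [this, hclc]
        · have : cc ≠ b.1 := fun h => by have := hlt b hb; simp [← h, hcc] at this
          simp only [this, if_false]
          exact hq0 _ (hlt b hb)
        · simpa using hqc
      · intro a ha r hr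
        simp only [List.mem_append, List.mem_map, List.mem_singleton] at ha
        rcases ha with ⟨a, ha, rfl⟩ | rfl
        · have h1 : r.1 < c := lt_trans (show r.1 < a.1.1 from hr) (hlt a ha)
          exact (hcl _ _ h1).trans (hE.lead a ha r hr)
        · exact hq0 r hr
      · intro a ha
        simp only [List.mem_append, List.mem_map, List.mem_singleton] at ha
        rcases ha with ⟨a, ha, rfl⟩ | rfl
        · exact (hlt a ha).trans (Nat.lt_succ_self c)
        · exact Nat.lt_succ_self c
      · intro r hr i hi
        obtain ⟨r, hr', rfl⟩ := List.mem_map.mp hr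
        rcases Nat.lt_succ_iff_lt_or_eq.mp hi with h1 | h1
        · rw [hcl r i h1]; exact hR r hr' i h1
        · obtain rfl : i = cc := Fin.ext h1
          exact hclc r
      · rw [← hspan]
        have hqmem : q ∈ Submodule.span K ({x | x ∈ L.map Prod.snd} ∪ {x | x ∈ R}) :=
          Submodule.smul_mem _ _ (Submodule.subset_span (Or.inr hpR))
        have e1 : ({x | x ∈ (L.map (fun a => (a.1, clearCol cc q a.2)) ++ [(cc, q)]).map Prod.snd} ∪
            {x | x ∈ R.map (clearCol cc q)}) =
            clearCol cc q '' ({x | x ∈ L.map Prod.snd} ∪ {x | x ∈ R}) ∪ {q} := by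
          ext x
          simp only [List.map_append, List.map_map, List.mem_append, List.mem_map, Set.mem_union,
            Set.mem_ofPred_eq, Set.mem_image, Set.mem_singleton_iff, List.map_cons, List.map_nil,
            List.mem_singleton, Function.comp_apply]
          constructor
          · rintro ((⟨a, ha, rfl⟩ | rfl) | ⟨a, ha, rfl⟩)
            · exact Or.inl ⟨a.2, Or.inl ⟨a, ha, rfl⟩, rfl⟩
            · exact Or.inr rfl
            · exact Or.inl ⟨a, Or.inr ha, rfl⟩
          · rintro (⟨_, ⟨a, ha, rfl⟩ | ha, rfl⟩ | rfl)
            · exact Or.inl (Or.inl ⟨a, ha, rfl⟩)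
            · exact Or.inr ⟨_, ha, rfl⟩
            · exact Or.inl (Or.inr rfl)
        rw [e1, span_clearCol, Submodule.span_union, sup_eq_left, Submodule.span_le]
        simpa using hqmem

lemma foldr_max_length {α : Type} {d : ℕ} (rows : List (Fin d → α)) (h : rows ≠ []) :
    (((rows.map List.ofFn).map List.length).foldr max 0) = d := by
  induction rows with
  | nil => exact absurd rfl h
  | cons r t ih =>
    by_cases ht : t = []
    · subst ht; simp
    · have := ih ht
      simp only [List.map_cons, List.foldr_cons, List.length_ofFn]
      rw [this, max_self]

/-- Gauss-Jordan elimination yields a basis of the row space in reduced row echelon form. -/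
lemma gaussJordan_spec [DecidableEq K] (rows : List (Fin d → K)) :
    ∃ L : List (Fin d × (Fin d → K)),
      gaussJordan (rows.map List.ofFn) = (L.map Prod.snd).map List.ofFn ∧ IsEchelon L ∧
      Submodule.span K {x | x ∈ L.map Prod.snd} = Submodule.span K {x | x ∈ rows} := by
  by_cases h : rows = []
  · subst h
    exact ⟨[], by simp [gaussJordan], ⟨by simp, by simp, by simp⟩, by simp⟩
  · obtain ⟨L, R, h1, h2, -, h3, h4⟩ := foldl_gaussStep rows d le_rfl
    refine ⟨L, ?_, h2, ?_⟩
    · unfold gaussJordan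
      rw [foldr_max_length rows h, h1]
    · rw [← h4, Submodule.span_union, eq_comm, sup_eq_left]
      have : Submodule.span K {x | x ∈ R} = ⊥ := by
        rw [Submodule.span_eq_bot]
        intro x hx
        funext i
        exact h3 x hx i i.2
      rw [this]
      exact bot_le

lemma IsEchelon.eq_of_pivot_eq {L : List (Fin d × (Fin d → K))} (hL : IsEchelon L) {a b}
    (ha : a ∈ L) (hb : b ∈ L) (h : a.1 = b.1) : a = b := by
  have hp : L.Pairwise fun a b => a.1 = b.1 → a = b :=
    hL.sorted.imp fun h e => absurd e h.ne
  have : Std.Symm fun a b : Fin d × (Fin d → K) => a.1 = b.1 → a = b :=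
    ⟨fun _ _ h e => (h e.symm).symm⟩
  exact hp.forall_of_forall (fun _ _ _ => rfl) ha hb h

/-- In echelon form the coefficients of a vector are its entries at the pivots. Hence a vector of
the span that vanishes on an initial segment of indices is a combination of those basis vectors
that vanish there, too. -/
lemma IsEchelon.mem_span_filter {L : List (Fin d × (Fin d → K))} (hL : IsEchelon L) (m : ℕ)
    (x : Fin d → K) (hx : x ∈ Submodule.span K {x | x ∈ L.map Prod.snd})
    (h0 : ∀ i : Fin d, i.1 < m → x i = 0) :
    x ∈ Submodule.span K {y | ∃ a ∈ L, a.2 = y ∧ m ≤ a.1.1} := by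
  classical
  -- Expansion of `x`: each element of `L` occurs with the entry of `x` at its pivot.
  have key : ∀ x ∈ Submodule.span K {x | x ∈ L.map Prod.snd},
      x = ∑ a ∈ L.toFinset, x a.1 • a.2 := by
    intro x hx
    induction hx using Submodule.span_induction with
    | mem x hx =>
      obtain ⟨b, hb, rfl⟩ := List.mem_map.mp hx
      rw [Finset.sum_eq_single b]
      · rw [hL.pivot b hb b hb]; simp
      · intro a ha hab
        have ha : a ∈ L := by simpa using ha
        rw [hL.pivot b hb a ha, if_neg, zero_smul]
        intro he
        apply hab
        exact (hL.eq_of_pivot_eq hb ha he).symm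
      · intro h; exact absurd (by simpa using hb) h
    | zero => simp
    | add x y _ _ hx hy =>
      conv_lhs => rw [hx, hy]
      simp [add_smul, Finset.sum_add_distrib]
    | smul c x _ hx =>
      conv_lhs => rw [hx]
      simp [Finset.smul_sum, mul_smul]
  rw [key x hx]
  refine Submodule.sum_mem _ fun a ha => ?_
  have ha : a ∈ L := by simpa using ha
  by_cases hm : m ≤ a.1.1
  · exact Submodule.smul_mem _ _ (Submodule.subset_span ⟨a, ha, rfl, hm⟩)
  · rw [h0 a.1 (by omega), zero_smul]; exact zero_mem _

/-- The last components `y` of the vectors `(0, y)` in the span of the given pairs, in echelon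
form: Gauss elimination of the concatenated pairs, where only those rows are kept whose first `m`
entries vanish. -/
def solve [DecidableEq K] (m : ℕ) (l : List (List K × List K)) : List (List K) :=
  ((gaussJordan (l.map fun p => p.1 ++ p.2)).filter fun r =>
    (List.range m).all fun i => decide (r.getD i 0 = 0)).map (List.drop m)

lemma all_range_getD_ofFn [DecidableEq K] {m : ℕ} (r : Fin (m + d) → K) :
    ((List.range m).all fun i => decide ((List.ofFn r).getD i 0 = 0)) =
      decide (∀ i : Fin m, r (Fin.castAdd d i) = 0) := by
  rw [Bool.eq_iff_iff]
  simp only [List.all_eq_true, List.mem_range, decide_eq_true_eq]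
  constructor
  · intro h i
    have := h i i.2
    have h2 : i.1 < m + d := i.2.trans_le (Nat.le_add_right m d)
    have h3 : (List.ofFn r).getD i.1 0 = r (Fin.castAdd d i) := by
      simp [List.getD, h2]
      rfl
    rwa [← h3]
  · intro h i hi
    have h2 : i < m + d := hi.trans_le (Nat.le_add_right m d)
    have : r ⟨i, h2⟩ = 0 := h ⟨i, hi⟩
    simp [List.getD, h2, this]

lemma drop_ofFn {α : Type} {m d : ℕ} (r : Fin (m + d) → α) :
    (List.ofFn r).drop m = List.ofFn fun i : Fin d => r (Fin.natAdd m i) := by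
  apply List.ext_getElem
  · simp
  · intro i h1 h2
    simp [Fin.natAdd]

/-- Restrict a vector with pivot to the last `d` indices, if the pivot is one of them. -/
def dropPivot {α : Type} {d : ℕ} (m : ℕ) (a : Fin (m + d) × (Fin (m + d) → α)) :
    Option (Fin d × (Fin d → α)) :=
  if h : m ≤ a.1.1 then
    some (⟨a.1.1 - m, by have := a.1.2; omega⟩, fun i => a.2 (Fin.natAdd m i))
  else none

lemma dropPivot_eq_some {α : Type} {m d : ℕ} {a : Fin (m + d) × (Fin (m + d) → α)} {b} :
    dropPivot m a = some b ↔ a.1 = Fin.natAdd m b.1 ∧ b.2 = fun i => a.2 (Fin.natAdd m i) := by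
  unfold dropPivot
  split_ifs with h
  · simp only [Option.some.injEq]
    constructor
    · rintro rfl
      refine ⟨Fin.ext ?_, rfl⟩
      simp [h]
    · rintro ⟨h1, h2⟩
      refine Prod.ext (Fin.ext ?_) h2.symm
      simp [h1]
  · simp only [false_iff, not_and]
    intro h1
    rw [h1] at h
    simp at h

/-- The output of `solve` is an echelon basis of the space of all `y` such that `(0, y)` is in the span
of the given pairs. -/
lemma solve_spec [DecidableEq K] {m : ℕ} (l : List ((Fin m → K) × (Fin d → K))) :
    ∃ L : List (Fin d × (Fin d → K)),
      solve m (l.map fun p => (List.ofFn p.1, List.ofFn p.2)) = (L.map Prod.snd).map List.ofFn ∧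
      IsEchelon L ∧
      ∀ y, y ∈ Submodule.span K {x | x ∈ L.map Prod.snd} ↔
        ((0 : Fin m → K), y) ∈ Submodule.span K {p | p ∈ l} := by
  obtain ⟨L, h1, hL, hspan⟩ := gaussJordan_spec (l.map fun p => Fin.append p.1 p.2)
  have hzero : ∀ a ∈ L, (∀ i : Fin m, a.2 (Fin.castAdd d i) = 0) ↔ m ≤ a.1.1 := by
    intro a ha
    constructor
    · intro h
      by_contra hlt
      have h2 := hL.pivot a ha a ha
      rw [if_pos rfl] at h2
      have h3 := h ⟨a.1.1, by omega⟩
      exact one_ne_zero (h2.symm.trans h3)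
    · intro h i
      exact hL.lead a ha _ (by
        rw [Fin.lt_def, Fin.val_castAdd]
        exact lt_of_lt_of_le i.2 h)
  have hmem : ∀ b, b ∈ L.filterMap (dropPivot m) ↔
      ∃ a ∈ L, a.1 = Fin.natAdd m b.1 ∧ b.2 = fun i => a.2 (Fin.natAdd m i) := by
    intro b
    simp only [List.mem_filterMap, dropPivot_eq_some]
  refine ⟨L.filterMap (dropPivot m), ?_, ⟨?_, ?_, ?_⟩, ?_⟩
  · unfold solve
    have e : ((l.map fun p => (List.ofFn p.1, List.ofFn p.2)).map fun p => p.1 ++ p.2) =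
        (l.map fun p => Fin.append p.1 p.2).map List.ofFn := by
      simp [List.ofFn_fin_append]
    rw [e, h1]
    clear h1 hspan hmem hL
    induction L with
    | nil => rfl
    | cons a L ih =>
      have ih := ih fun b hb => hzero b (List.mem_cons_of_mem _ hb)
      have ha := hzero a List.mem_cons_self
      simp only [List.map_cons, List.filter_cons, all_range_getD_ofFn, ha, List.filterMap_cons]
      by_cases h : m ≤ a.1.1
      · simp only [h, decide_true, if_true, List.map_cons, dropPivot, dite_true, drop_ofFn]
        rw [ih]
      · simp only [h, decide_false, dropPivot, dite_false]
        exact ih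
  · rw [List.pairwise_filterMap]
    refine hL.sorted.imp ?_
    intro a a' haa b hb b' hb'
    rw [dropPivot_eq_some] at hb hb'
    rw [hb.1, hb'.1] at haa
    simpa using haa
  · intro b hb b' hb'
    obtain ⟨a, ha, h2, h3⟩ := (hmem b).mp hb
    obtain ⟨a', ha', h2', h3'⟩ := (hmem b').mp hb'
    rw [h3]
    simp only
    rw [← h2', hL.pivot a ha a' ha', h2, h2']
    simp
  · intro b hb r hr
    obtain ⟨a, ha, h2, h3⟩ := (hmem b).mp hb
    rw [h3]
    exact hL.lead a ha _ (by rw [h2]; simpa using hr)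
  · -- Concatenation as a linear equivalence.
    let e : ((Fin m → K) × (Fin d → K)) →ₗ[K] (Fin (m + d) → K) :=
      { toFun := fun p => Fin.append p.1 p.2
        map_add' := by
          intro p q; funext i
          refine Fin.addCases (fun i => ?_) (fun i => ?_) i <;> simp
        map_smul' := by
          intro c p; funext i
          refine Fin.addCases (fun i => ?_) (fun i => ?_) i <;> simp }
    have he : Function.Injective e := by
      rintro ⟨p1, p2⟩ ⟨q1, q2⟩ h
      have h' : ∀ i, Fin.append p1 p2 i = Fin.append q1 q2 i := fun i => congrFun h i
      refine Prod.ext (funext fun i => ?_) (funext fun i => ?_)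
      · simpa using h' (Fin.castAdd d i)
      · simpa using h' (Fin.natAdd m i)
    let π : (Fin (m + d) → K) →ₗ[K] (Fin d → K) := LinearMap.funLeft K K (Fin.natAdd m)
    have hmap : Submodule.span K {x | x ∈ L.map Prod.snd} = (Submodule.span K {p | p ∈ l}).map e := by
      rw [hspan, Submodule.map_span]
      congr 1
      ext x
      simp [e]
    have hiff : ∀ y, ((0 : Fin m → K), y) ∈ Submodule.span K {p | p ∈ l} ↔
        Fin.append 0 y ∈ Submodule.span K {x | x ∈ L.map Prod.snd} := by
      intro y
      rw [hmap]
      constructor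
      · intro h; exact ⟨_, h, rfl⟩
      · rintro ⟨p, hp, hpe⟩
        rwa [← he (a₁ := p) (a₂ := (0, y)) hpe]
    intro y
    rw [hiff]
    constructor
    · intro hy
      induction hy using Submodule.span_induction with
      | mem x hx =>
        obtain ⟨b, hb, rfl⟩ := List.mem_map.mp hx
        obtain ⟨a, ha, h2, h3⟩ := (hmem b).mp hb
        have : Fin.append (0 : Fin m → K) b.2 = a.2 := by
          funext i
          refine Fin.addCases (fun i => ?_) (fun i => ?_) i
          · rw [(hzero a ha).mpr (by rw [h2]; simp) i]; simp
          · rw [h3]; simp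
        rw [this]
        exact Submodule.subset_span (List.mem_map.mpr ⟨a, ha, rfl⟩)
      | zero =>
        have : Fin.append (0 : Fin m → K) (0 : Fin d → K) = 0 := e.map_zero
        rw [this]; exact zero_mem _
      | add x y _ _ hx hy =>
        have : Fin.append (0 : Fin m → K) (x + y) = Fin.append 0 x + Fin.append 0 y := by
          have := e.map_add (0, x) (0, y)
          simpa [e] using this
        rw [this]; exact add_mem hx hy
      | smul c x _ hx =>
        have : Fin.append (0 : Fin m → K) (c • x) = c • Fin.append 0 x := by
          have := e.map_smul c (0, x)
          simpa [e] using this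
        rw [this]; exact Submodule.smul_mem _ _ hx
    · intro hy
      have h2 := hL.mem_span_filter m _ hy (fun i hi => by
        have : i = Fin.castAdd d ⟨i, hi⟩ := rfl
        rw [this, Fin.append_left]; rfl)
      have h3 : π (Fin.append 0 y) = y := by
        funext i; simp [π, LinearMap.funLeft]
      rw [← h3]
      have h4 := Submodule.mem_map_of_mem (f := π) h2
      rw [Submodule.map_span] at h4
      refine Submodule.span_mono ?_ h4
      rintro _ ⟨_, ⟨a, ha, rfl, hm⟩, rfl⟩
      refine List.mem_map.mpr ⟨(⟨a.1.1 - m, by have := a.1.2; omega⟩, π a.2), ?_, rfl⟩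
      rw [hmem]
      refine ⟨a, ha, Fin.ext ?_, rfl⟩
      simp [hm]

end GaussSpec

section GaussMap

variable {K F : Type} [Field K] [DecidableEq K] [Field F] [DecidableEq F] (f : K →+* F)

lemma getD_map_ringHom {K F : Type} [Field K] [Field F] (f : K →+* F) (l : List K) (i : ℕ) :
    (l.map f).getD i 0 = f (l.getD i 0) := by
  have := List.getD_map (l := l) (n := i) (d := (0 : K)) f
  rwa [map_zero] at this

lemma gaussStep_map (P R : List (List K)) (c : ℕ) :
    gaussStep (P.map (List.map f), R.map (List.map f)) c =
      Prod.map (List.map (List.map f)) (List.map (List.map f)) (gaussStep (P, R) c) := by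
  have hp : ((fun r : List F => decide (r.getD c 0 ≠ 0)) ∘ List.map f) =
      fun r : List K => decide (r.getD c 0 ≠ 0) := by
    funext r; simp only [Function.comp, getD_map_ringHom, map_ne_zero]
  unfold gaussStep
  simp only [List.find?_map, hp]
  cases h : R.find? (fun r => decide (r.getD c 0 ≠ 0)) with
  | none => rfl
  | some p =>
    simp only [Option.map_some, Prod.map, List.map_append, List.map_map, List.map_cons,
      List.map_nil, Function.comp_def, getD_map_ringHom, List.map_zipWith,
      List.zipWith_map_left, List.zipWith_map_right, map_sub, map_mul, map_div₀]

lemma gaussJordan_map (rows : List (List K)) :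
    gaussJordan (rows.map (List.map f)) = (gaussJordan rows).map (List.map f) := by
  have hfold : ∀ (cs : List ℕ) (st : List (List K) × List (List K)),
      cs.foldl gaussStep (Prod.map (List.map (List.map f)) (List.map (List.map f)) st) =
        Prod.map (List.map (List.map f)) (List.map (List.map f)) (cs.foldl gaussStep st) := by
    intro cs
    induction cs with
    | nil => intro st; rfl
    | cons c cs ih =>
      intro st
      simp only [List.foldl_cons]
      rw [← ih]
      congr 1
      exact gaussStep_map f st.1 st.2 c
  unfold gaussJordan
  have hlen : (rows.map (List.map f)).map List.length = rows.map List.length := by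
    simp [Function.comp_def]
  rw [hlen]
  exact congrArg Prod.fst (hfold _ ([], rows))

/-- Gauss elimination is compatible with field extensions. -/
lemma solve_map (m : ℕ) (l : List (List K × List K)) :
    solve m (l.map (Prod.map (List.map f) (List.map f))) = (solve m l).map (List.map f) := by
  unfold solve
  have e : (l.map (Prod.map (List.map f) (List.map f))).map (fun p => p.1 ++ p.2) =
      (l.map fun p => p.1 ++ p.2).map (List.map f) := by
    simp
  rw [e, gaussJordan_map, List.filter_map, List.map_map, List.map_map]
  have hp : ((fun r : List F => (List.range m).all fun i => decide (r.getD i 0 = 0)) ∘ List.map f) =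
      fun r : List K => (List.range m).all fun i => decide (r.getD i 0 = 0) := by
    funext r; simp only [Function.comp, getD_map_ringHom, map_eq_zero]
  rw [hp]
  refine List.map_congr_left fun r _ => ?_
  simp

end GaussMap

end AbelianExp

/-! ### The algorithm on lists of complex numbers -/

namespace AbelianExp

noncomputable section Algorithm

/-- The row vector `x A - t x`, for a matrix `A` of size `n`. -/
def shiftRow (n : ℕ) (A : List (List ℂ)) (t : ℂ) (x : List ℂ) : List ℂ :=
  (List.range n).map fun k =>
    ((List.range n).map fun i => x.getD i 0 * (A.getD i []).getD k 0).sum + -(t * x.getD k 0)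

/-- The zero vector of length `n`. -/
def zeroRow (n : ℕ) : List ℂ := (List.range n).map fun _ => 0

/-- The rows of the unit matrix of size `n`. -/
def unitRows (n : ℕ) : List (List ℂ) :=
  (List.range n).map fun i => (List.range n).map fun k => (zeroRow i ++ [1]).getD k 0

/-- A basis of the space of all `u` in the span of `U` such that `u A - t u` lies in the span
of `W`. -/
def refine (n : ℕ) (A : List (List ℂ)) (t : ℂ) (W U : List (List ℂ)) : List (List ℂ) :=
  solve n (U.map (fun u => (shiftRow n A t u, u)) ++ W.map fun w => (w, zeroRow n))

/-- A basis of the space of all `u` such that `u A_j - χ_j u` lies in the span of `W`, for all `j`. -/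
def candidates (n : ℕ) (As : List (List (List ℂ))) (χ : List ℂ) (W : List (List ℂ)) :
    List (List ℂ) :=
  (List.range As.length).foldr (fun j U => refine n (As.getD j []) (χ.getD j 0) W U) (unitRows n)

/-- Whether `u` lies outside the span of `W`: in this case no multiple of `u` but `0` does. -/
def isNew (n : ℕ) (W : List (List ℂ)) (u : List ℂ) : Bool :=
  (solve n ((u, [1]) :: W.map fun w => (w, [0]))).isEmpty

/-- Extend the list `W` by a maximal independent set of candidates. -/
def extend (n : ℕ) (As : List (List (List ℂ))) (χ : List ℂ) (W : List (List ℂ)) : List (List ℂ) :=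
  (candidates n As χ W).foldr (fun u W' => if isNew n W' u = true then u :: W' else W') W

/-- A basis of the joint generalized eigenspace for `χ` in which the matrices are triangular. For `k`
matrices of size `n`, the flag is complete after `k n + 1` steps. -/
def block (n : ℕ) (As : List (List (List ℂ))) (χ : List ℂ) : List (List ℂ) :=
  extend n As χ ((fun W => (extend n As χ)^[As.length] W)^[n] [])

/-- Whether two lists of length `k` coincide up to complex conjugation. -/
def sameUpToConj (k : ℕ) (χ χ' : List ℂ) : Bool :=
  ((List.range k).all fun j => decide (χ.getD j 0 = χ'.getD j 0)) ||
    (List.range k).all fun j =>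
      decide (χ.getD j 0 = ((χ'.getD j 0).re : ℂ) + -(Complex.I * ((χ'.getD j 0).im : ℂ)))

/-- Keep one representative for every pair of conjugate lists. -/
def reps (k : ℕ) (l : List (List ℂ)) : List (List ℂ) :=
  l.foldr (fun χ r => if r.any (fun χ' => sameUpToConj k χ χ') = true then r else χ :: r) []

/-- Whether one of the first `k` entries is not real. -/
def isCplx (k : ℕ) (χ : List ℂ) : Bool :=
  (List.range k).any fun j => !decide (((χ.getD j 0).im : ℂ) = 0)

/-- The nonzero joint generalized eigenspaces up to conjugation, each with its eigenvalues. -/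
def eigenBlocks (n : ℕ) (As : List (List (List ℂ))) (σs : List (List ℂ)) :
    List (List ℂ × List (List ℂ)) :=
  ((reps As.length σs.sections).map fun χ => (χ, block n As χ)).filter fun b => !b.2.isEmpty

/-- The real parts of the entries. -/
def reRow (x : List ℂ) : List ℂ := x.map fun z => (z.re : ℂ)

/-- The imaginary parts of the entries. -/
def imRow (x : List ℂ) : List ℂ := x.map fun z => (z.im : ℂ)

/-- The rows of the base change matrix. -/
def baseRows (k : ℕ) (bs : List (List ℂ × List (List ℂ))) : List (List ℂ) :=
  bs.flatMap fun b => b.2.flatMap fun ξ =>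
    if isCplx k b.1 = true then [reRow ξ, imRow ξ] else [reRow ξ]

/-- The fields and the sizes of the blocks. -/
def shape (k : ℕ) (bs : List (List ℂ × List (List ℂ))) : List (Bool × ℕ) :=
  bs.map fun b => (isCplx k b.1, b.2.length)

/-- The real and imaginary parts of all `ξ A - i Im(χ_j) ξ`: they vanish if and only if `A` acts on
every block by the scalar `i Im(χ_j)`. -/
def defect (n : ℕ) (bs : List (List ℂ × List (List ℂ))) (j : ℕ) (A : List (List ℂ)) : List ℂ :=
  bs.flatMap fun b => b.2.flatMap fun ξ =>
    reRow (shiftRow n A (Complex.I * ((b.1.getD j 0).im : ℂ)) ξ) ++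
      imRow (shiftRow n A (Complex.I * ((b.1.getD j 0).im : ℂ)) ξ)

/-- The echelon basis of `𝔥₀`. -/
def angles (n : ℕ) (As : List (List (List ℂ))) (bs : List (List ℂ × List (List ℂ))) :
    List (List ℂ) :=
  solve (defect n bs 0 []).length ((List.range As.length).map fun j =>
    (defect n bs j (As.getD j []), bs.map fun b => ((b.1.getD j 0).im : ℂ)))

end Algorithm

/-! ### The algorithm as a program -/

/-!
A program whose name ends in `P` takes programs for its arguments, all of them in the same context,
and computes the function of the same name of their values. The lemma `eval_fooP` says so.
-/

namespace Prog

/-- Programs in a context that is extended by one variable. -/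
def up {a b c : Ty} (p : Prog a b) : Prog (.prod a c) b := .comp p .fst

@[simp] lemma eval_up {a b c : Ty} (p : Prog a b) (x : (Ty.prod a c).Val) :
    (up (c := c) p).eval x = p.eval x.1 := by simp [up, eval]

/-- The last variable of the context. -/
def var {a c : Ty} : Prog (.prod a c) c := .snd

@[simp] lemma eval_var {a c : Ty} (x : (Ty.prod a c).Val) :
    (var : Prog (.prod a c) c).eval x = x.2 := by simp [var, eval]

section Basic

variable {a b c : Ty}

def consP (h : Prog a c) (t : Prog a (.list c)) : Prog a (.list c) := .comp .cons (.pair h t)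

@[simp] lemma eval_consP (h : Prog a c) (t : Prog a (.list c)) (x : a.Val) :
    (consP h t).eval x = (h.eval x :: t.eval x : List c.Val) := by simp [consP, eval]

@[simp] lemma eval_nilP (x : a.Val) : (Prog.nil : Prog a (.list c)).eval x = ([] : List c.Val) := by
  simp [eval]

@[simp] lemma eval_pairP (f : Prog a b) (g : Prog a c) (x : a.Val) :
    (Prog.pair f g).eval x = (f.eval x, g.eval x) := by simp [eval]

@[simp] lemma eval_cond (t : Prog a .bool) (f g : Prog a b) (x : a.Val) :
    (Prog.cond t f g).eval x = if t.eval x = true then f.eval x else g.eval x := by simp [eval]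

@[simp] lemma eval_numZero (x : a.Val) : (Prog.numZero : Prog a .num).eval x = (0 : ℂ) := by
  simp [eval]

@[simp] lemma eval_numOne (x : a.Val) : (Prog.numOne : Prog a .num).eval x = (1 : ℂ) := by
  simp [eval]

@[simp] lemma eval_numI (x : a.Val) : (Prog.numI : Prog a .num).eval x = Complex.I := by
  simp [eval]

@[simp] lemma eval_tt (x : a.Val) : (Prog.tt : Prog a .bool).eval x = true := by simp [eval]

@[simp] lemma eval_ff (x : a.Val) : (Prog.ff : Prog a .bool).eval x = false := by simp [eval]

@[simp] lemma eval_zero (x : a.Val) : (Prog.zero : Prog a .nat).eval x = (0 : ℕ) := by simp [eval]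

def fstP (p : Prog a (.prod b c)) : Prog a b := .comp .fst p

@[simp] lemma eval_fstP (p : Prog a (.prod b c)) (x : a.Val) :
    (fstP p).eval x = (p.eval x).1 := by simp [fstP, eval]

def sndP (p : Prog a (.prod b c)) : Prog a c := .comp .snd p

@[simp] lemma eval_sndP (p : Prog a (.prod b c)) (x : a.Val) :
    (sndP p).eval x = (p.eval x).2 := by simp [sndP, eval]

def succP (p : Prog a .nat) : Prog a .nat := .comp .succ p

@[simp] lemma eval_succP (p : Prog a .nat) (x : a.Val) :
    (succP p).eval x = (p.eval x + 1 : ℕ) := by simp [succP, eval]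

def addP (p q : Prog a .num) : Prog a .num := .comp .add (.pair p q)

@[simp] lemma eval_addP (p q : Prog a .num) (x : a.Val) :
    (addP p q).eval x = (p.eval x + q.eval x : ℂ) := by simp [addP, eval]

def mulP (p q : Prog a .num) : Prog a .num := .comp .mul (.pair p q)

@[simp] lemma eval_mulP (p q : Prog a .num) (x : a.Val) :
    (mulP p q).eval x = (p.eval x * q.eval x : ℂ) := by simp [mulP, eval]

def negP (p : Prog a .num) : Prog a .num := .comp .neg p

@[simp] lemma eval_negP (p : Prog a .num) (x : a.Val) :
    (negP p).eval x = (-(show ℂ from p.eval x) : ℂ) := by simp [negP, eval]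

def reP (p : Prog a .num) : Prog a .num := .comp .re p

@[simp] lemma eval_reP (p : Prog a .num) (x : a.Val) :
    (reP p).eval x = ((Complex.re (p.eval x) : ℝ) : ℂ) := by simp [reP, eval]

def imP (p : Prog a .num) : Prog a .num := .comp .im p

@[simp] lemma eval_imP (p : Prog a .num) (x : a.Val) :
    (imP p).eval x = ((Complex.im (p.eval x) : ℝ) : ℂ) := by simp [imP, eval]

def eqP (p q : Prog a .num) : Prog a .bool := .comp .eqTest (.pair p q)

@[simp] lemma eval_eqP (p q : Prog a .num) (x : a.Val) :
    (eqP p q).eval x = decide ((p.eval x : ℂ) = q.eval x) := rfl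

def notP (p : Prog a .bool) : Prog a .bool := .cond p .ff .tt

@[simp] lemma eval_notP (p : Prog a .bool) (x : a.Val) :
    (notP p).eval x = (!(show Bool from p.eval x) : Bool) := by
  cases h : p.eval x <;> simp [notP, h]

def orP (p q : Prog a .bool) : Prog a .bool := .cond p .tt q

@[simp] lemma eval_orP (p q : Prog a .bool) (x : a.Val) :
    (orP p q).eval x = (p.eval x || q.eval x : Bool) := by
  cases h : p.eval x <;> simp [orP, h]

end Basic

section Lists

variable {a b c : Ty}

/-- `List.foldr`; the step sees the list element and, as the last variable, the accumulator. -/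
def foldrP (l : Prog a (.list c)) (init : Prog a b) (step : Prog (.prod (.prod a c) b) b) :
    Prog a b :=
  .listRec l init (.comp step
    (.pair (.pair .fst (.comp .fst .snd)) (.comp .snd (.comp .snd .snd))))

@[simp] lemma eval_foldrP (l : Prog a (.list c)) (init : Prog a b)
    (step : Prog (.prod (.prod a c) b) b) (x : a.Val) :
    (foldrP l init step).eval x =
      List.foldr (fun h y => step.eval ((x, h), y)) (init.eval x) (l.eval x) := by
  simp only [foldrP, eval]
  generalize l.eval x = l'
  induction l' with
  | nil => rfl
  | cons h t ih => simp only [List.foldr_cons, ← ih]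

def iterP (m : Prog a .nat) (init : Prog a b) (step : Prog (.prod a b) b) : Prog a b :=
  .natRec m init (.comp step (.pair .fst (.comp .snd .snd)))

@[simp] lemma eval_iterP (m : Prog a .nat) (init : Prog a b) (step : Prog (.prod a b) b)
    (x : a.Val) :
    (iterP m init step).eval x = (fun y => step.eval (x, y))^[m.eval x] (init.eval x) := by
  simp only [iterP, eval]
  generalize m.eval x = m'
  induction m' with
  | zero => rfl
  | succ m' ih => rw [Function.iterate_succ_apply', ← ih]

def mapP (l : Prog a (.list c)) (f : Prog (.prod a c) b) : Prog a (.list b) :=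
  foldrP l .nil (consP (up f) var)

@[simp] lemma eval_mapP (l : Prog a (.list c)) (f : Prog (.prod a c) b) (x : a.Val) :
    (mapP l f).eval x = List.map (fun y => f.eval (x, y)) (l.eval x) := by
  simp only [mapP, eval_foldrP, eval_consP, eval_up, eval_var, eval_nilP]
  generalize l.eval x = l'
  induction l' with
  | nil => rfl
  | cons h t ih => simp only [List.foldr_cons, List.map_cons, ih]

def appendP (l l' : Prog a (.list c)) : Prog a (.list c) :=
  foldrP l l' (consP (up var) var)

@[simp] lemma eval_appendP (l l' : Prog a (.list c)) (x : a.Val) :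
    (appendP l l').eval x = (l.eval x ++ l'.eval x : List c.Val) := by
  simp only [appendP, eval_foldrP, eval_consP, eval_up, eval_var]
  exact List.foldr_cons_eq_append'

def flatMapP (l : Prog a (.list c)) (f : Prog (.prod a c) (.list b)) : Prog a (.list b) :=
  foldrP l .nil (appendP (up f) var)

@[simp] lemma eval_flatMapP (l : Prog a (.list c)) (f : Prog (.prod a c) (.list b)) (x : a.Val) :
    (flatMapP l f).eval x = List.flatMap (fun y => f.eval (x, y)) (l.eval x) := by
  simp only [flatMapP, eval_foldrP, eval_appendP, eval_up, eval_var, eval_nilP]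
  generalize l.eval x = l'
  induction l' with
  | nil => rfl
  | cons h t ih => simp only [List.foldr_cons, List.flatMap_cons, ih]

def filterP (l : Prog a (.list c)) (f : Prog (.prod a c) .bool) : Prog a (.list c) :=
  foldrP l .nil (.cond (up f) (consP (up var) var) var)

@[simp] lemma eval_filterP (l : Prog a (.list c)) (f : Prog (.prod a c) .bool) (x : a.Val) :
    (filterP l f).eval x = List.filter (fun y => f.eval (x, y)) (l.eval x) := by
  simp only [filterP, eval_foldrP, eval_cond, eval_consP, eval_up, eval_var, eval_nilP]
  generalize l.eval x = l'
  induction l' with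
  | nil => rfl
  | cons h t ih => simp only [List.foldr_cons, List.filter_cons, ih]

def allP (l : Prog a (.list c)) (f : Prog (.prod a c) .bool) : Prog a .bool :=
  foldrP l .tt (.cond (up f) var .ff)

@[simp] lemma eval_allP (l : Prog a (.list c)) (f : Prog (.prod a c) .bool) (x : a.Val) :
    (allP l f).eval x = List.all (l.eval x) (fun y => f.eval (x, y)) := by
  simp only [allP, eval_foldrP, eval_cond, eval_ff, eval_up, eval_var, eval_tt]
  generalize l.eval x = l'
  induction l' with
  | nil => rfl
  | cons h t ih =>
    simp only [List.foldr_cons, List.all_cons, ih]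
    cases f.eval (x, h) <;> simp

def anyP (l : Prog a (.list c)) (f : Prog (.prod a c) .bool) : Prog a .bool :=
  foldrP l .ff (.cond (up f) .tt var)

@[simp] lemma eval_anyP (l : Prog a (.list c)) (f : Prog (.prod a c) .bool) (x : a.Val) :
    (anyP l f).eval x = List.any (l.eval x) (fun y => f.eval (x, y)) := by
  simp only [anyP, eval_foldrP, eval_cond, eval_ff, eval_up, eval_var, eval_tt]
  generalize l.eval x = l'
  induction l' with
  | nil => rfl
  | cons h t ih =>
    simp only [List.foldr_cons, List.any_cons, ih]
    cases f.eval (x, h) <;> simp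

def isEmptyP (l : Prog a (.list c)) : Prog a .bool := foldrP l .tt .ff

@[simp] lemma eval_isEmptyP (l : Prog a (.list c)) (x : a.Val) :
    (isEmptyP l).eval x = List.isEmpty (l.eval x) := by
  simp only [isEmptyP, eval_foldrP, eval_ff, eval_tt]
  cases l.eval x <;> rfl

def lengthP (l : Prog a (.list c)) : Prog a .nat := foldrP l .zero (succP var)

@[simp] lemma eval_lengthP (l : Prog a (.list c)) (x : a.Val) :
    (lengthP l).eval x = List.length (l.eval x) := by
  simp only [lengthP, eval_foldrP, eval_succP, eval_var, eval_zero]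
  generalize l.eval x = l'
  induction l' with
  | nil => rfl
  | cons h t ih => simp only [List.foldr_cons, List.length_cons, ih]

def sumP (l : Prog a (.list .num)) : Prog a .num := foldrP l .numZero (addP (up var) var)

@[simp] lemma eval_sumP (l : Prog a (.list .num)) (x : a.Val) :
    (sumP l).eval x = List.sum (α := ℂ) (l.eval x) := by
  simp only [sumP, eval_foldrP, eval_addP, eval_var, eval_up, eval_numZero]
  rfl

def rangeP (m : Prog a .nat) : Prog a (.list .nat) :=
  .natRec m .nil (appendP (.comp .snd .snd) (consP (.comp .fst .snd) .nil))

@[simp] lemma eval_rangeP (m : Prog a .nat) (x : a.Val) :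
    (rangeP m).eval x = List.range (m.eval x) := by
  simp only [rangeP, eval, eval_appendP, eval_consP]
  generalize m.eval x = m'
  induction m' with
  | zero => rfl
  | succ m' ih => simp only [ih, List.range_succ]

def tailP (l : Prog a (.list c)) : Prog a (.list c) :=
  .listRec l .nil (.comp .fst (.comp .snd .snd))

@[simp] lemma eval_tailP (l : Prog a (.list c)) (x : a.Val) :
    (tailP l).eval x = List.tail (l.eval x) := by
  simp only [tailP, eval]
  cases l.eval x <;> rfl

def dropP (m : Prog a .nat) (l : Prog a (.list c)) : Prog a (.list c) := iterP m l (tailP var)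

@[simp] lemma eval_dropP (m : Prog a .nat) (l : Prog a (.list c)) (x : a.Val) :
    (dropP m l).eval x = List.drop (m.eval x) (l.eval x) := by
  simp only [dropP, eval_iterP, eval_tailP, eval_var]
  generalize m.eval x = m'
  generalize l.eval x = l'
  induction m' with
  | zero => rfl
  | succ m' ih => rw [Function.iterate_succ_apply', ih, List.tail_drop]

def getDP (l : Prog a (.list c)) (m : Prog a .nat) (d : Prog a c) : Prog a c :=
  foldrP (dropP m l) d (up var)

@[simp] lemma eval_getDP (l : Prog a (.list c)) (m : Prog a .nat) (d : Prog a c) (x : a.Val) :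
    (getDP l m d).eval x = List.getD (l.eval x) (m.eval x) (d.eval x) := by
  simp only [getDP, eval_foldrP, eval_dropP, eval_up, eval_var]
  generalize m.eval x = m'
  generalize l.eval x = l'
  induction m' generalizing l' with
  | zero => cases l' <;> rfl
  | succ m' ih =>
    cases l' with
    | nil => rfl
    | cons h t => simpa using ih t

end Lists

section Algorithm

variable {a : Ty}

def solveP (m : Prog a .nat) (l : Prog a (.list (.prod (.list .num) (.list .num)))) :
    Prog a .mat :=
  mapP (filterP (.comp .gauss (mapP l (appendP (fstP var) (sndP var))))
    (allP (rangeP (up m)) (eqP (getDP (up var) var .numZero) .numZero))) (dropP (up m) var)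

@[simp] lemma eval_solveP (m : Prog a .nat)
    (l : Prog a (.list (.prod (.list .num) (.list .num)))) (x : a.Val) :
    (solveP m l).eval x = solve (m.eval x) (l.eval x) := by
  simp only [solveP, eval_mapP, eval_filterP, eval, eval_allP, eval_eqP, eval_getDP, eval_up,
    eval_var, eval_rangeP, eval_dropP, eval_appendP, eval_fstP, eval_sndP]
  rfl

def shiftRowP (n : Prog a .nat) (A : Prog a .mat) (t : Prog a .num) (v : Prog a (.list .num)) :
    Prog a (.list .num) :=
  mapP (rangeP n) (addP
    (sumP (mapP (rangeP (up n))
      (mulP (getDP (up (up v)) var .numZero) (getDP (getDP (up (up A)) var .nil) (up var) .numZero))))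
    (negP (mulP (up t) (getDP (up v) var .numZero))))

@[simp] lemma eval_shiftRowP (n : Prog a .nat) (A : Prog a .mat) (t : Prog a .num)
    (v : Prog a (.list .num)) (x : a.Val) :
    (shiftRowP n A t v).eval x = shiftRow (n.eval x) (A.eval x) (t.eval x) (v.eval x) := by
  simp [shiftRowP, shiftRow]

def zeroRowP (n : Prog a .nat) : Prog a (.list .num) := mapP (rangeP n) .numZero

@[simp] lemma eval_zeroRowP (n : Prog a .nat) (x : a.Val) :
    (zeroRowP n).eval x = zeroRow (n.eval x) := by
  simp [zeroRowP, zeroRow]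

def unitRowsP (n : Prog a .nat) : Prog a .mat :=
  mapP (rangeP n) (mapP (rangeP (up n))
    (getDP (appendP (zeroRowP (up var)) (consP .numOne .nil)) var .numZero))

@[simp] lemma eval_unitRowsP (n : Prog a .nat) (x : a.Val) :
    (unitRowsP n).eval x = unitRows (n.eval x) := by
  simp only [unitRowsP, unitRows, eval_mapP, eval_rangeP, eval_up, eval_getDP, eval_appendP,
    eval_zeroRowP, eval_var, eval_consP, eval_numOne, eval_nilP, eval_numZero]

def refineP (n : Prog a .nat) (A : Prog a .mat) (t : Prog a .num) (W U : Prog a .mat) :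
    Prog a .mat :=
  solveP n (appendP (mapP U (.pair (shiftRowP (up n) (up A) (up t) var) var))
    (mapP W (.pair var (zeroRowP (up n)))))

@[simp] lemma eval_refineP (n : Prog a .nat) (A : Prog a .mat) (t : Prog a .num)
    (W U : Prog a .mat) (x : a.Val) :
    (refineP n A t W U).eval x =
      refine (n.eval x) (A.eval x) (t.eval x) (W.eval x) (U.eval x) := by
  simp [refineP, refine]

def candidatesP (n : Prog a .nat) (As : Prog a (.list .mat)) (χ : Prog a (.list .num))
    (W : Prog a .mat) : Prog a .mat :=
  foldrP (rangeP (lengthP As)) (unitRowsP n)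
    (refineP (up (up n)) (getDP (up (up As)) (up var) .nil) (getDP (up (up χ)) (up var) .numZero)
      (up (up W)) var)

@[simp] lemma eval_candidatesP (n : Prog a .nat) (As : Prog a (.list .mat))
    (χ : Prog a (.list .num)) (W : Prog a .mat) (x : a.Val) :
    (candidatesP n As χ W).eval x =
      candidates (n.eval x) (As.eval x) (χ.eval x) (W.eval x) := by
  simp [candidatesP, candidates]

def isNewP (n : Prog a .nat) (W : Prog a .mat) (u : Prog a (.list .num)) : Prog a .bool :=
  isEmptyP (solveP n (consP (.pair u (consP .numOne .nil))
    (mapP W (.pair var (consP .numZero .nil)))))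

@[simp] lemma eval_isNewP (n : Prog a .nat) (W : Prog a .mat) (u : Prog a (.list .num))
    (x : a.Val) :
    (isNewP n W u).eval x = isNew (n.eval x) (W.eval x) (u.eval x) := by
  simp [isNewP, isNew]

def extendP (n : Prog a .nat) (As : Prog a (.list .mat)) (χ : Prog a (.list .num))
    (W : Prog a .mat) : Prog a .mat :=
  foldrP (candidatesP n As χ W) W
    (.cond (isNewP (up (up n)) var (up var)) (consP (up var) var) var)

@[simp] lemma eval_extendP (n : Prog a .nat) (As : Prog a (.list .mat))
    (χ : Prog a (.list .num)) (W : Prog a .mat) (x : a.Val) :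
    (extendP n As χ W).eval x = extend (n.eval x) (As.eval x) (χ.eval x) (W.eval x) := by
  simp [extendP, extend]

def blockP (n : Prog a .nat) (As : Prog a (.list .mat)) (χ : Prog a (.list .num)) : Prog a .mat :=
  extendP n As χ
    (iterP n .nil (iterP (lengthP (up As)) var (extendP (up (up n)) (up (up As)) (up (up χ)) var)))

@[simp] lemma eval_blockP (n : Prog a .nat) (As : Prog a (.list .mat))
    (χ : Prog a (.list .num)) (x : a.Val) :
    (blockP n As χ).eval x = block (n.eval x) (As.eval x) (χ.eval x) := by
  simp only [blockP, block, eval_iterP, eval_lengthP, eval_up, eval_var, eval_extendP, eval_nilP]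

def sectionsP (l : Prog a (.list (.list .num))) : Prog a (.list (.list .num)) :=
  foldrP l (consP .nil .nil) (flatMapP var (mapP (up (up var)) (consP var (up var))))

@[simp] lemma eval_sectionsP (l : Prog a (.list (.list .num))) (x : a.Val) :
    (sectionsP l).eval x = List.sections (α := ℂ) (l.eval x) := by
  simp only [sectionsP, eval_foldrP, eval_consP, eval_nilP, eval_flatMapP, eval_mapP, eval_up,
    eval_var]
  generalize l.eval x = l'
  induction l' with
  | nil => rfl
  | cons h t ih => simp only [List.foldr_cons, List.sections, ih]

def sameUpToConjP (k : Prog a .nat) (χ χ' : Prog a (.list .num)) : Prog a .bool :=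
  orP (allP (rangeP k) (eqP (getDP (up χ) var .numZero) (getDP (up χ') var .numZero)))
    (allP (rangeP k) (eqP (getDP (up χ) var .numZero)
      (addP (reP (getDP (up χ') var .numZero))
        (negP (mulP .numI (imP (getDP (up χ') var .numZero)))))))

@[simp] lemma eval_sameUpToConjP (k : Prog a .nat) (χ χ' : Prog a (.list .num)) (x : a.Val) :
    (sameUpToConjP k χ χ').eval x = sameUpToConj (k.eval x) (χ.eval x) (χ'.eval x) := by
  simp [sameUpToConjP, sameUpToConj]

def repsP (k : Prog a .nat) (l : Prog a (.list (.list .num))) : Prog a (.list (.list .num)) :=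
  foldrP l .nil (.cond (anyP var (sameUpToConjP (up (up (up k))) (up (up var)) var)) var
    (consP (up var) var))

@[simp] lemma eval_repsP (k : Prog a .nat) (l : Prog a (.list (.list .num))) (x : a.Val) :
    (repsP k l).eval x = reps (k.eval x) (l.eval x) := by
  simp [repsP, reps]

def isCplxP (k : Prog a .nat) (χ : Prog a (.list .num)) : Prog a .bool :=
  anyP (rangeP k) (notP (eqP (imP (getDP (up χ) var .numZero)) .numZero))

@[simp] lemma eval_isCplxP (k : Prog a .nat) (χ : Prog a (.list .num)) (x : a.Val) :
    (isCplxP k χ).eval x = isCplx (k.eval x) (χ.eval x) := by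
  simp only [isCplxP, isCplx, eval_anyP, eval_rangeP, eval_notP, eval_eqP, eval_imP, eval_getDP,
    eval_up, eval_var, eval_numZero]

/-- The type of a list of eigenvalues with a basis of the joint generalized eigenspace. -/
abbrev blockTy : Ty := .prod (.list .num) .mat

def eigenBlocksP (n : Prog a .nat) (As : Prog a (.list .mat)) (σs : Prog a (.list (.list .num))) :
    Prog a (.list blockTy) :=
  filterP (mapP (repsP (lengthP As) (sectionsP σs)) (.pair var (blockP (up n) (up As) var)))
    (notP (isEmptyP (sndP var)))

@[simp] lemma eval_eigenBlocksP (n : Prog a .nat) (As : Prog a (.list .mat))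
    (σs : Prog a (.list (.list .num))) (x : a.Val) :
    (eigenBlocksP n As σs).eval x = eigenBlocks (n.eval x) (As.eval x) (σs.eval x) := by
  simp [eigenBlocksP, eigenBlocks]

def reRowP (v : Prog a (.list .num)) : Prog a (.list .num) := mapP v (reP var)

@[simp] lemma eval_reRowP (v : Prog a (.list .num)) (x : a.Val) :
    (reRowP v).eval x = reRow (v.eval x) := by
  simp [reRowP, reRow]

def imRowP (v : Prog a (.list .num)) : Prog a (.list .num) := mapP v (imP var)

@[simp] lemma eval_imRowP (v : Prog a (.list .num)) (x : a.Val) :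
    (imRowP v).eval x = imRow (v.eval x) := by
  simp [imRowP, imRow]

def baseRowsP (k : Prog a .nat) (bs : Prog a (.list blockTy)) : Prog a .mat :=
  flatMapP bs (flatMapP (sndP var) (.cond (isCplxP (up (up k)) (fstP (up var)))
    (consP (reRowP var) (consP (imRowP var) .nil)) (consP (reRowP var) .nil)))

@[simp] lemma eval_baseRowsP (k : Prog a .nat) (bs : Prog a (.list blockTy)) (x : a.Val) :
    (baseRowsP k bs).eval x = baseRows (k.eval x) (bs.eval x) := by
  simp [baseRowsP, baseRows]

def shapeP (k : Prog a .nat) (bs : Prog a (.list blockTy)) : Prog a (.list (.prod .bool .nat)) :=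
  mapP bs (.pair (isCplxP (up k) (fstP var)) (lengthP (sndP var)))

@[simp] lemma eval_shapeP (k : Prog a .nat) (bs : Prog a (.list blockTy)) (x : a.Val) :
    (shapeP k bs).eval x = shape (k.eval x) (bs.eval x) := by
  simp [shapeP, shape]

def defectP (n : Prog a .nat) (bs : Prog a (.list blockTy)) (j : Prog a .nat) (A : Prog a .mat) :
    Prog a (.list .num) :=
  flatMapP bs (flatMapP (sndP var)
    (appendP
      (reRowP (shiftRowP (up (up n)) (up (up A))
        (mulP .numI (imP (getDP (fstP (up var)) (up (up j)) .numZero))) var))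
      (imRowP (shiftRowP (up (up n)) (up (up A))
        (mulP .numI (imP (getDP (fstP (up var)) (up (up j)) .numZero))) var))))

@[simp] lemma eval_defectP (n : Prog a .nat) (bs : Prog a (.list blockTy)) (j : Prog a .nat)
    (A : Prog a .mat) (x : a.Val) :
    (defectP n bs j A).eval x = defect (n.eval x) (bs.eval x) (j.eval x) (A.eval x) := by
  simp only [defectP, defect, eval_flatMapP, eval_appendP, eval_reRowP, eval_imRowP,
    eval_shiftRowP, eval_mulP, eval_imP, eval_getDP, eval_fstP, eval_sndP, eval_up, eval_var,
    eval_numI, eval_numZero]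

def anglesP (n : Prog a .nat) (As : Prog a (.list .mat)) (bs : Prog a (.list blockTy)) :
    Prog a .mat :=
  solveP (lengthP (defectP n bs .zero .nil)) (mapP (rangeP (lengthP As))
    (.pair (defectP (up n) (up bs) var (getDP (up As) var .nil))
      (mapP (up bs) (imP (getDP (fstP var) (up var) .numZero)))))

@[simp] lemma eval_anglesP (n : Prog a .nat) (As : Prog a (.list .mat))
    (bs : Prog a (.list blockTy)) (x : a.Val) :
    (anglesP n As bs).eval x = angles (n.eval x) (As.eval x) (bs.eval x) := by
  simp only [anglesP, angles, eval_solveP, eval_lengthP, eval_defectP, eval_zero, eval_nilP,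
    eval_mapP, eval_rangeP, eval_pairP, eval_up, eval_var, eval_getDP, eval_imP, eval_fstP,
    eval_numZero]

/-- The output as a function of the size, the matrices, and the blocks. -/
def outputP (n : Prog a .nat) (As : Prog a (.list .mat)) (bs : Prog a (.list blockTy)) :
    Prog a outputTy :=
  .pair (baseRowsP (lengthP As) bs) (.pair (shapeP (lengthP As) bs) (anglesP n As bs))

end Algorithm

/-- The program that computes the block decomposition and the echelon basis of `𝔥₀`. -/
def main : Prog inputTy outputTy :=
  outputP (fstP .id) (mapP (sndP .id) (fstP var))
    (eigenBlocksP (fstP .id) (mapP (sndP .id) (fstP var)) (mapP (sndP .id) (sndP var)))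

lemma eval_main (x : inputTy.Val) :
    main.eval x =
      let n : ℕ := x.1
      let As : List (List (List ℂ)) := List.map Prod.fst x.2
      let bs := eigenBlocks n As (List.map Prod.snd x.2)
      (baseRows As.length bs, (shape As.length bs, angles n As bs)) := by
  simp [main, outputP, eval]

end Prog

end AbelianExp

/-! ### Joint generalized eigenspaces of commuting endomorphisms -/

namespace AbelianExp

section Flag

variable {E : Type*} [AddCommGroup E] [Module ℂ E] {k : ℕ} (N : Fin k → Module.End ℂ E)

/-- The flag of the vectors which are annihilated by all products of `i` of the endomorphisms. -/
def flag : ℕ → Submodule ℂ E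
  | 0 => ⊥
  | i + 1 => ⨅ j, (flag i).comap (N j)

lemma mem_flag_succ {i : ℕ} {u : E} : u ∈ flag N (i + 1) ↔ ∀ j, N j u ∈ flag N i := by
  simp [flag]

lemma flag_mono (i : ℕ) : flag N i ≤ flag N (i + 1) := by
  induction i with
  | zero => exact bot_le
  | succ i ih =>
    intro u hu
    rw [mem_flag_succ] at hu ⊢
    exact fun j => ih (hu j)

/-- Each step of the flag consumes one of the `e j` factors of some `N j`. -/
lemma mem_flag_of_pow_eq_zero (hN : ∀ i j, Commute (N i) (N j)) (i : ℕ) (e : Fin k → ℕ)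
    (he : ∑ j, e j < i) (u : E) (hu : ∀ j, (N j ^ e j) u = 0) : u ∈ flag N i := by
  induction i generalizing e u with
  | zero => exact absurd he (Nat.not_lt_zero _)
  | succ i ih =>
    rw [mem_flag_succ]
    intro j
    by_cases hj : e j = 0
    · have h0 := hu j
      rw [hj, pow_zero, Module.End.one_apply] at h0
      rw [h0, map_zero]
      exact zero_mem _
    · refine ih (Function.update e j (e j - 1)) ?_ _ ?_
      · rw [Finset.sum_update_of_mem (Finset.mem_univ j)]
        rw [← Finset.add_sum_erase _ _ (Finset.mem_univ j)] at he
        rw [← Finset.erase_eq]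
        omega
      · intro l
        rw [← Module.End.mul_apply]
        by_cases hl : l = j
        · subst hl
          rw [Function.update_self, ← pow_succ, Nat.sub_add_cancel (Nat.pos_of_ne_zero hj)]
          exact hu l
        · rw [Function.update_of_ne hl, ((hN l j).pow_left (e l)).eq, Module.End.mul_apply, hu l,
            map_zero]

lemma exists_pow_eq_zero_of_mem_flag (i : ℕ) (u : E) (hu : u ∈ flag N i) (j : Fin k) :
    (N j ^ i) u = 0 := by
  induction i generalizing u with
  | zero => simpa [flag] using hu
  | succ i ih =>
    rw [mem_flag_succ] at hu
    rw [pow_succ, Module.End.mul_apply]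
    exact ih _ (hu j)

end Flag

section Weight

variable {n k : ℕ}

/-- Right multiplication of row vectors by a real matrix, as an endomorphism of `ℂ^n`. -/
noncomputable def rowEnd (A : Matrix (Fin n) (Fin n) ℝ) : Module.End ℂ (Fin n → ℂ) :=
  (A.map (algebraMap ℝ ℂ)).vecMulLinear

lemma rowEnd_apply (A : Matrix (Fin n) (Fin n) ℝ) (x : Fin n → ℂ) (i : Fin n) :
    rowEnd A x i = ∑ l, x l * (A l i : ℂ) := by
  simp [rowEnd, Matrix.vecMul, dotProduct]

lemma rowEnd_add (A B : Matrix (Fin n) (Fin n) ℝ) : rowEnd (A + B) = rowEnd A + rowEnd B := by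
  ext x i
  simp [rowEnd_apply, mul_add, Finset.sum_add_distrib]

lemma rowEnd_smul (c : ℝ) (A : Matrix (Fin n) (Fin n) ℝ) :
    rowEnd (c • A) = (c : ℂ) • rowEnd A := by
  apply LinearMap.ext
  intro x
  funext i
  simp [rowEnd_apply, Finset.mul_sum, mul_left_comm]

lemma rowEnd_mul (A B : Matrix (Fin n) (Fin n) ℝ) : rowEnd (A * B) = rowEnd B * rowEnd A := by
  apply LinearMap.ext
  intro x
  simp only [rowEnd, Module.End.mul_apply, Matrix.vecMulLinear_apply, Matrix.vecMul_vecMul]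
  rw [Matrix.map_mul]

/-- `x ↦ x A - t x`. -/
noncomputable def shiftEnd (A : Matrix (Fin n) (Fin n) ℝ) (t : ℂ) : Module.End ℂ (Fin n → ℂ) :=
  rowEnd A - t • (1 : Module.End ℂ (Fin n → ℂ))

lemma shiftEnd_apply (A : Matrix (Fin n) (Fin n) ℝ) (t : ℂ) (x : Fin n → ℂ) :
    shiftEnd A t x = rowEnd A x - t • x := rfl

lemma commute_rowEnd {A B : Matrix (Fin n) (Fin n) ℝ} (h : A * B = B * A) :
    Commute (rowEnd A) (rowEnd B) := by
  rw [commute_iff_eq, ← rowEnd_mul, ← rowEnd_mul, h]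

lemma commute_shiftEnd {A B : Matrix (Fin n) (Fin n) ℝ} (h : A * B = B * A) (s t : ℂ) :
    Commute (shiftEnd A s) (shiftEnd B t) := by
  have h1 : ∀ (c : ℂ) (f : Module.End ℂ (Fin n → ℂ)),
      Commute (c • (1 : Module.End ℂ (Fin n → ℂ))) f :=
    fun c f => (Commute.one_left f).smul_left c
  exact ((commute_rowEnd h).sub_right (h1 _ _).symm).sub_left ((h1 _ _).sub_right (h1 _ _))

/-- The joint generalized eigenspace of row vectors. -/
noncomputable def weightSpace (A : Fin k → Matrix (Fin n) (Fin n) ℝ) (χ : Fin k → ℂ) :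
    Submodule ℂ (Fin n → ℂ) :=
  ⨅ j, (rowEnd (A j)).maxGenEigenspace (χ j)

lemma mem_weightSpace {A : Fin k → Matrix (Fin n) (Fin n) ℝ} {χ : Fin k → ℂ} {u : Fin n → ℂ} :
    u ∈ weightSpace A χ ↔ ∀ j, ∃ e : ℕ, (shiftEnd (A j) (χ j) ^ e) u = 0 := by
  simp [weightSpace, shiftEnd]

/-- In dimension `n` the exponents of the `k` endomorphisms add up to at most `k n`, so that the flag
is complete after `k n + 1` steps. -/
lemma flag_eq_weightSpace (A : Fin k → Matrix (Fin n) (Fin n) ℝ)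
    (hA : ∀ i j, A i * A j = A j * A i) (χ : Fin k → ℂ) :
    flag (fun j => shiftEnd (A j) (χ j)) (k * n + 1) = weightSpace A χ := by
  apply le_antisymm
  · intro u hu
    rw [mem_weightSpace]
    exact fun j => ⟨_, exists_pow_eq_zero_of_mem_flag _ _ _ hu j⟩
  · intro u hu
    refine mem_flag_of_pow_eq_zero _ (fun i j => commute_shiftEnd (hA i j) _ _) _ (fun _ => n)
      (by simp) u fun j => ?_
    have h1 : u ∈ (rowEnd (A j)).maxGenEigenspace (χ j) := (Submodule.mem_iInf _).mp hu j
    rw [Module.End.maxGenEigenspace_eq_genEigenspace_finrank, Module.finrank_fin_fun,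
      Module.End.mem_genEigenspace_nat, LinearMap.mem_ker] at h1
    exact h1

lemma iSupIndep_weightSpace (A : Fin k → Matrix (Fin n) (Fin n) ℝ)
    (hA : ∀ i j, A i * A j = A j * A i) : iSupIndep (weightSpace A) :=
  Module.End.independent_iInf_maxGenEigenspace_of_forall_mapsTo _ fun i j φ =>
    Module.End.mapsTo_maxGenEigenspace_of_comm (commute_rowEnd (hA j i)) φ

lemma iSup_weightSpace (A : Fin k → Matrix (Fin n) (Fin n) ℝ)
    (hA : ∀ i j, A i * A j = A j * A i) : ⨆ χ, weightSpace A χ = ⊤ :=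
  Module.End.iSup_iInf_maxGenEigenspace_eq_top_of_forall_mapsTo _
    (fun i j φ => Module.End.mapsTo_maxGenEigenspace_of_comm (commute_rowEnd (hA j i)) φ)
    fun i => Module.End.iSup_maxGenEigenspace_eq_top (rowEnd (A i))

/-- The joint eigenvalues are eigenvalues. -/
lemma mem_spectrum_of_weightSpace_ne_bot {A : Fin k → Matrix (Fin n) (Fin n) ℝ} {χ : Fin k → ℂ}
    (h : weightSpace A χ ≠ ⊥) (j : Fin k) :
    χ j ∈ spectrum ℂ ((A j).map (algebraMap ℝ ℂ)) := by
  obtain ⟨u, hu, hu0⟩ := Submodule.exists_mem_ne_zero_of_ne_bot h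
  obtain ⟨e, he⟩ := mem_weightSpace.mp hu j
  by_contra hs
  rw [spectrum.notMem_iff] at hs
  have hinj : Function.Injective (shiftEnd (A j) (χ j)) := by
    have h1 := Matrix.vecMul_injective_of_isUnit hs
    intro x y hxy
    apply h1
    have h2 : ∀ z, Matrix.vecMul z (algebraMap ℂ (Matrix (Fin n) (Fin n) ℂ) (χ j) -
        (A j).map (algebraMap ℝ ℂ)) = -shiftEnd (A j) (χ j) z := by
      intro z
      rw [Matrix.vecMul_sub, shiftEnd_apply, neg_sub, Algebra.algebraMap_eq_smul_one,
        Matrix.vecMul_smul, Matrix.vecMul_one]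
      rfl
    simp only [h2, hxy]
  have h3 : Function.Injective (shiftEnd (A j) (χ j) ^ e) := by
    rw [Module.End.coe_pow]
    exact hinj.iterate e
  exact hu0 (h3 (by rw [he, map_zero]))

/-- Entrywise complex conjugation. -/
noncomputable def conjVec (x : Fin n → ℂ) : Fin n → ℂ := fun i => starRingEnd ℂ (x i)

lemma conjVec_conjVec (x : Fin n → ℂ) : conjVec (conjVec x) = x := by
  funext i; simp [conjVec]

lemma conjVec_shiftEnd (A : Matrix (Fin n) (Fin n) ℝ) (t : ℂ) (x : Fin n → ℂ) :
    conjVec (shiftEnd A t x) = shiftEnd A (starRingEnd ℂ t) (conjVec x) := by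
  funext i
  simp [conjVec, shiftEnd_apply, rowEnd_apply]

lemma conjVec_mem_weightSpace {A : Fin k → Matrix (Fin n) (Fin n) ℝ} {χ : Fin k → ℂ}
    {u : Fin n → ℂ} (hu : u ∈ weightSpace A χ) :
    conjVec u ∈ weightSpace A (fun j => starRingEnd ℂ (χ j)) := by
  rw [mem_weightSpace] at hu ⊢
  intro j
  obtain ⟨e, he⟩ := hu j
  refine ⟨e, ?_⟩
  have : ∀ (e : ℕ) (u : Fin n → ℂ), (shiftEnd (A j) (starRingEnd ℂ (χ j)) ^ e) (conjVec u) =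
      conjVec ((shiftEnd (A j) (χ j) ^ e) u) := by
    intro e
    induction e with
    | zero => intro u; rfl
    | succ e ih =>
      intro u
      rw [pow_succ, pow_succ, Module.End.mul_apply, Module.End.mul_apply, ← conjVec_shiftEnd, ih]
  rw [this, he]
  funext i; simp [conjVec]

end Weight

end AbelianExp

/-! ### What the list operations compute -/

namespace AbelianExp

section Lists

variable {n k : ℕ}

/-- The span of a list of vectors. -/
def listSpan {K V : Type} [Field K] [AddCommGroup V] [Module K V] (U : List V) : Submodule K V :=
  Submodule.span K {x | x ∈ U}

lemma listSpan_cons {V : Type} [AddCommGroup V] [Module ℂ V] (u : V) (U : List V) :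
    listSpan (K := ℂ) (u :: U) = Submodule.span ℂ {u} ⊔ listSpan U := by
  unfold listSpan
  rw [← Submodule.span_union]
  congr 1
  ext x
  simp

lemma getD_ofFn {α : Type} (x : Fin n → α) (i : Fin n) (d : α) : (List.ofFn x).getD i d = x i := by
  simp [List.getD]

lemma range_map_eq_ofFn {α : Type} (f : ℕ → α) :
    (List.range n).map f = List.ofFn fun i : Fin n => f i := by
  apply List.ext_getElem <;> simp

lemma shiftRow_ofFn (A : Matrix (Fin n) (Fin n) ℝ) (t : ℂ) (x : Fin n → ℂ) :
    shiftRow n (encodeMatrix A) t (List.ofFn x) = List.ofFn (shiftEnd A t x) := by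
  unfold shiftRow
  rw [range_map_eq_ofFn]
  congr 1
  funext i
  rw [range_map_eq_ofFn, List.sum_ofFn, getD_ofFn, shiftEnd_apply, Pi.sub_apply, rowEnd_apply,
    Pi.smul_apply, smul_eq_mul, ← sub_eq_add_neg]
  congr 1
  refine Finset.sum_congr rfl fun l _ => ?_
  have h : List.getD (encodeMatrix A) l [] = List.ofFn fun i => ((A l i : ℝ) : ℂ) :=
    getD_ofFn (fun l => List.ofFn fun i => ((A l i : ℝ) : ℂ)) l []
  rw [h, getD_ofFn, getD_ofFn]

lemma zeroRow_eq : zeroRow n = List.ofFn (0 : Fin n → ℂ) := by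
  unfold zeroRow
  rw [range_map_eq_ofFn]
  rfl

lemma unitRows_eq :
    unitRows n = (List.finRange n).map fun i => List.ofFn (Pi.single i (1 : ℂ) : Fin n → ℂ) := by
  unfold unitRows
  rw [range_map_eq_ofFn, ← List.ofFn_eq_map]
  congr 1
  funext i
  rw [range_map_eq_ofFn]
  congr 1
  funext j
  rcases lt_trichotomy j i with h | h | h
  · have h' : (j : ℕ) < i := h
    rw [Pi.single_eq_of_ne h.ne]
    simp [zeroRow, List.getD, List.getElem?_append, h']
  · subst h
    simp [zeroRow, List.getD]
  · have h' : (i : ℕ) < j := h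
    rw [Pi.single_eq_of_ne h.ne']
    have h3 : ¬ (j : ℕ) < i := by omega
    obtain ⟨m, hm⟩ : ∃ m, (j : ℕ) - i = m + 1 := ⟨j - i - 1, by omega⟩
    simp [zeroRow, List.getD, List.getElem?_append, h3, hm]

/-- All entries are real. -/
def IsRealVec {ι : Type} (x : ι → ℂ) : Prop := ∀ i, (x i).im = 0

/-- Elimination with real input has real output. -/
lemma solve_real (m : ℕ) (l : List (List ℂ × List ℂ))
    (hl : ∀ p ∈ l, (∀ z ∈ p.1, z.im = 0) ∧ ∀ z ∈ p.2, z.im = 0) :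
    ∀ r ∈ solve m l, ∀ z ∈ r, z.im = 0 := by
  have h1 : ∀ x : List ℂ, (∀ z ∈ x, z.im = 0) →
      (x.map Complex.re).map (Complex.ofRealHom : ℝ →+* ℂ) = x := by
    intro x hx
    rw [List.map_map]
    conv_rhs => rw [← List.map_id x]
    refine List.map_congr_left fun z hz => ?_
    exact Complex.ext (by simp) (by simp [hx z hz])
  have h2 : l = (l.map (Prod.map (List.map Complex.re) (List.map Complex.re))).map
      (Prod.map (List.map (Complex.ofRealHom : ℝ →+* ℂ))
        (List.map (Complex.ofRealHom : ℝ →+* ℂ))) := by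
    rw [List.map_map]
    conv_lhs => rw [← List.map_id l]
    refine List.map_congr_left fun p hp => ?_
    exact Prod.ext (h1 _ (hl p hp).1).symm (h1 _ (hl p hp).2).symm
  rw [h2, solve_map]
  intro r hr z hz
  obtain ⟨r', -, rfl⟩ := List.mem_map.mp hr
  obtain ⟨z', -, rfl⟩ := List.mem_map.mp hz
  simp

lemma refine_spec (A : Matrix (Fin n) (Fin n) ℝ) (t : ℂ) (W U : List (Fin n → ℂ)) :
    ∃ U' : List (Fin n → ℂ),
      refine n (encodeMatrix A) t (W.map List.ofFn) (U.map List.ofFn) = U'.map List.ofFn ∧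
      (∀ u, u ∈ listSpan (K := ℂ) U' ↔ u ∈ listSpan (K := ℂ) U ∧
        shiftEnd A t u ∈ listSpan (K := ℂ) W) ∧
      (t.im = 0 → (∀ w ∈ W, IsRealVec w) → (∀ u ∈ U, IsRealVec u) → ∀ u ∈ U', IsRealVec u) := by
  have hl : (U.map List.ofFn).map (fun u => (shiftRow n (encodeMatrix A) t u, u)) ++
        (W.map List.ofFn).map (fun w => (w, zeroRow n)) =
      (U.map (fun u => (shiftEnd A t u, u)) ++ W.map fun w => (w, (0 : Fin n → ℂ))).map
        fun p => (List.ofFn p.1, List.ofFn p.2) := by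
    simp [Function.comp_def, shiftRow_ofFn, zeroRow_eq]
  obtain ⟨L, h1, -, h3⟩ := solve_spec (K := ℂ)
    (U.map (fun u => (shiftEnd A t u, u)) ++ W.map fun w => (w, (0 : Fin n → ℂ)))
  have h1' : refine n (encodeMatrix A) t (W.map List.ofFn) (U.map List.ofFn) =
      (L.map Prod.snd).map List.ofFn := by
    unfold refine
    rw [hl, h1]
  refine ⟨L.map Prod.snd, h1', ?_, ?_⟩
  · intro u
    have h4 := h3 u
    unfold listSpan at *
    rw [h4]
    let g : (Fin n → ℂ) →ₗ[ℂ] (Fin n → ℂ) × (Fin n → ℂ) := (shiftEnd A t).prod LinearMap.id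
    have h5 : {p : (Fin n → ℂ) × (Fin n → ℂ) |
        p ∈ U.map (fun u => (shiftEnd A t u, u)) ++ W.map fun w => (w, (0 : Fin n → ℂ))} =
        g '' {x | x ∈ U} ∪ LinearMap.inl ℂ (Fin n → ℂ) (Fin n → ℂ) '' {x | x ∈ W} := by
      ext p
      simp [g]
    rw [h5, Submodule.span_union, Submodule.span_image, Submodule.span_image, Submodule.mem_sup]
    constructor
    · rintro ⟨y, ⟨x, hx, rfl⟩, z, ⟨w, hw, rfl⟩, h6⟩
      have hg : g x = (shiftEnd A t x, x) := rfl
      rw [hg] at h6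
      have e1 := congrArg Prod.fst h6
      have e2 := congrArg Prod.snd h6
      simp only [LinearMap.inl_apply, Prod.mk_add_mk, add_zero] at e1 e2
      subst e2
      refine ⟨hx, ?_⟩
      rw [eq_neg_of_add_eq_zero_left e1]
      exact neg_mem hw
    · rintro ⟨hu, hw⟩
      refine ⟨_, ⟨u, hu, rfl⟩, _, ⟨_, neg_mem hw, rfl⟩, ?_⟩
      simp [g]
  · intro ht hW hU u hu
    have h4 := solve_real n ((U.map List.ofFn).map (fun u => (shiftRow n (encodeMatrix A) t u, u)) ++
        (W.map List.ofFn).map (fun w => (w, zeroRow n))) (by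
      rw [hl]
      intro p hp
      obtain ⟨q, hq, rfl⟩ := List.mem_map.mp hp
      simp only [List.mem_ofFn, forall_exists_index, forall_apply_eq_imp_iff]
      rcases List.mem_append.mp hq with hq | hq
      · obtain ⟨u, hu, rfl⟩ := List.mem_map.mp hq
        refine ⟨fun i => ?_, hU u hu⟩
        have hu' := hU u hu
        simp [shiftEnd_apply, rowEnd_apply, Complex.mul_im, hu' _, ht]
      · obtain ⟨w, hw, rfl⟩ := List.mem_map.mp hq
        exact ⟨hW w hw, fun i => rfl⟩)
    intro i
    refine h4 (List.ofFn u) ?_ (u i) (by simp)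
    have : List.ofFn u ∈ refine n (encodeMatrix A) t (W.map List.ofFn) (U.map List.ofFn) := by
      rw [h1']
      exact List.mem_map.mpr ⟨u, hu, rfl⟩
    exact this

lemma candidates_spec (A : Fin k → Matrix (Fin n) (Fin n) ℝ) (χ : Fin k → ℂ)
    (W : List (Fin n → ℂ)) :
    ∃ U : List (Fin n → ℂ),
      candidates n (List.ofFn fun j => encodeMatrix (A j)) (List.ofFn χ) (W.map List.ofFn) =
        U.map List.ofFn ∧
      (∀ u, u ∈ listSpan (K := ℂ) U ↔ ∀ j, shiftEnd (A j) (χ j) u ∈ listSpan (K := ℂ) W) ∧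
      (IsRealVec χ → (∀ w ∈ W, IsRealVec w) → ∀ u ∈ U, IsRealVec u) := by
  have key : ∀ js : List (Fin k), ∃ U : List (Fin n → ℂ),
      (js.map Fin.val).foldr (fun j U => refine n ((List.ofFn fun j => encodeMatrix (A j)).getD j [])
        ((List.ofFn χ).getD j 0) (W.map List.ofFn) U) (unitRows n) = U.map List.ofFn ∧
      (∀ u, u ∈ listSpan (K := ℂ) U ↔ ∀ j ∈ js, shiftEnd (A j) (χ j) u ∈ listSpan (K := ℂ) W) ∧
      (IsRealVec χ → (∀ w ∈ W, IsRealVec w) → ∀ u ∈ U, IsRealVec u) := by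
    intro js
    induction js with
    | nil =>
      refine ⟨(List.finRange n).map fun i => Pi.single i 1, ?_, ?_, ?_⟩
      · simp [unitRows_eq, Function.comp_def]
      · intro u
        simp only [List.not_mem_nil, false_imp_iff, implies_true, iff_true]
        have : listSpan (K := ℂ) ((List.finRange n).map fun i => (Pi.single i 1 : Fin n → ℂ)) = ⊤ := by
          rw [eq_top_iff, ← (Pi.basisFun ℂ (Fin n)).span_eq]
          apply Submodule.span_mono
          rintro _ ⟨i, rfl⟩
          exact List.mem_map.mpr ⟨i, List.mem_finRange i, by simp⟩
        rw [this]
        trivial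
      · intro _ _ u hu i
        obtain ⟨l, -, rfl⟩ := List.mem_map.mp hu
        by_cases h : i = l
        · subst h; simp
        · simp [Pi.single_eq_of_ne h]
    | cons j js ih =>
      obtain ⟨U, h1, h2, h3⟩ := ih
      obtain ⟨U', h1', h2', h3'⟩ := refine_spec (A j) (χ j) W U
      refine ⟨U', ?_, ?_, ?_⟩
      · rw [List.map_cons, List.foldr_cons, h1, getD_ofFn, getD_ofFn, h1']
      · intro u
        rw [h2', h2, List.forall_mem_cons, and_comm]
      · intro hχ hW
        exact h3' (hχ j) hW (h3 hχ hW)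
  obtain ⟨U, h1, h2, h3⟩ := key (List.finRange k)
  refine ⟨U, ?_, ?_, h3⟩
  · rw [← h1, candidates, List.length_ofFn, List.map_coe_finRange_eq_range]
  · intro u
    rw [h2]
    simp

lemma isNew_spec (W : List (Fin n → ℂ)) (u : Fin n → ℂ) :
    isNew n (W.map List.ofFn) (List.ofFn u) = true ↔ u ∉ listSpan (K := ℂ) W := by
  have hl : (List.ofFn u, [(1 : ℂ)]) :: (W.map List.ofFn).map (fun w => (w, [(0 : ℂ)])) =
      ((u, (1 : Fin 1 → ℂ)) :: W.map fun w => (w, (0 : Fin 1 → ℂ))).map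
        fun p => (List.ofFn p.1, List.ofFn p.2) := by
    simp [Function.comp_def, List.ofFn_succ]
  obtain ⟨L, h1, hL, h3⟩ := solve_spec (K := ℂ)
    ((u, (1 : Fin 1 → ℂ)) :: W.map fun w => (w, (0 : Fin 1 → ℂ)))
  unfold isNew
  rw [hl, h1]
  have hset : {p : (Fin n → ℂ) × (Fin 1 → ℂ) |
      p ∈ (u, (1 : Fin 1 → ℂ)) :: W.map fun w => (w, (0 : Fin 1 → ℂ))} =
      {(u, (1 : Fin 1 → ℂ))} ∪ LinearMap.inl ℂ (Fin n → ℂ) (Fin 1 → ℂ) '' {x | x ∈ W} := by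
    ext p
    simp
  -- The span of `(u, 1)` and the `(w, 0)` contains some `(0, y)` with `y ≠ 0` iff `u ∈ span W`.
  have hiff : ∀ y : Fin 1 → ℂ, y ∈ Submodule.span ℂ {x | x ∈ L.map Prod.snd} ↔
      ∃ c : ℂ, y = c • (1 : Fin 1 → ℂ) ∧ c • u ∈ listSpan (K := ℂ) W := by
    intro y
    rw [h3, hset, Submodule.span_union, Submodule.span_image, Submodule.mem_sup]
    constructor
    · rintro ⟨p, hp, q, ⟨w, hw, rfl⟩, h6⟩
      obtain ⟨c, rfl⟩ := Submodule.mem_span_singleton.mp hp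
      have e1 := congrArg Prod.fst h6
      have e2 := congrArg Prod.snd h6
      simp only [Prod.smul_mk, LinearMap.inl_apply, Prod.mk_add_mk, add_zero] at e1 e2
      refine ⟨c, e2.symm, ?_⟩
      rw [eq_neg_of_add_eq_zero_left e1]
      exact neg_mem hw
    · rintro ⟨c, rfl, hc⟩
      refine ⟨_, Submodule.mem_span_singleton.mpr ⟨c, rfl⟩, _, ⟨_, neg_mem hc, rfl⟩, ?_⟩
      simp
  rw [List.isEmpty_iff, List.map_eq_nil_iff, List.map_eq_nil_iff]
  constructor
  · rintro rfl hu
    have := (hiff 1).mpr ⟨1, by simp, by simpa using hu⟩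
    simp at this
  · intro hu
    by_contra hne
    obtain ⟨a, ha⟩ := List.exists_mem_of_ne_nil L hne
    obtain ⟨c, hc, hcu⟩ := (hiff a.2).mp
      (Submodule.subset_span (List.mem_map.mpr ⟨a, ha, rfl⟩))
    have h5 := hL.pivot a ha a ha
    rw [hc] at h5
    simp only [Pi.smul_apply, Pi.one_apply, smul_eq_mul, mul_one, if_true] at h5
    rw [h5, one_smul] at hcu
    exact hu hcu

/-- Each of the vectors is an eigenvector modulo the span of the subsequent ones. -/
def IsTriangularList (A : Fin k → Matrix (Fin n) (Fin n) ℝ) (χ : Fin k → ℂ) :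
    List (Fin n → ℂ) → Prop
  | [] => True
  | u :: W => (∀ j, shiftEnd (A j) (χ j) u ∈ listSpan (K := ℂ) W) ∧ IsTriangularList A χ W

/-- A basis of `S` in which the given matrices become triangular, and which is real if the
eigenvalues are real. -/
structure IsBlockBasis (A : Fin k → Matrix (Fin n) (Fin n) ℝ) (χ : Fin k → ℂ)
    (S : Submodule ℂ (Fin n → ℂ)) (W : List (Fin n → ℂ)) : Prop where
  indep : LinearIndependent ℂ W.get
  triangular : IsTriangularList A χ W
  span_eq : listSpan W = S
  real : IsRealVec χ → ∀ w ∈ W, IsRealVec w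

lemma range_get {α : Type} (W : List α) : Set.range W.get = {x | x ∈ W} := by
  ext x
  simp [List.mem_iff_get]

lemma linearIndependent_get_cons {u : Fin n → ℂ} {W : List (Fin n → ℂ)}
    (hW : LinearIndependent ℂ W.get) (hu : u ∉ listSpan (K := ℂ) W) :
    LinearIndependent ℂ (u :: W).get := by
  have e : (u :: W).get = (Fin.cons u W.get : Fin (W.length + 1) → Fin n → ℂ) := by
    funext i
    refine Fin.cases rfl (fun i => rfl) i
  rw [e, linearIndependent_finCons]
  exact ⟨hW, by rwa [range_get]⟩

/-- Extending a basis of a member of the flag yields a basis of the next one. -/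
lemma extend_spec (A : Fin k → Matrix (Fin n) (Fin n) ℝ) (χ : Fin k → ℂ) (i : ℕ)
    (W : List (Fin n → ℂ)) (hW : IsBlockBasis A χ (flag (fun j => shiftEnd (A j) (χ j)) i) W) :
    ∃ W', extend n (List.ofFn fun j => encodeMatrix (A j)) (List.ofFn χ) (W.map List.ofFn) =
        W'.map List.ofFn ∧
      IsBlockBasis A χ (flag (fun j => shiftEnd (A j) (χ j)) (i + 1)) W' := by
  obtain ⟨U, h1, h2, h3⟩ := candidates_spec A χ W
  have key : ∀ U : List (Fin n → ℂ),
      (∀ u ∈ U, ∀ j, shiftEnd (A j) (χ j) u ∈ listSpan (K := ℂ) W) →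
      (IsRealVec χ → ∀ u ∈ U, IsRealVec u) → ∃ W',
      (U.map List.ofFn).foldr (fun u W' => if isNew n W' u = true then u :: W' else W')
        (W.map List.ofFn) = W'.map List.ofFn ∧
      IsBlockBasis A χ (listSpan W ⊔ listSpan U) W' := by
    intro U hU hUr
    induction U with
    | nil =>
      refine ⟨W, rfl, hW.indep, hW.triangular, ?_, hW.real⟩
      simp [listSpan]
    | cons u U ih =>
      obtain ⟨W', h4, h5⟩ := ih (fun v hv => hU v (List.mem_cons_of_mem _ hv))
        (fun hχ v hv => hUr hχ v (List.mem_cons_of_mem _ hv))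
      rw [List.map_cons, List.foldr_cons, h4, listSpan_cons, sup_left_comm, ← h5.span_eq]
      by_cases hu : u ∈ listSpan (K := ℂ) W'
      · rw [if_neg (by rw [isNew_spec]; exact fun h => h hu)]
        refine ⟨W', rfl, h5.indep, h5.triangular, ?_, h5.real⟩
        rw [eq_comm, sup_eq_right, Submodule.span_le]
        simpa using hu
      · rw [if_pos ((isNew_spec _ _).mpr hu)]
        refine ⟨u :: W', rfl, linearIndependent_get_cons h5.indep hu, ⟨?_, h5.triangular⟩,
          listSpan_cons u W', ?_⟩
        · intro j
          rw [h5.span_eq]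
          exact Submodule.mem_sup_left (hU u List.mem_cons_self j)
        · intro hχ w hw
          rcases List.mem_cons.mp hw with rfl | hw
          · exact hUr hχ _ List.mem_cons_self
          · exact h5.real hχ w hw
  obtain ⟨W', h4, h5⟩ := key U
    (fun u hu => (h2 u).mp (Submodule.subset_span hu)) (fun hχ => h3 hχ (hW.real hχ))
  refine ⟨W', by rw [extend, h1, h4], ?_⟩
  have : listSpan W ⊔ listSpan U = flag (fun j => shiftEnd (A j) (χ j)) (i + 1) := by
    have hU : listSpan U = flag (fun j => shiftEnd (A j) (χ j)) (i + 1) := by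
      ext u
      rw [h2, mem_flag_succ, hW.span_eq]
    rw [hU, hW.span_eq, sup_eq_right]
    exact flag_mono _ i
  rwa [this] at h5

/-- The list `block` is a triangularizing basis of the joint generalized eigenspace. -/
lemma block_spec (A : Fin k → Matrix (Fin n) (Fin n) ℝ) (hA : ∀ i j, A i * A j = A j * A i)
    (χ : Fin k → ℂ) :
    ∃ W, block n (List.ofFn fun j => encodeMatrix (A j)) (List.ofFn χ) = W.map List.ofFn ∧
      IsBlockBasis A χ (weightSpace A χ) W := by
  have key : ∀ i : ℕ, ∃ W,
      (extend n (List.ofFn fun j => encodeMatrix (A j)) (List.ofFn χ))^[i] [] = W.map List.ofFn ∧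
      IsBlockBasis A χ (flag (fun j => shiftEnd (A j) (χ j)) i) W := by
    intro i
    induction i with
    | zero =>
      refine ⟨[], rfl, ?_, trivial, ?_, by simp⟩
      · exact linearIndependent_empty_type (ι := Fin 0)
      · simp [listSpan, flag]
    | succ i ih =>
      obtain ⟨W, h1, h2⟩ := ih
      rw [Function.iterate_succ_apply', h1]
      exact extend_spec A χ i W h2
  obtain ⟨W, h1, h2⟩ := key (k * n + 1)
  refine ⟨W, ?_, ?_⟩
  · rw [← h1, Function.iterate_succ_apply', block, List.length_ofFn, Function.iterate_mul]
  · rwa [flag_eq_weightSpace A hA] at h2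

end Lists

end AbelianExp

/-! ### The complex coordinates of a block decomposition -/

namespace AbelianExp

lemma sum_I_pow_scalarMatrix (c : Bool) (z : ℂ) (hz : c = false → z.im = 0)
    (y : Fin (fieldDim c)) :
    ∑ x : Fin (fieldDim c), Complex.I ^ (x : ℕ) * ((scalarMatrix c z x y : ℝ) : ℂ) =
      z * Complex.I ^ (y : ℕ) := by
  cases c with
  | false =>
    have h := hz rfl
    obtain rfl : y = (0 : Fin 1) := Subsingleton.elim _ _
    change ∑ x : Fin 1, Complex.I ^ (x : ℕ) * ((scalarMatrix false z x 0 : ℝ) : ℂ) = _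
    simp only [Fin.sum_univ_one]
    apply Complex.ext <;> simp [scalarMatrix, h]
  | true =>
    change ∑ x : Fin 2, Complex.I ^ (x : ℕ) * ((scalarMatrix true z x y : ℝ) : ℂ) = _
    change Fin 2 at y
    rw [Fin.sum_univ_two]
    fin_cases y <;> apply Complex.ext <;> simp [scalarMatrix]

lemma eq_of_sum_I_pow_eq (c : Bool) (f g : Fin (fieldDim c) → ℝ)
    (h : ∑ x : Fin (fieldDim c), Complex.I ^ (x : ℕ) * (f x : ℂ) =
      ∑ x : Fin (fieldDim c), Complex.I ^ (x : ℕ) * (g x : ℂ)) : f = g := by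
  cases c with
  | false =>
    change ∑ x : Fin 1, Complex.I ^ (x : ℕ) * (f x : ℂ) = ∑ x : Fin 1, _ at h
    simp only [Fin.sum_univ_one] at h
    funext x
    obtain rfl : x = (0 : Fin 1) := Subsingleton.elim _ _
    simpa using h
  | true =>
    change ∑ x : Fin 2, Complex.I ^ (x : ℕ) * (f x : ℂ) = ∑ x : Fin 2, _ at h
    simp only [Fin.sum_univ_two] at h
    have h1 := congrArg Complex.re h
    have h2 := congrArg Complex.im h
    funext x
    change Fin 2 at x
    fin_cases x
    · simpa using h1
    · simpa using h2

namespace BlockDecomposition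

variable {n : ℕ} (D : BlockDecomposition n)

/-- The rows of a real matrix that belong to the block `r`, combined to complex rows. -/
noncomputable def blockRows (r : Fin D.numBlocks) :
    Matrix (Fin n) (Fin n) ℝ →ₗ[ℝ] Matrix (Fin (D.size r)) (Fin n) ℂ where
  toFun M := Matrix.of fun a i =>
    ∑ c : Fin (fieldDim (D.cplx r)), Complex.I ^ (c : ℕ) * (M (D.indexEquiv ⟨r, (a, c)⟩) i : ℂ)
  map_add' M M' := by
    ext a i
    simp [mul_add, Finset.sum_add_distrib]
  map_smul' t M := by
    ext a i
    simp only [Matrix.of_apply, Matrix.smul_apply, RingHom.id_apply, smul_eq_mul,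
      Complex.ofReal_mul, Complex.real_smul, Finset.mul_sum]
    exact Finset.sum_congr rfl fun c _ => mul_left_comm _ _ _

lemma blockRows_apply (r : Fin D.numBlocks) (M : Matrix (Fin n) (Fin n) ℝ) (a : Fin (D.size r))
    (i : Fin n) :
    D.blockRows r M a i = ∑ c : Fin (fieldDim (D.cplx r)),
      Complex.I ^ (c : ℕ) * (M (D.indexEquiv ⟨r, (a, c)⟩) i : ℂ) := rfl

lemma blockRows_mul (r : Fin D.numBlocks) (M X : Matrix (Fin n) (Fin n) ℝ) :
    D.blockRows r (M * X) = D.blockRows r M * X.map (algebraMap ℝ ℂ) := by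
  ext a i
  simp only [blockRows_apply, Matrix.mul_apply, Finset.sum_mul, Complex.ofReal_sum,
    Complex.ofReal_mul, Finset.mul_sum, Matrix.map_apply]
  rw [Finset.sum_comm]
  refine Finset.sum_congr rfl fun x _ => Finset.sum_congr rfl fun c _ => ?_
  rw [mul_assoc]
  rfl

lemma eq_of_blockRows_eq {M M' : Matrix (Fin n) (Fin n) ℝ}
    (h : ∀ r, D.blockRows r M = D.blockRows r M') : M = M' := by
  ext i j
  obtain ⟨⟨r, a, c⟩, rfl⟩ := D.indexEquiv.surjective i
  have h1 := congrFun (congrFun (h r) a) j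
  rw [blockRows_apply, blockRows_apply] at h1
  exact congrFun (eq_of_sum_I_pow_eq _ (fun c => M (D.indexEquiv ⟨r, (a, c)⟩) j)
    (fun c => M' (D.indexEquiv ⟨r, (a, c)⟩) j) h1) c

/-- The families whose real blocks have real entries. -/
def IsRealFamily (T : D.Family) : Prop := ∀ r, D.cplx r = false → ∀ a b, (T r a b).im = 0

lemma isRealFamily_of_mem_admissible {T : D.Family} (hT : T ∈ D.admissible) : D.IsRealFamily T :=
  fun r => (hT r).1

lemma toMatrix_mul_apply (T : D.Family) (M : Matrix (Fin n) (Fin n) ℝ) (r : Fin D.numBlocks)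
    (a : Fin (D.size r)) (c : Fin (fieldDim (D.cplx r))) (i : Fin n) :
    (D.toMatrix T * M) (D.indexEquiv ⟨r, (a, c)⟩) i =
      ∑ b, ∑ c', scalarMatrix (D.cplx r) (T r a b) c c' * M (D.indexEquiv ⟨r, (b, c')⟩) i := by
  rw [Matrix.mul_apply, ← D.indexEquiv.sum_comp, Fintype.sum_sigma, Fintype.sum_eq_single r]
  · rw [Fintype.sum_prod_type]
    refine Finset.sum_congr rfl fun b _ => Finset.sum_congr rfl fun c' _ => ?_
    simp only [toMatrix, Matrix.reindex_apply, Matrix.submatrix_apply, Equiv.symm_apply_apply,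
      Matrix.blockDiagonal'_apply_eq, realize, Matrix.of_apply]
  · intro r' hr'
    refine Finset.sum_eq_zero fun q _ => ?_
    simp only [toMatrix, Matrix.reindex_apply, Matrix.submatrix_apply, Equiv.symm_apply_apply]
    rw [Matrix.blockDiagonal'_apply_ne _ _ _ hr'.symm, zero_mul]

lemma blockRows_toMatrix_mul {T : D.Family} (hT : D.IsRealFamily T) (r : Fin D.numBlocks)
    (M : Matrix (Fin n) (Fin n) ℝ) :
    D.blockRows r (D.toMatrix T * M) = T r * D.blockRows r M := by
  ext a i
  rw [blockRows_apply, Matrix.mul_apply]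
  simp only [toMatrix_mul_apply, blockRows_apply, Complex.ofReal_sum, Complex.ofReal_mul,
    Finset.mul_sum]
  rw [Finset.sum_comm]
  refine Finset.sum_congr rfl fun b _ => ?_
  rw [Finset.sum_comm]
  refine Finset.sum_congr rfl fun c' _ => ?_
  rw [← mul_assoc, ← sum_I_pow_scalarMatrix (D.cplx r) (T r a b) (fun h => hT r h a b) c',
    Finset.sum_mul]
  exact Finset.sum_congr rfl fun c _ => (mul_assoc _ _ _).symm

lemma conj_eq_iff (X M : Matrix (Fin n) (Fin n) ℝ) :
    D.conj X = M ↔ (D.B : Matrix (Fin n) (Fin n) ℝ) * X = M * (D.B : Matrix (Fin n) (Fin n) ℝ) := by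
  unfold conj
  exact Units.mul_inv_eq_iff_eq_mul (b := D.B)

/-- In the complex coordinates, the equation `B X B⁻¹ = T` decouples into the blocks. -/
lemma conj_eq_toMatrix_iff {T : D.Family} (hT : D.IsRealFamily T)
    (X : Matrix (Fin n) (Fin n) ℝ) :
    D.conj X = D.toMatrix T ↔
      ∀ r, D.blockRows r D.B * X.map (algebraMap ℝ ℂ) = T r * D.blockRows r D.B := by
  rw [conj_eq_iff]
  constructor
  · intro h r
    rw [← blockRows_mul, h, blockRows_toMatrix_mul D hT]
  · intro h
    apply D.eq_of_blockRows_eq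
    intro r
    rw [blockRows_mul, h, blockRows_toMatrix_mul D hT]

/-- A right inverse of the matrix of the complex coordinates of the block `r`. -/
noncomputable def blockSection (r : Fin D.numBlocks) : Matrix (Fin n) (Fin (D.size r)) ℂ :=
  Matrix.of fun i a => if i = D.indexEquiv ⟨r, (a, ⟨0, by cases D.cplx r <;> simp⟩)⟩ then 1 else 0

lemma blockRows_one_mul_blockSection (r : Fin D.numBlocks) :
    D.blockRows r 1 * D.blockSection r = 1 := by
  ext a b
  rw [Matrix.mul_apply]
  simp only [blockSection, Matrix.of_apply, mul_ite, mul_one, mul_zero, Finset.sum_ite_eq',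
    Finset.mem_univ, if_true, blockRows_apply, Matrix.one_apply, EmbeddingLike.apply_eq_iff_eq]
  by_cases h : a = b
  · subst h
    rw [if_pos rfl, Finset.sum_eq_single ⟨0, by cases D.cplx r <;> simp⟩]
    · simp
    · intro c _ hc
      rw [if_neg]
      · simp
      · intro h
        simp only [Sigma.mk.injEq, heq_eq_eq, Prod.mk.injEq, true_and] at h
        exact hc h
    · simp
  · rw [if_neg h]
    refine Finset.sum_eq_zero fun c _ => ?_
    rw [if_neg]
    · simp
    · intro h'
      simp only [Sigma.mk.injEq, heq_eq_eq, Prod.mk.injEq, true_and] at h'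
      exact h h'.1

/-- The block `r` of `B X B⁻¹`, as a complex matrix. -/
noncomputable def coeff (r : Fin D.numBlocks) :
    Matrix (Fin n) (Fin n) ℝ →ₗ[ℝ] Matrix (Fin (D.size r)) (Fin (D.size r)) ℂ where
  toFun X := D.blockRows r (D.conj X) * D.blockSection r
  map_add' X Y := by
    simp only [conj, Matrix.mul_add, Matrix.add_mul, map_add]
  map_smul' t X := by
    simp only [conj, Matrix.mul_smul, Matrix.smul_mul, map_smul, RingHom.id_apply]

lemma coeff_apply (r : Fin D.numBlocks) (X : Matrix (Fin n) (Fin n) ℝ) :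
    D.coeff r X = D.blockRows r (D.conj X) * D.blockSection r := rfl

lemma coeff_eq {T : D.Family} (hT : D.IsRealFamily T) {X : Matrix (Fin n) (Fin n) ℝ}
    (h : D.conj X = D.toMatrix T) (r : Fin D.numBlocks) : D.coeff r X = T r := by
  rw [coeff_apply, h, ← Matrix.mul_one (D.toMatrix T), blockRows_toMatrix_mul D hT,
    Matrix.mul_assoc, blockRows_one_mul_blockSection, Matrix.mul_one]

lemma conj_eq_toMatrix_coeff {X : Matrix (Fin n) (Fin n) ℝ} (h : D.conj X ∈ D.𝒜) :
    D.conj X = D.toMatrix (fun r => D.coeff r X) := by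
  obtain ⟨T, hT, hX⟩ := h
  have := D.coeff_eq (D.isRealFamily_of_mem_admissible hT) hX.symm
  simp only [this, hX]

lemma coeff_mem_admissible {X : Matrix (Fin n) (Fin n) ℝ} (h : D.conj X ∈ D.𝒜) :
    (fun r => D.coeff r X) ∈ D.admissible := by
  obtain ⟨T, hT, hX⟩ := h
  have := D.coeff_eq (D.isRealFamily_of_mem_admissible hT) hX.symm
  simpa only [this] using hT

/-- The scalar on the diagonal of the block `r` of `B X B⁻¹`. -/
noncomputable def diagScalar (r : Fin D.numBlocks) : Matrix (Fin n) (Fin n) ℝ →ₗ[ℝ] ℂ where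
  toFun X := D.coeff r X ⟨0, D.size_pos _ (List.getElem_mem _)⟩ ⟨0, D.size_pos _ (List.getElem_mem _)⟩
  map_add' X Y := by simp
  map_smul' t X := by simp

/-- The nilpotent part of the block `r` of `B X B⁻¹`. -/
noncomputable def nilPart (r : Fin D.numBlocks) :
    Matrix (Fin n) (Fin n) ℝ →ₗ[ℝ] Matrix (Fin (D.size r)) (Fin (D.size r)) ℂ where
  toFun X := D.coeff r X - D.diagScalar r X • 1
  map_add' X Y := by simp only [map_add, add_smul]; abel
  map_smul' t X := by
    simp only [map_smul, RingHom.id_apply, smul_sub, smul_assoc]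

lemma coeff_eq_add (r : Fin D.numBlocks) (X : Matrix (Fin n) (Fin n) ℝ) :
    D.coeff r X = D.diagScalar r X • 1 + D.nilPart r X := by
  simp [nilPart]

lemma nilPart_upper {X : Matrix (Fin n) (Fin n) ℝ} (h : D.conj X ∈ D.𝒜) (r : Fin D.numBlocks)
    (a b : Fin (D.size r)) (hab : b ≤ a) : D.nilPart r X a b = 0 := by
  obtain ⟨-, α, N, hN, hT⟩ := D.coeff_mem_admissible h r
  simp only at hT
  have h0 : D.diagScalar r X = α := by
    simp [diagScalar, hT, hN]
  have h1 : D.nilPart r X = N := by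
    simp [nilPart, h0, hT]
  rw [h1]
  exact hN a b hab

lemma diagScalar_im {X : Matrix (Fin n) (Fin n) ℝ} (h : D.conj X ∈ D.𝒜) (r : Fin D.numBlocks)
    (hr : D.cplx r = false) : (D.diagScalar r X).im = 0 :=
  (D.coeff_mem_admissible h r).1 hr _ _

/-- The space of all matrices that belong to `𝒜` in the new coordinates. -/
noncomputable def adaptedSubmodule : Submodule ℝ (Matrix (Fin n) (Fin n) ℝ) where
  carrier := {X | D.conj X ∈ D.𝒜}
  zero_mem' := by
    refine ⟨0, fun r => ⟨fun _ _ _ => rfl, 0, 0, fun _ _ _ => rfl, by simp⟩, ?_⟩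
    rw [eq_comm, D.conj_eq_toMatrix_iff (fun _ _ _ _ => rfl)]
    intro r
    simp
  add_mem' := by
    rintro X Y ⟨S, hS, hX⟩ ⟨T, hT, hY⟩
    have hS' := D.isRealFamily_of_mem_admissible hS
    have hT' := D.isRealFamily_of_mem_admissible hT
    refine ⟨S + T, fun r => ⟨fun hr a b => ?_, ?_⟩, ?_⟩
    · simp [hS' r hr a b, hT' r hr a b]
    · obtain ⟨-, α, M, hM, h1⟩ := hS r
      obtain ⟨-, β, N, hN, h2⟩ := hT r
      refine ⟨α + β, M + N, fun a b hab => ?_, ?_⟩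
      · simp [hM a b hab, hN a b hab]
      · rw [Pi.add_apply, h1, h2, add_smul]
        abel
    · rw [eq_comm, D.conj_eq_toMatrix_iff (fun r hr a b => by simp [hS' r hr a b, hT' r hr a b])]
      rw [eq_comm, D.conj_eq_toMatrix_iff hS'] at hX
      rw [eq_comm, D.conj_eq_toMatrix_iff hT'] at hY
      intro r
      rw [Matrix.map_add _ (map_add _), Matrix.mul_add, hX, hY, Pi.add_apply, Matrix.add_mul]
  smul_mem' := by
    rintro t X ⟨T, hT, hX⟩
    have hT' := D.isRealFamily_of_mem_admissible hT
    refine ⟨fun r => (t : ℂ) • T r, fun r => ⟨fun hr a b => ?_, ?_⟩, ?_⟩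
    · simp [hT' r hr a b]
    · obtain ⟨-, α, N, hN, h1⟩ := hT r
      refine ⟨t * α, (t : ℂ) • N, fun a b hab => ?_, ?_⟩
      · simp [hN a b hab]
      · simp only [h1, smul_add, smul_smul]
    · rw [eq_comm, D.conj_eq_toMatrix_iff (fun r hr a b => by simp [hT' r hr a b])]
      rw [eq_comm, D.conj_eq_toMatrix_iff hT'] at hX
      intro r
      have h1 : (t • X).map (algebraMap ℝ ℂ) = (t : ℂ) • X.map (algebraMap ℝ ℂ) := by
        ext a b
        simp
      rw [h1, Matrix.mul_smul, hX, Matrix.smul_mul]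

lemma eq_of_coeff_eq {X Y : Matrix (Fin n) (Fin n) ℝ} (hX : D.conj X ∈ D.𝒜) (hY : D.conj Y ∈ D.𝒜)
    (h : ∀ r, D.coeff r X = D.coeff r Y) : X = Y := by
  have h1 : D.conj X = D.conj Y := by
    rw [D.conj_eq_toMatrix_coeff hX, D.conj_eq_toMatrix_coeff hY]
    simp only [h]
  rw [conj_eq_iff, conj, Units.inv_mul_cancel_right] at h1
  exact (Units.isUnit D.B).mul_left_cancel h1

/-- The coordinates of `𝔥₀` in terms of the blocks. -/
lemma mem_𝔥₀Coords_iff {𝔥 : LieSubalgebra ℝ (Matrix (Fin n) (Fin n) ℝ)} (h : D.IsAdapted 𝔥)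
    (θ : Fin D.numBlocks → ℝ) :
    θ ∈ D.𝔥₀Coords 𝔥 ↔ ∃ X ∈ 𝔥, ∀ r, D.coeff r X = ((θ r : ℂ) * Complex.I) • 1 := by
  constructor
  · rintro ⟨X, ⟨hX, T', hT', hXT'⟩, T, hT, hXT, hθ⟩
    refine ⟨X, hX, fun r => ?_⟩
    have hreal : D.IsRealFamily (T' - D.discardIm T') := by
      intro r hr a b
      have h1 := (hT' r).1 hr a b
      by_cases hab : a = b
      · subst hab
        simp [discardIm, h1]
      · simp [discardIm, hab]
    have h1 := D.coeff_eq hreal hXT' r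
    have h2 := D.coeff_eq (D.isRealFamily_of_mem_admissible hT) hXT r
    obtain ⟨-, α, N, hN, hα⟩ := hT' r
    have h3 : D.coeff r X = ((α.im : ℂ) * Complex.I) • 1 := by
      rw [h1]
      ext a b
      by_cases hab : a = b
      · subst hab
        apply Complex.ext <;> simp [discardIm, hα, hN a a le_rfl]
      · simp [discardIm, hab]
    have a : Fin (D.size r) := ⟨0, D.size_pos _ (List.getElem_mem _)⟩
    have h4 := hθ r a
    rw [← h2, h3] at h4
    simp at h4
    rw [h3, h4]
  · rintro ⟨X, hX, hr⟩
    have hA := h X hX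
    have hadm := D.coeff_mem_admissible hA
    refine ⟨X, ⟨hX, _, hadm, ?_⟩, _, hadm, D.conj_eq_toMatrix_coeff hA, ?_⟩
    · rw [D.conj_eq_toMatrix_coeff hA]
      congr 1
      funext r
      ext a b
      by_cases hab : a = b
      · subst hab
        simp [discardIm, hr]
      · simp [discardIm, hr, hab]
    · intro r a
      simp [hr]

end BlockDecomposition

end AbelianExp

/-! ### The exponential of triangular matrices -/

namespace AbelianExp

section MatrixExp

open NormedSpace

variable {d n : ℕ}

lemma hasSum_exp_matrix (X : Matrix (Fin n) (Fin n) ℂ) :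
    HasSum (fun i : ℕ => ((i.factorial : ℂ)⁻¹) • X ^ i) (exp X) :=
  open scoped Matrix.Norms.Operator in NormedSpace.exp_series_hasSum_exp' (𝕂 := ℂ) X

lemma continuous_exp_matrix :
    Continuous (exp : Matrix (Fin n) (Fin n) ℝ → Matrix (Fin n) (Fin n) ℝ) :=
  open scoped Matrix.Norms.Operator in NormedSpace.exp_continuous

/-- Intertwining relations are inherited by the exponentials. -/
lemma mul_exp_eq_exp_mul {Ξ : Matrix (Fin d) (Fin n) ℂ} {X : Matrix (Fin n) (Fin n) ℂ}
    {T : Matrix (Fin d) (Fin d) ℂ} (h : Ξ * X = T * Ξ) : Ξ * exp X = exp T * Ξ := by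
  have hpow : ∀ i : ℕ, Ξ * X ^ i = T ^ i * Ξ := by
    intro i
    induction i with
    | zero => simp
    | succ i ih => rw [pow_succ, ← Matrix.mul_assoc, ih, Matrix.mul_assoc, h, pow_succ,
        Matrix.mul_assoc]
  have h1 : HasSum (fun i : ℕ => Ξ * (((i.factorial : ℂ)⁻¹) • X ^ i)) (Ξ * exp X) :=
    (hasSum_exp_matrix X).map (AddMonoidHom.mk' (fun M => Ξ * M) (Matrix.mul_add Ξ))
      (continuous_const.matrix_mul continuous_id)
  have h2 : HasSum (fun i : ℕ => (((i.factorial : ℂ)⁻¹) • T ^ i) * Ξ) (exp T * Ξ) :=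
    (hasSum_exp_matrix T).map
      (AddMonoidHom.mk' (fun M => M * Ξ) (fun M N => Matrix.add_mul M N Ξ))
      (continuous_id.matrix_mul continuous_const)
  refine h1.unique ?_
  convert h2 using 2 with i
  rw [Matrix.mul_smul, Matrix.smul_mul, hpow]

lemma map_exp_matrix (X : Matrix (Fin n) (Fin n) ℝ) :
    (exp X).map (algebraMap ℝ ℂ) = exp (X.map (algebraMap ℝ ℂ)) := by
  have h := (open scoped Matrix.Norms.Operator in
    NormedSpace.exp_series_hasSum_exp' (𝕂 := ℝ) X)
  have h1 : HasSum (fun i : ℕ => (((i.factorial : ℝ)⁻¹) • X ^ i).map (algebraMap ℝ ℂ))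
      ((exp X).map (algebraMap ℝ ℂ)) :=
    h.map ((algebraMap ℝ ℂ).mapMatrix.toAddMonoidHom)
      (continuous_id.matrix_map Complex.continuous_ofReal)
  refine h1.unique ?_
  convert hasSum_exp_matrix (X.map (algebraMap ℝ ℂ)) using 2 with i
  have h3 : (X ^ i).map (algebraMap ℝ ℂ) = X.map (algebraMap ℝ ℂ) ^ i :=
    map_pow (algebraMap ℝ ℂ).mapMatrix X i
  rw [← h3]
  ext a b
  simp

lemma exp_smul_one (α : ℂ) :
    exp (α • (1 : Matrix (Fin d) (Fin d) ℂ)) = Complex.exp α • 1 := by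
  rw [← Matrix.diagonal_one, ← Matrix.diagonal_smul, ← Matrix.diagonal_smul, Matrix.exp_diagonal]
  congr 1
  funext i
  rw [Pi.coe_exp, Complex.exp_eq_exp_ℂ]
  simp

lemma exp_smul_one_add (α : ℂ) (N : Matrix (Fin d) (Fin d) ℂ) :
    exp (α • (1 : Matrix (Fin d) (Fin d) ℂ) + N) = Complex.exp α • exp N := by
  rw [Matrix.exp_add_of_commute _ _ ((Commute.one_left N).smul_left α), exp_smul_one,
    Matrix.smul_mul, Matrix.one_mul]

/-- The matrix is proper upper triangular. -/
def IsStrictUpper (N : Matrix (Fin d) (Fin d) ℂ) : Prop := ∀ a b, b ≤ a → N a b = 0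

lemma IsStrictUpper.pow_eq_zero {N : Matrix (Fin d) (Fin d) ℂ} (hN : IsStrictUpper N) :
    N ^ d = 0 := by
  have h1 : N.charpoly = Polynomial.X ^ d := by
    rw [Matrix.charpoly_of_isUpperTriangular N (fun a b hab => hN a b (le_of_lt hab))]
    simp [hN _ _ le_rfl]
  have h2 := Matrix.aeval_self_charpoly N
  rwa [h1, map_pow, Polynomial.aeval_X] at h2

lemma IsStrictUpper.exp_nsmul_eq_sum {N : Matrix (Fin d) (Fin d) ℂ} (hN : IsStrictUpper N)
    (t : ℕ) :
    exp N ^ t = ∑ i : Fin d, ((t : ℂ) ^ (i : ℕ) * ((i : ℕ).factorial : ℂ)⁻¹) • N ^ (i : ℕ) := by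
  rw [← Matrix.exp_nsmul]
  refine (hasSum_exp_matrix (t • N)).unique ?_
  have h1 : ∀ i ∉ Finset.range d, ((i.factorial : ℂ)⁻¹) • (t • N) ^ i = 0 := by
    intro i hi
    have hi : d ≤ i := by simpa using hi
    rw [smul_pow, pow_eq_zero_of_le hi hN.pow_eq_zero, smul_zero, smul_zero]
  have h2 := hasSum_sum_of_ne_finset_zero (L := SummationFilter.unconditional ℕ) h1
  rw [Finset.sum_range] at h2
  convert h2 using 1
  refine Finset.sum_congr rfl fun i _ => ?_
  rw [smul_pow, ← Nat.cast_smul_eq_nsmul ℂ, smul_smul, mul_comm, Nat.cast_pow]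

/-- On proper upper triangular matrices the exponential has a polynomial inverse: `t ↦ exp (t N)`
is a polynomial of degree `< d` with linear coefficient `N`, so that `N` can be computed from the
values at `0, 1, …, d - 1`. -/
lemma exists_log_weights (d : ℕ) : ∃ w : Fin d → ℂ,
    ∀ N : Matrix (Fin d) (Fin d) ℂ, IsStrictUpper N → N = ∑ t, w t • exp N ^ (t : ℕ) := by
  let V : Matrix (Fin d) (Fin d) ℂ := Matrix.vandermonde fun t => ((t : ℕ) : ℂ)
  have hV : IsUnit V := by
    rw [Matrix.isUnit_iff_isUnit_det, isUnit_iff_ne_zero]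
    exact Matrix.det_vandermonde_ne_zero_iff.mpr fun s t h => Fin.ext (Nat.cast_injective h)
  obtain ⟨w, hw⟩ := (Matrix.vecMul_surjective_iff_isUnit.mpr hV)
    (fun i : Fin d => if (i : ℕ) = 1 then 1 else 0)
  refine ⟨w, fun N hN => ?_⟩
  have hw' : ∀ i : Fin d, ∑ t, w t * ((t : ℕ) : ℂ) ^ (i : ℕ) = if (i : ℕ) = 1 then 1 else 0 := by
    intro i
    have := congrFun hw i
    simpa [Matrix.vecMul, dotProduct, V, Matrix.vandermonde_apply] using this
  have h1 : ∑ t, w t • exp N ^ (t : ℕ) =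
      ∑ i : Fin d, (if (i : ℕ) = 1 then (1 : ℂ) else 0) • N ^ (i : ℕ) := by
    simp only [hN.exp_nsmul_eq_sum, Finset.smul_sum]
    rw [Finset.sum_comm]
    refine Finset.sum_congr rfl fun i _ => ?_
    simp only [smul_smul, ← mul_assoc]
    rw [← Finset.sum_smul, ← Finset.sum_mul, hw']
    split_ifs with h
    · simp [h]
    · simp
  rw [h1]
  by_cases hd : 1 < d
  · rw [Finset.sum_eq_single ⟨1, hd⟩]
    · simp
    · intro i _ hi
      rw [if_neg (fun h => hi (Fin.ext h)), zero_smul]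
    · simp
  · rw [Finset.sum_eq_zero]
    · ext a b
      exact hN a b (by have := a.2; have := b.2; rw [Fin.le_def]; omega)
    · intro i _
      rw [if_neg (by have := i.2; omega), zero_smul]

lemma IsStrictUpper.eq_zero_of_exp_eq_one {N : Matrix (Fin d) (Fin d) ℂ} (hN : IsStrictUpper N)
    (h : exp N = 1) : N = 0 := by
  obtain ⟨w, hw⟩ := exists_log_weights d
  rw [hw N hN, hw 0 (fun _ _ _ => rfl), h, exp_zero]

/-- The first column of `N` vanishes, so that the first column of `exp N` is a unit vector. -/
lemma IsStrictUpper.exp_apply_zero {N : Matrix (Fin d) (Fin d) ℂ} (hN : IsStrictUpper N)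
    (hd : 0 < d) : exp N ⟨0, hd⟩ ⟨0, hd⟩ = 1 := by
  let e : Matrix (Fin d) (Fin 1) ℂ := Matrix.of fun a _ => if a = ⟨0, hd⟩ then 1 else 0
  have h1 : e * (0 : Matrix (Fin 1) (Fin 1) ℂ) = N * e := by
    ext a b
    simp [e, Matrix.mul_apply, hN a ⟨0, hd⟩ (Nat.zero_le _)]
  have h2 := mul_exp_eq_exp_mul h1
  rw [exp_zero, Matrix.mul_one] at h2
  have h3 := congrFun (congrFun h2 ⟨0, hd⟩) 0
  simpa [e, Matrix.mul_apply] using h3.symm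

end MatrixExp

/-! ### Closed sums of a subspace and a lattice -/

section Lattice

open Filter Topology

/-- A closed countable additive subgroup of a complete space is discrete, by Baire's theorem. -/
lemma exists_ball_of_isClosed_countable {E : Type*} [NormedAddCommGroup E] [CompleteSpace E]
    (W : AddSubgroup E) (hc : IsClosed (W : Set E)) (hcount : (W : Set E).Countable) :
    ∃ ε > 0, ∀ x ∈ W, ‖x‖ < ε → x = 0 := by
  have : CompleteSpace W := hc.completeSpace_coe
  have : Countable W := hcount
  obtain ⟨w, hw⟩ := nonempty_interior_of_iUnion_of_closed (f := fun w : W => ({w} : Set W))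
    (fun w => isClosed_singleton) (by ext x; simp)
  have hopen : IsOpen ({w} : Set W) := by
    obtain ⟨y, hy⟩ := hw
    have hyw : y = w := by simpa using interior_subset hy
    rw [← interior_eq_iff_isOpen]
    refine subset_antisymm interior_subset ?_
    rw [Set.singleton_subset_iff, ← hyw]
    simpa [hyw] using hy
  obtain ⟨ε, hε, hball⟩ := Metric.isOpen_iff.mp hopen w rfl
  refine ⟨ε, hε, fun x hx hxε => ?_⟩
  have h1 : w + ⟨x, hx⟩ ∈ Metric.ball w ε := by
    rw [Metric.mem_ball, dist_eq_norm, add_sub_cancel_left]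
    exact hxε
  have h2 : w + ⟨x, hx⟩ = w := hball h1
  simpa using h2

/-- If the sum of a subspace and a lattice is closed, the echelon basis of the subspace is
rational: by compactness, two of the multiples `t v_j` almost coincide modulo the lattice, and they
coincide because the elements of the sum that vanish at the pivots form a discrete group. -/
lemma rational_of_isClosed {m d : ℕ} {v : Fin m → Fin d → ℝ} (hv : IsGaussJordan v) {c : ℝ}
    (hc : 0 < c)
    (hcl : IsClosed {x : Fin d → ℝ | ∃ u ∈ Submodule.span ℝ (Set.range v), ∃ z : Fin d → ℤ,
      x = u + fun r => c * z r}) (j : Fin m) (r : Fin d) : ∃ q : ℚ, v j r = q := by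
  obtain ⟨p, hp, hvp⟩ := hv
  have hpiv : ∀ i s, v i (p s) = if i = s then 1 else 0 := by
    intro i s
    by_cases h : i = s
    · subst h; simp [(hvp i).2.1]
    · simp [h, (hvp i).2.2 s (fun h' => h h'.symm)]
  let G : AddSubgroup (Fin d → ℝ) :=
    { carrier := {x | ∃ u ∈ Submodule.span ℝ (Set.range v), ∃ z : Fin d → ℤ,
        x = u + fun r => c * z r}
      zero_mem' := ⟨0, zero_mem _, 0, by funext r; simp⟩
      add_mem' := by
        rintro _ _ ⟨u, hu, z, rfl⟩ ⟨u', hu', z', rfl⟩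
        refine ⟨u + u', add_mem hu hu', z + z', ?_⟩
        funext r
        simp
        ring
      neg_mem' := by
        rintro _ ⟨u, hu, z, rfl⟩
        refine ⟨-u, neg_mem hu, -z, ?_⟩
        funext r
        simp
        ring }
  let P : AddSubgroup (Fin d → ℝ) :=
    { carrier := {x | ∀ s, x (p s) = 0}
      zero_mem' := fun s => rfl
      add_mem' := fun {x y} hx hy s => by simp [hx s, hy s]
      neg_mem' := fun {x} hx s => by simp [hx s] }
  have hPcl : IsClosed (P : Set (Fin d → ℝ)) := by
    have : (P : Set (Fin d → ℝ)) = ⋂ s, {x | x (p s) = 0} := by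
      ext x; simp [P]
    rw [this]
    exact isClosed_iInter fun s => isClosed_eq (continuous_apply _) continuous_const
  have hWcl : IsClosed ((G ⊓ P : AddSubgroup (Fin d → ℝ)) : Set (Fin d → ℝ)) := hcl.inter hPcl
  -- An element of `G ⊓ P` is determined by its lattice part.
  have hcount : ((G ⊓ P : AddSubgroup (Fin d → ℝ)) : Set (Fin d → ℝ)).Countable := by
    refine (Set.countable_range fun z : Fin d → ℤ =>
      (fun r => c * (z r : ℝ)) - ∑ s, (c * (z (p s) : ℝ)) • v s).mono ?_
    rintro x ⟨⟨u, hu, z, rfl⟩, hx⟩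
    refine ⟨z, ?_⟩
    obtain ⟨a, rfl⟩ := (Submodule.mem_span_range_iff_exists_fun ℝ).mp hu
    have ha : ∀ s, a s = -(c * z (p s)) := by
      intro s
      have h1 : (∑ i, a i • v i + fun r => c * (z r : ℝ)) (p s) = 0 := hx s
      rw [Pi.add_apply, Finset.sum_apply] at h1
      simp only [Pi.smul_apply, hpiv, smul_eq_mul, mul_ite, mul_one, mul_zero,
        Finset.sum_ite_eq', Finset.mem_univ, if_true] at h1
      linarith
    simp only [ha, neg_smul, Finset.sum_neg_distrib]
    abel
  obtain ⟨ε, hε, hdisc⟩ := exists_ball_of_isClosed_countable (G ⊓ P) hWcl hcount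
  let y : ℕ → Fin d → ℝ := fun t r => c * Int.fract (t * v j r)
  have hy : ∀ t, y t ∈ G ⊓ P := by
    intro t
    refine ⟨⟨(c * t) • v j, Submodule.smul_mem _ _ (Submodule.subset_span ⟨j, rfl⟩),
      fun r => -⌊t * v j r⌋, ?_⟩, fun s => ?_⟩
    · funext r
      simp only [y, Int.fract, Pi.add_apply, Pi.smul_apply, smul_eq_mul, Int.cast_neg]
      ring
    · simp only [y, hpiv]
      split_ifs <;> simp
  have hbdd : Bornology.IsBounded (Set.Icc (0 : Fin d → ℝ) fun _ => c) := Metric.isBounded_Icc _ _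
  have hyI : ∀ t, y t ∈ Set.Icc (0 : Fin d → ℝ) fun _ => c := by
    intro t
    refine ⟨fun r => mul_nonneg hc.le (Int.fract_nonneg _), fun r => ?_⟩
    have := (Int.fract_lt_one ((t : ℝ) * v j r)).le
    simp only [y]
    nlinarith
  obtain ⟨a, -, φ, hφ, hlim⟩ := tendsto_subseq_of_bounded hbdd hyI
  obtain ⟨t, ht⟩ := Metric.cauchySeq_iff'.mp hlim.cauchySeq ε hε
  have h1 := ht (t + 1) (Nat.le_succ t)
  rw [dist_eq_norm] at h1
  have h2 := hdisc _ (sub_mem (hy (φ (t + 1))) (hy (φ t))) h1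
  have h3 := congrFun h2 r
  simp only [Pi.sub_apply, Pi.zero_apply, y, ← mul_sub, mul_eq_zero, hc.ne', false_or] at h3
  have h4 : (φ t : ℝ) < φ (t + 1) := by exact_mod_cast hφ (Nat.lt_succ_self t)
  have h5 : ((φ (t + 1) : ℝ) - φ t) ≠ 0 := by linarith
  refine ⟨(⌊φ (t + 1) * v j r⌋ - ⌊φ t * v j r⌋) / ((φ (t + 1) : ℚ) - φ t), ?_⟩
  push_cast
  rw [eq_div_iff h5]
  simp only [Int.fract] at h3
  linarith

end Lattice

end AbelianExp

/-! ### Closedness of the exponential image -/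

namespace AbelianExp

open NormedSpace

/-- The exponential of a matrix as an element of `GL(n, ℝ)`. -/
noncomputable def expGL {n : ℕ} (X : Matrix (Fin n) (Fin n) ℝ) : GL (Fin n) ℝ where
  val := exp X
  inv := exp (-X)
  val_inv := by
    rw [← Matrix.exp_add_of_commute _ _ (Commute.refl X).neg_right, add_neg_cancel, exp_zero]
  inv_val := by
    rw [← Matrix.exp_add_of_commute _ _ (Commute.refl X).neg_left, neg_add_cancel, exp_zero]

lemma continuous_expGL {n : ℕ} : Continuous (expGL : Matrix (Fin n) (Fin n) ℝ → GL (Fin n) ℝ) := by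
  rw [Units.continuous_iff]
  exact ⟨continuous_exp_matrix, continuous_exp_matrix.comp continuous_neg⟩

lemma mem_expImage {n : ℕ} {𝔥 : LieSubalgebra ℝ (Matrix (Fin n) (Fin n) ℝ)} {g : GL (Fin n) ℝ} :
    g ∈ expImage 𝔥 ↔ ∃ X ∈ 𝔥, expGL X = g := by
  constructor
  · rintro ⟨X, hX, h⟩
    exact ⟨X, hX, Units.ext h.symm⟩
  · rintro ⟨X, hX, rfl⟩
    exact ⟨X, hX, rfl⟩

namespace BlockDecomposition

variable {n : ℕ} (D : BlockDecomposition n)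

lemma isStrictUpper_nilPart {X : Matrix (Fin n) (Fin n) ℝ} (h : D.conj X ∈ D.𝒜)
    (r : Fin D.numBlocks) : IsStrictUpper (D.nilPart r X) :=
  D.nilPart_upper h r

lemma blockRows_mul_exp {X : Matrix (Fin n) (Fin n) ℝ} (h : D.conj X ∈ D.𝒜)
    (r : Fin D.numBlocks) :
    D.blockRows r D.B * (exp X).map (algebraMap ℝ ℂ) = exp (D.coeff r X) * D.blockRows r D.B := by
  rw [map_exp_matrix]
  apply mul_exp_eq_exp_mul
  exact (D.conj_eq_toMatrix_iff (D.isRealFamily_of_mem_admissible (D.coeff_mem_admissible h)) X).mp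
    (D.conj_eq_toMatrix_coeff h) r

lemma coeff_exp {X : Matrix (Fin n) (Fin n) ℝ} (h : D.conj X ∈ D.𝒜) (r : Fin D.numBlocks) :
    D.coeff r (exp X) = exp (D.coeff r X) := by
  rw [coeff_apply, conj, blockRows_mul, blockRows_mul, blockRows_mul_exp D h, Matrix.mul_assoc _
    (D.blockRows r D.B), ← blockRows_mul, Units.mul_inv, Matrix.mul_assoc,
    blockRows_one_mul_blockSection, Matrix.mul_one]

lemma exp_eq_exp_iff {X Y : Matrix (Fin n) (Fin n) ℝ} (hX : D.conj X ∈ D.𝒜)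
    (hY : D.conj Y ∈ D.𝒜) :
    expGL X = expGL Y ↔ ∀ r, exp (D.coeff r X) = exp (D.coeff r Y) := by
  rw [Units.ext_iff]
  change exp X = exp Y ↔ _
  constructor
  · intro h r
    rw [← D.coeff_exp hX, ← D.coeff_exp hY, h]
  · intro h
    apply (Units.isUnit D.B).mul_left_cancel
    apply D.eq_of_blockRows_eq
    intro r
    rw [blockRows_mul, blockRows_mul, D.blockRows_mul_exp hX, D.blockRows_mul_exp hY, h]

lemma exp_coeff (X : Matrix (Fin n) (Fin n) ℝ) (r : Fin D.numBlocks) :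
    exp (D.coeff r X) = Complex.exp (D.diagScalar r X) • exp (D.nilPart r X) := by
  rw [coeff_eq_add, exp_smul_one_add]

lemma diagScalar_exp {X : Matrix (Fin n) (Fin n) ℝ} (h : D.conj X ∈ D.𝒜)
    (r : Fin D.numBlocks) : D.diagScalar r (exp X) = Complex.exp (D.diagScalar r X) := by
  change D.coeff r (exp X) _ _ = _
  rw [coeff_exp D h, exp_coeff, Matrix.smul_apply,
    (D.isStrictUpper_nilPart h r).exp_apply_zero, smul_eq_mul, mul_one]

lemma conj_neg_mem {X : Matrix (Fin n) (Fin n) ℝ} (h : D.conj X ∈ D.𝒜) : D.conj (-X) ∈ D.𝒜 :=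
  D.adaptedSubmodule.neg_mem h

/-- The diagonal scalars of `exp X` and `exp (-X)` and the nilpotent part of `X`, written as a
function of `exp X`. -/
noncomputable def logData (w : ∀ r : Fin D.numBlocks, Fin (D.size r) → ℂ) (g : GL (Fin n) ℝ) :
    ∀ r : Fin D.numBlocks, (ℂ × ℂ) × (Fin (D.size r) → Fin (D.size r) → ℂ) :=
  fun r => ((D.diagScalar r (g : Matrix (Fin n) (Fin n) ℝ),
    D.diagScalar r ((g⁻¹ : GL (Fin n) ℝ) : Matrix (Fin n) (Fin n) ℝ)),
    fun a b => (∑ t, w r t • (D.diagScalar r ((g⁻¹ : GL (Fin n) ℝ) : Matrix (Fin n) (Fin n) ℝ) •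
      D.coeff r (g : Matrix (Fin n) (Fin n) ℝ)) ^ (t : ℕ)) a b)

lemma continuous_logData (w : ∀ r : Fin D.numBlocks, Fin (D.size r) → ℂ) :
    Continuous (D.logData w) := by
  have h1 : ∀ r, Continuous (D.diagScalar r) := fun r =>
    LinearMap.continuous_of_finiteDimensional _
  have h2 : ∀ r, Continuous (D.coeff r) := fun r =>
    LinearMap.continuous_of_finiteDimensional _
  have h3 : Continuous fun g : GL (Fin n) ℝ => (g : Matrix (Fin n) (Fin n) ℝ) :=
    Units.continuous_val
  have h4 : Continuous fun g : GL (Fin n) ℝ => ((g⁻¹ : GL (Fin n) ℝ) : Matrix (Fin n) (Fin n) ℝ) :=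
    Units.continuous_val.comp continuous_inv
  refine continuous_pi fun r => Continuous.prodMk
    (((h1 r).comp h3).prodMk ((h1 r).comp h4)) ?_
  have h5 : Continuous fun g : GL (Fin n) ℝ => ∑ t, w r t •
      (D.diagScalar r ((g⁻¹ : GL (Fin n) ℝ) : Matrix (Fin n) (Fin n) ℝ) •
      D.coeff r (g : Matrix (Fin n) (Fin n) ℝ)) ^ (t : ℕ) :=
    continuous_finsetSum _ fun t _ => by
      have h6 : Continuous fun g : GL (Fin n) ℝ =>
          D.diagScalar r ((g⁻¹ : GL (Fin n) ℝ) : Matrix (Fin n) (Fin n) ℝ) •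
          D.coeff r (g : Matrix (Fin n) (Fin n) ℝ) := ((h1 r).comp h4).smul ((h2 r).comp h3)
      exact (h6.pow (t : ℕ)).const_smul (w r t)
  exact continuous_pi fun a => continuous_pi fun b => h5.matrix_elem a b

/-- The function `logData` recovers the nilpotent part if the weights `w` invert the exponential. -/
lemma logData_expGL {w : ∀ r : Fin D.numBlocks, Fin (D.size r) → ℂ}
    (hw : ∀ r, ∀ N : Matrix (Fin (D.size r)) (Fin (D.size r)) ℂ, IsStrictUpper N →
      N = ∑ t, w r t • exp N ^ (t : ℕ)) {X : Matrix (Fin n) (Fin n) ℝ} (h : D.conj X ∈ D.𝒜)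
    (r : Fin D.numBlocks) :
    D.logData w (expGL X) r = ((Complex.exp (D.diagScalar r X), Complex.exp (-D.diagScalar r X)),
      D.nilPart r X) := by
  have h1 : D.diagScalar r (((expGL X)⁻¹ : GL (Fin n) ℝ) : Matrix (Fin n) (Fin n) ℝ) =
      Complex.exp (-D.diagScalar r X) := by
    rw [← map_neg]
    exact D.diagScalar_exp (D.conj_neg_mem h) r
  have h2 : D.coeff r ((expGL X : GL (Fin n) ℝ) : Matrix (Fin n) (Fin n) ℝ) =
      exp (D.coeff r X) := D.coeff_exp h r
  refine Prod.ext (Prod.ext (D.diagScalar_exp h r) h1) ?_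
  simp only [logData]
  rw [h1, h2, exp_coeff, smul_smul, ← Complex.exp_add, neg_add_cancel, Complex.exp_zero, one_smul,
    ← hw r _ (D.isStrictUpper_nilPart h r)]

/-- The real parts of the diagonal scalars and the nilpotent parts. -/
noncomputable def realData : Matrix (Fin n) (Fin n) ℝ →ₗ[ℝ]
    ∀ r : Fin D.numBlocks, ℝ × (Fin (D.size r) → Fin (D.size r) → ℂ) where
  toFun X r := ((D.diagScalar r X).re, D.nilPart r X)
  map_add' X Y := by
    funext r
    refine Prod.ext (by simp) ?_
    exact map_add (D.nilPart r) X Y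
  map_smul' t X := by
    funext r
    refine Prod.ext (by simp) ?_
    exact map_smul (D.nilPart r) t X

/-- The real parts and the nilpotent parts of `X` are bounded in terms of `exp X`. -/
lemma norm_realData_le {w : ∀ r : Fin D.numBlocks, Fin (D.size r) → ℂ}
    (hw : ∀ r, ∀ N : Matrix (Fin (D.size r)) (Fin (D.size r)) ℂ, IsStrictUpper N →
      N = ∑ t, w r t • exp N ^ (t : ℕ)) {X : Matrix (Fin n) (Fin n) ℝ} (h : D.conj X ∈ D.𝒜) :
    ‖D.realData X‖ ≤ ‖D.logData w (expGL X)‖ := by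
  rw [pi_norm_le_iff_of_nonneg (norm_nonneg _)]
  intro r
  refine le_trans ?_ (norm_le_pi_norm _ r)
  rw [D.logData_expGL hw h]
  refine max_le_max ?_ le_rfl
  -- `|x| ≤ max (exp x) (exp (-x))`
  change ‖(D.diagScalar r X).re‖ ≤
    max ‖Complex.exp (D.diagScalar r X)‖ ‖Complex.exp (-D.diagScalar r X)‖
  rw [Complex.norm_exp, Complex.norm_exp, Real.norm_eq_abs, Complex.neg_re]
  exact max_le_max (by linarith [Real.add_one_le_exp (D.diagScalar r X).re])
    (by linarith [Real.add_one_le_exp (-(D.diagScalar r X).re)])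

variable {𝔥 : LieSubalgebra ℝ (Matrix (Fin n) (Fin n) ℝ)} {m : ℕ} {v : Fin m → Fin D.numBlocks → ℝ}

/-- If `𝔥₀` has a rational basis, then `exp 𝔥` is closed: the elements of `exp 𝔥` near a given point
are exponentials of a compact subset of `𝔥`, because modulo the periods of the exponential map `X` is
bounded in terms of the real parts and the nilpotent parts. -/
lemma isClosed_expImage_of_rational (hA : D.IsAdapted 𝔥)
    (hspan : (Submodule.span ℝ (Set.range v) : Set (Fin D.numBlocks → ℝ)) = D.𝔥₀Coords 𝔥)
    (hv : ∀ j r, ∃ q : ℚ, v j r = q) : IsClosed (expImage 𝔥) := by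
  -- With a common denominator `q`, the multiples of `v j` by `2 π q` are periods.
  choose qv hqv using hv
  obtain ⟨q, hq0, k, hk⟩ : ∃ q : ℝ, 0 < q ∧ ∃ k : Fin m → Fin D.numBlocks → ℤ,
      ∀ j r, q * v j r = k j r := by
    have hdvd : ∀ j r, ∃ e : ℕ, ∏ x : Fin m × Fin D.numBlocks, (qv x.1 x.2).den =
        (qv j r).den * e := fun j r =>
      Finset.dvd_prod_of_mem (fun x : Fin m × Fin D.numBlocks => (qv x.1 x.2).den)
        (Finset.mem_univ (j, r))
    choose e he using hdvd
    refine ⟨((∏ x : Fin m × Fin D.numBlocks, (qv x.1 x.2).den : ℕ) : ℝ), ?_,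
      fun j r => (qv j r).num * e j r, fun j r => ?_⟩
    · exact_mod_cast Finset.prod_pos fun (x : Fin m × Fin D.numBlocks) _ => (qv x.1 x.2).den_pos
    · rw [he j r, hqv]
      have h1 : ((qv j r : ℚ) : ℝ) * ((qv j r).den : ℝ) = ((qv j r).num : ℝ) := by
        exact_mod_cast Rat.mul_den_eq_num (qv j r)
      push_cast
      rw [← h1]
      ring
  have hZ : ∀ j, ∃ X ∈ 𝔥, ∀ r, D.coeff r X = ((v j r : ℂ) * Complex.I) • 1 := by
    intro j
    rw [← D.mem_𝔥₀Coords_iff hA, ← hspan]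
    exact Submodule.subset_span ⟨j, rfl⟩
  choose Z hZ𝔥 hZ using hZ
  have hsum : ∀ t : Fin m → ℝ, ∑ j, t j • Z j ∈ 𝔥 := fun t =>
    𝔥.toSubmodule.sum_mem fun j _ => 𝔥.toSubmodule.smul_mem _ (hZ𝔥 j)
  have hsumc : ∀ (t : Fin m → ℝ) (r : Fin D.numBlocks), D.coeff r (∑ j, t j • Z j) =
      (((∑ j, t j * v j r : ℝ) : ℂ) * Complex.I) • 1 := by
    intro t r
    rw [map_sum, Complex.ofReal_sum, Finset.sum_mul, Finset.sum_smul]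
    refine Finset.sum_congr rfl fun j _ => ?_
    rw [map_smul, hZ, ← smul_assoc]
    congr 1
    simp [mul_assoc]
  let f := D.realData.domRestrict 𝔥.toSubmodule
  obtain ⟨s, hs⟩ := LinearMap.exists_rightInverse_of_surjective f.rangeRestrict f.range_rangeRestrict
  have hs' : ∀ y, D.realData (s y : Matrix (Fin n) (Fin n) ℝ) = y := fun y =>
    congrArg Subtype.val (LinearMap.congr_fun hs y)
  let F : LinearMap.range f × (Fin m → ℝ) → GL (Fin n) ℝ := fun p =>
    expGL ((s p.1 : Matrix (Fin n) (Fin n) ℝ) + ∑ j, p.2 j • Z j)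
  have hF : Continuous F := by
    have h1 : Continuous (𝔥.toSubmodule.subtype ∘ₗ s) := LinearMap.continuous_of_finiteDimensional _
    refine continuous_expGL.comp ((h1.comp continuous_fst).add
      (continuous_finsetSum _ fun j _ => ?_))
    exact ((continuous_apply j).comp continuous_snd).smul continuous_const
  have : ProperSpace (LinearMap.range f) := FiniteDimensional.proper ℝ _
  let K : ℝ → Set (GL (Fin n) ℝ) := fun R =>
    F '' (Metric.closedBall 0 R ×ˢ Set.Icc 0 fun _ => 2 * Real.pi * q)
  have hK : ∀ R, IsCompact (K R) := fun R =>
    ((isCompact_closedBall _ _).prod isCompact_Icc).image hF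
  have hKsub : ∀ R, K R ⊆ expImage 𝔥 := by
    rintro R _ ⟨p, -, rfl⟩
    exact mem_expImage.mpr ⟨_, 𝔥.add_mem (s p.1).2 (hsum p.2), rfl⟩
  have hbound : ∀ R, ∀ X ∈ 𝔥, ‖D.realData X‖ ≤ R → expGL X ∈ K R := by
    intro R X hX hR
    let y : LinearMap.range f := ⟨D.realData X, ⟨⟨X, hX⟩, rfl⟩⟩
    have hY : X - s y ∈ 𝔥 := 𝔥.sub_mem hX (s y).2
    have hYdata : D.realData (X - s y) = 0 := by rw [map_sub, hs', sub_self]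
    have hYc : ∀ r, D.coeff r (X - s y) =
        (((D.diagScalar r (X - s y)).im : ℂ) * Complex.I) • 1 := by
      intro r
      have h1 : (D.diagScalar r (X - s y)).re = 0 := congrArg Prod.fst (congrFun hYdata r)
      have h2 : D.nilPart r (X - s y) = 0 := congrArg Prod.snd (congrFun hYdata r)
      rw [coeff_eq_add, h2, add_zero]
      congr 1
      generalize D.diagScalar r (X - s y) = c at h1 ⊢
      apply Complex.ext <;> simp [h1]
    have hmem : (fun r => (D.diagScalar r (X - s y)).im) ∈ Submodule.span ℝ (Set.range v) := by
      rw [← SetLike.mem_coe, hspan, D.mem_𝔥₀Coords_iff hA]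
      exact ⟨_, hY, hYc⟩
    obtain ⟨a, ha⟩ := (Submodule.mem_span_range_iff_exists_fun ℝ).mp hmem
    have ha' : ∀ r, (D.diagScalar r (X - s y)).im = ∑ j, a j * v j r := by
      intro r
      rw [← congrFun ha r, Finset.sum_apply]
      rfl
    have hpos : 0 < 2 * Real.pi * q := by positivity
    let z : Fin m → ℤ := fun j => ⌊a j / (2 * Real.pi * q)⌋
    let t : Fin m → ℝ := fun j => a j - 2 * Real.pi * q * z j
    have ht : t ∈ Set.Icc (0 : Fin m → ℝ) fun _ => 2 * Real.pi * q := by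
      refine ⟨fun j => ?_, fun j => ?_⟩
      · have := Int.floor_le (a j / (2 * Real.pi * q))
        rw [le_div_iff₀ hpos] at this
        simp only [t, z, Pi.zero_apply]
        linarith
      · have := (Int.lt_floor_add_one (a j / (2 * Real.pi * q))).le
        rw [div_le_iff₀ hpos] at this
        simp only [t, z]
        linarith
    refine ⟨(y, t), ⟨by simpa [y] using hR, ht⟩, ?_⟩
    refine (D.exp_eq_exp_iff (hA _ (𝔥.add_mem (s y).2 (hsum t))) (hA X hX)).mpr fun r => ?_
    -- The difference of the two exponents is a period.
    have h1 : D.coeff r X = (((∑ j, z j * k j r : ℤ) : ℂ) * (2 * Real.pi * Complex.I)) • 1 +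
        D.coeff r ((s y : Matrix (Fin n) (Fin n) ℝ) + ∑ j, t j • Z j) := by
      have h2 : X = (X - s y) + s y := by abel
      conv_lhs => rw [h2]
      rw [map_add, map_add, hYc, hsumc, ha', add_comm (D.coeff r _), ← add_assoc, ← add_smul]
      congr 2
      have h3 : (∑ j, a j * v j r : ℝ) =
          ((∑ j, z j * k j r : ℤ) : ℝ) * (2 * Real.pi) + ∑ j, t j * v j r := by
        push_cast
        rw [Finset.sum_mul, ← Finset.sum_add_distrib]
        refine Finset.sum_congr rfl fun j _ => ?_
        rw [← hk]
        simp only [t]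
        ring
      rw [h3]
      push_cast
      ring
    rw [h1, exp_smul_one_add, Complex.exp_int_mul_two_pi_mul_I, one_smul]
  choose w hw using fun r : Fin D.numBlocks => exists_log_weights (D.size r)
  refine isClosed_of_closure_subset fun g₀ hg₀ => ?_
  let R := ‖D.logData w g₀‖ + 1
  let U : Set (GL (Fin n) ℝ) := {g | ‖D.logData w g‖ < R}
  have hU : IsOpen U := isOpen_lt (D.continuous_logData w).norm continuous_const
  have h1 : U ∩ expImage 𝔥 ⊆ K R := by
    rintro g ⟨hg, hg𝔥⟩
    obtain ⟨X, hX, rfl⟩ := mem_expImage.mp hg𝔥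
    exact hbound R X hX ((D.norm_realData_le hw (hA X hX)).trans (le_of_lt hg))
  have h2 : g₀ ∈ closure (U ∩ expImage 𝔥) :=
    hU.inter_closure ⟨show ‖D.logData w g₀‖ < R from lt_add_one _, hg₀⟩
  exact hKsub R ((hK R).isClosed.closure_subset_iff.mpr h1 h2)

/-- The imaginary angles `θ`, restricted to the complex blocks. -/
noncomputable def angleFamily (θ : Fin D.numBlocks → ℝ) : D.Family :=
  fun r => (((if D.cplx r = true then θ r else 0 : ℝ) : ℂ) * Complex.I) • 1

lemma isRealFamily_angleFamily (θ : Fin D.numBlocks → ℝ) : D.IsRealFamily (D.angleFamily θ) := by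
  intro r hr a b
  simp [angleFamily, hr]

/-- The matrix with blocks `i θ_r ⬝ 1` in the new coordinates. -/
noncomputable def angleMatrix (θ : Fin D.numBlocks → ℝ) : Matrix (Fin n) (Fin n) ℝ :=
  ((D.B⁻¹ : GL (Fin n) ℝ) : Matrix (Fin n) (Fin n) ℝ) * D.toMatrix (D.angleFamily θ) * D.B

lemma conj_angleMatrix (θ : Fin D.numBlocks → ℝ) :
    D.conj (D.angleMatrix θ) = D.toMatrix (D.angleFamily θ) := by
  rw [conj_eq_iff, angleMatrix, Matrix.mul_assoc, Units.mul_inv_cancel_left]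

lemma conj_angleMatrix_mem (θ : Fin D.numBlocks → ℝ) : D.conj (D.angleMatrix θ) ∈ D.𝒜 := by
  rw [conj_angleMatrix]
  exact ⟨_, fun r => ⟨D.isRealFamily_angleFamily θ r, _, 0, fun _ _ _ => rfl,
    (add_zero _).symm⟩, rfl⟩

lemma coeff_angleMatrix (θ : Fin D.numBlocks → ℝ) (r : Fin D.numBlocks) :
    D.coeff r (D.angleMatrix θ) = D.angleFamily θ r :=
  D.coeff_eq (D.isRealFamily_angleFamily θ) (D.conj_angleMatrix θ) r

lemma continuous_angleMatrix : Continuous D.angleMatrix := by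
  have hadd : ∀ θ θ', D.angleMatrix (θ + θ') = D.angleMatrix θ + D.angleMatrix θ' := by
    intro θ θ'
    refine D.eq_of_coeff_eq (D.conj_angleMatrix_mem _) (D.adaptedSubmodule.add_mem
      (D.conj_angleMatrix_mem θ) (D.conj_angleMatrix_mem θ')) fun r => ?_
    rw [map_add, coeff_angleMatrix, coeff_angleMatrix, coeff_angleMatrix]
    unfold angleFamily
    rw [← add_smul]
    congr 1
    split_ifs <;> simp [add_mul]
  have hsmul : ∀ (c : ℝ) θ, D.angleMatrix (c • θ) = c • D.angleMatrix θ := by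
    intro c θ
    refine D.eq_of_coeff_eq (D.conj_angleMatrix_mem _) (D.adaptedSubmodule.smul_mem c
      (D.conj_angleMatrix_mem θ)) fun r => ?_
    rw [map_smul, coeff_angleMatrix, coeff_angleMatrix]
    unfold angleFamily
    rw [← smul_assoc]
    congr 1
    split_ifs <;> simp [mul_assoc]
  let L : (Fin D.numBlocks → ℝ) →ₗ[ℝ] Matrix (Fin n) (Fin n) ℝ :=
    { toFun := D.angleMatrix, map_add' := hadd, map_smul' := hsmul }
  exact L.continuous_of_finiteDimensional

/-- If `exp 𝔥` is closed, then so is the inverse image of `exp 𝔥` under the parametrization of the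
torus `exp ℐ` by the angles: it is the sum of `𝔥₀` and the lattice of periods. -/
lemma rational_of_isClosed_expImage (hA : D.IsAdapted 𝔥) (hgj : IsGaussJordan v)
    (hspan : (Submodule.span ℝ (Set.range v) : Set (Fin D.numBlocks → ℝ)) = D.𝔥₀Coords 𝔥)
    (hcl : IsClosed (expImage 𝔥)) (j : Fin m) (r : Fin D.numBlocks) : ∃ q : ℚ, v j r = q := by
  refine rational_of_isClosed hgj Real.two_pi_pos ?_ j r
  have hset : {x : Fin D.numBlocks → ℝ | ∃ u ∈ Submodule.span ℝ (Set.range v),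
      ∃ z : Fin D.numBlocks → ℤ, x = u + fun r => 2 * Real.pi * z r} =
      (fun θ => expGL (D.angleMatrix θ)) ⁻¹' expImage 𝔥 ∩
        ⋂ r, {θ | D.cplx r = false → Complex.exp ((θ r : ℂ) * Complex.I) = 1} := by
    ext θ
    simp only [Set.mem_ofPred_eq, Set.mem_inter_iff, Set.mem_preimage, Set.mem_iInter]
    constructor
    · rintro ⟨u, hu, z, rfl⟩
      rw [← SetLike.mem_coe, hspan, D.mem_𝔥₀Coords_iff hA] at hu
      obtain ⟨X, hX, hXu⟩ := hu
      have hu0 : ∀ r, D.cplx r = false → u r = 0 := by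
        intro r hr
        have h1 := D.diagScalar_im (hA X hX) r hr
        simpa [diagScalar, hXu] using h1
      have hper : ∀ r, Complex.exp (((u r + 2 * Real.pi * z r : ℝ) : ℂ) * Complex.I) =
          Complex.exp ((u r : ℂ) * Complex.I) := by
        intro r
        rw [Complex.exp_eq_exp_iff_exists_int]
        exact ⟨z r, by push_cast; ring⟩
      refine ⟨mem_expImage.mpr ⟨X, hX, ?_⟩, fun r hr => ?_⟩
      · rw [D.exp_eq_exp_iff (hA X hX) (D.conj_angleMatrix_mem _)]
        intro r
        rw [hXu, coeff_angleMatrix, angleFamily, exp_smul_one, exp_smul_one]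
        by_cases hr : D.cplx r = true
        · rw [if_pos hr, Pi.add_apply, hper]
        · rw [if_neg hr, hu0 r (by simpa using hr)]
      · rw [Pi.add_apply, hper, hu0 r hr]
        simp
    · rintro ⟨hθ, hreal⟩
      obtain ⟨X, hX, hXθ⟩ := mem_expImage.mp hθ
      rw [D.exp_eq_exp_iff (hA X hX) (D.conj_angleMatrix_mem _)] at hXθ
      have hexp : ∀ r, Complex.exp (D.diagScalar r X) = Complex.exp
          (((if D.cplx r = true then θ r else 0 : ℝ) : ℂ) * Complex.I) ∧ D.nilPart r X = 0 := by
        intro r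
        have h1 := hXθ r
        have hN := D.isStrictUpper_nilPart (hA X hX) r
        rw [coeff_angleMatrix, angleFamily, exp_smul_one, exp_coeff] at h1
        have h2 : Complex.exp (D.diagScalar r X) = Complex.exp
            (((if D.cplx r = true then θ r else 0 : ℝ) : ℂ) * Complex.I) := by
          have hd : 0 < D.size r := D.size_pos _ (List.getElem_mem _)
          have h3 := congrFun (congrFun h1 ⟨0, hd⟩) ⟨0, hd⟩
          rw [Matrix.smul_apply, hN.exp_apply_zero, Matrix.smul_apply, Matrix.one_apply_eq] at h3
          simpa using h3
        refine ⟨h2, hN.eq_zero_of_exp_eq_one ?_⟩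
        rw [h2] at h1
        exact smul_right_injective _ (Complex.exp_ne_zero _) h1
      have hz : ∀ r, ∃ z : ℤ, D.diagScalar r X =
          (((if D.cplx r = true then θ r else 0 : ℝ) : ℂ) * Complex.I) +
            z * (2 * Real.pi * Complex.I) := fun r =>
        Complex.exp_eq_exp_iff_exists_int.mp (hexp r).1
      choose z hz using hz
      have hz' : ∀ r, ∃ z' : ℤ, θ r = (if D.cplx r = true then θ r else 0) + 2 * Real.pi * z' := by
        intro r
        by_cases hr : D.cplx r = true
        · exact ⟨0, by simp [hr]⟩
        · obtain ⟨z', h1⟩ := Complex.exp_eq_one_iff.mp (hreal r (by simpa using hr))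
          refine ⟨z', ?_⟩
          rw [if_neg hr, zero_add]
          have h2 := congrArg Complex.im h1
          simp at h2
          linarith
      choose z' hz' using hz'
      refine ⟨fun r => (if D.cplx r = true then θ r else 0) + 2 * Real.pi * z r, ?_,
        fun r => z' r - z r, ?_⟩
      · rw [← SetLike.mem_coe, hspan, D.mem_𝔥₀Coords_iff hA]
        refine ⟨X, hX, fun r => ?_⟩
        rw [coeff_eq_add, (hexp r).2, add_zero, hz]
        congr 1
        push_cast
        ring
      · funext r
        rw [Pi.add_apply]
        conv_lhs => rw [hz' r]
        push_cast
        ring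
  rw [hset]
  refine (hcl.preimage (continuous_expGL.comp D.continuous_angleMatrix)).inter
    (isClosed_iInter fun r => ?_)
  by_cases hr : D.cplx r = false
  · simp only [hr, true_imp_iff]
    refine isClosed_eq (Complex.continuous_exp.comp ?_) continuous_const
    exact (Complex.continuous_ofReal.comp (continuous_apply r)).mul continuous_const
  · simp [hr]

end BlockDecomposition

end AbelianExp

/-! ### The block decomposition given by the joint generalized eigenspaces -/

namespace AbelianExp

lemma sum_I_pow_re_im (c : Bool) (z : ℂ) (hz : c = false → z.im = 0) :
    ∑ x : Fin (fieldDim c), Complex.I ^ (x : ℕ) * ((if (x : ℕ) = 0 then z.re else z.im : ℝ) : ℂ) =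
      z := by
  cases c with
  | false =>
    change ∑ x : Fin 1, Complex.I ^ (x : ℕ) * ((if (x : ℕ) = 0 then z.re else z.im : ℝ) : ℂ) = _
    have h := hz rfl
    rw [Fin.sum_univ_one]
    apply Complex.ext <;> simp [h]
  | true =>
    change ∑ x : Fin 2, Complex.I ^ (x : ℕ) * ((if (x : ℕ) = 0 then z.re else z.im : ℝ) : ℂ) = _
    rw [Fin.sum_univ_two]
    apply Complex.ext <;> simp

lemma conjVec_eq_self {n : ℕ} {x : Fin n → ℂ} (h : IsRealVec x) : conjVec x = x := by
  funext i
  exact Complex.conj_eq_iff_im.mpr (h i)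

lemma conjVec_injective {n : ℕ} : Function.Injective (conjVec : (Fin n → ℂ) → Fin n → ℂ) :=
  Function.LeftInverse.injective conjVec_conjVec

lemma linearIndependent_conjVec {n d : ℕ} {ξ : Fin d → Fin n → ℂ} (h : LinearIndependent ℂ ξ) :
    LinearIndependent ℂ fun a => conjVec (ξ a) := by
  rw [Fintype.linearIndependent_iff] at h ⊢
  intro g hg a
  have h1 := h (fun a => starRingEnd ℂ (g a)) (by
    funext i
    have h2 := congrArg (starRingEnd ℂ) (congrFun hg i)
    simpa [Finset.sum_apply, conjVec] using h2) a
  simpa using h1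

/-- The joint generalized eigenspaces of commuting real matrices up to complex conjugation. Each of
them comes with a basis in which the matrices are triangular; this basis is real if the joint
eigenvalue is real. -/
structure EigenSystem {n k : ℕ} (A : Fin k → Matrix (Fin n) (Fin n) ℝ) where
  comm : ∀ i j, A i * A j = A j * A i
  blocks : List (Bool × ℕ)
  size_pos : ∀ b ∈ blocks, 0 < b.2
  χ : Fin blocks.length → Fin k → ℂ
  ξ : ∀ r : Fin blocks.length, Fin blocks[r].2 → Fin n → ℂ
  indep : ∀ r, LinearIndependent ℂ (ξ r)
  span_eq : ∀ r, Submodule.span ℂ (Set.range (ξ r)) = weightSpace A (χ r)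
  triangular : ∀ r a j, shiftEnd (A j) (χ r j) (ξ r a) ∈ Submodule.span ℂ (ξ r '' Set.Ioi a)
  cplx_iff : ∀ r, blocks[r].1 = true ↔ ¬ IsRealVec (χ r)
  real : ∀ r, IsRealVec (χ r) → ∀ a, IsRealVec (ξ r a)
  ne : ∀ r r', r ≠ r' → χ r ≠ χ r' ∧ χ r ≠ conjVec (χ r')
  complete : ∀ φ, weightSpace A φ ≠ ⊥ → ∃ r, φ = χ r ∨ φ = conjVec (χ r)

namespace EigenSystem

variable {n k : ℕ} {A : Fin k → Matrix (Fin n) (Fin n) ℝ} (E : EigenSystem A)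

/-- The field of the block `r`. -/
abbrev cplx (r : Fin E.blocks.length) : Bool := E.blocks[r].1

/-- The dimension of the joint eigenspace `r`. -/
abbrev size (r : Fin E.blocks.length) : ℕ := E.blocks[r].2

lemma isRealVec_χ {r : Fin E.blocks.length} (h : E.cplx r = false) : IsRealVec (E.χ r) := by
  by_contra h1
  rw [← E.cplx_iff] at h1
  exact Bool.false_ne_true (h.symm.trans h1)

lemma isRealVec_ξ {r : Fin E.blocks.length} (h : E.cplx r = false) (a : Fin (E.size r)) :
    IsRealVec (E.ξ r a) := E.real r (E.isRealVec_χ h) a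

/-- The real and imaginary parts of the basis vectors. -/
noncomputable def row (x : Σ r, Fin (E.size r) × Fin (fieldDim (E.cplx r))) : Fin n → ℝ :=
  fun i => if (x.2.2 : ℕ) = 0 then (E.ξ x.1 x.2.1 i).re else (E.ξ x.1 x.2.1 i).im

lemma sum_row (r : Fin E.blocks.length) (a : Fin (E.size r)) (i : Fin n) :
    ∑ c : Fin (fieldDim (E.cplx r)), Complex.I ^ (c : ℕ) * (E.row ⟨r, (a, c)⟩ i : ℂ) = E.ξ r a i :=
  sum_I_pow_re_im (E.cplx r) (E.ξ r a i) fun h => E.isRealVec_ξ h a i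

/-- The joint eigenvalues and their conjugates. -/
noncomputable def weight (x : Σ r, Fin (fieldDim (E.cplx r))) : Fin k → ℂ :=
  if (x.2 : ℕ) = 0 then E.χ x.1 else conjVec (E.χ x.1)

/-- The joint eigenvalues and the conjugates of the nonreal ones are distinct. -/
lemma weight_injective : Function.Injective E.weight := by
  rintro ⟨r, c⟩ ⟨r', c'⟩ h
  simp only [weight] at h
  have hr : r = r' := by
    by_contra hne
    obtain ⟨h1, h2⟩ := E.ne r r' hne
    split_ifs at h with h3 h4 h4
    · exact h1 h
    · exact h2 h
    · exact (E.ne r' r (Ne.symm hne)).2 h.symm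
    · exact h1 (conjVec_injective h)
  subst hr
  have hself : E.χ r = conjVec (E.χ r) → E.cplx r = false := by
    intro h1
    by_contra h2
    refine (E.cplx_iff r).mp (Bool.not_eq_false _ ▸ h2) fun i => ?_
    exact Complex.conj_eq_iff_im.mp (congrFun h1 i).symm
  congr 1
  -- If only one of the two indices vanishes, then the weight is real, and `0` is the only index.
  have hfalse : E.cplx r = false → c = c' := by
    intro h1
    have : Subsingleton (Fin (fieldDim (E.cplx r))) := by
      rw [h1]
      exact inferInstanceAs (Subsingleton (Fin 1))
    exact Subsingleton.elim _ _
  have h2 : fieldDim (E.cplx r) ≤ 2 := by cases E.cplx r <;> simp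
  have := c.2
  have := c'.2
  split_ifs at h with h3 h4 h4
  · exact Fin.ext (h3.trans h4.symm)
  · exact hfalse (hself h)
  · exact hfalse (hself h.symm)
  · exact Fin.ext (by omega)

/-- The basis vectors and their conjugates. -/
noncomputable def vec (x : Σ r, Fin (fieldDim (E.cplx r))) (a : Fin (E.size x.1)) : Fin n → ℂ :=
  if (x.2 : ℕ) = 0 then E.ξ x.1 a else conjVec (E.ξ x.1 a)

lemma linearIndependent_vec :
    LinearIndependent ℂ fun y : Σ x : (Σ r, Fin (fieldDim (E.cplx r))), Fin (E.size x.1) =>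
      E.vec y.1 y.2 := by
  have hle : ∀ x, Submodule.span ℂ (Set.range (E.vec x)) ≤ weightSpace A (E.weight x) := by
    intro x
    rw [Submodule.span_le]
    rintro _ ⟨a, rfl⟩
    have h1 : E.ξ x.1 a ∈ weightSpace A (E.χ x.1) := by
      rw [← E.span_eq]
      exact Submodule.subset_span ⟨a, rfl⟩
    unfold vec weight
    split_ifs
    · exact h1
    · exact conjVec_mem_weightSpace h1
  refine linearIndependent_iUnion_finite (fun x => ?_) fun x t _ hxt => ?_
  · unfold vec
    split_ifs
    · exact E.indep x.1
    · exact linearIndependent_conjVec (E.indep x.1)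
  · refine (((iSupIndep_weightSpace A E.comm).comp E.weight_injective) x).mono (hle x) ?_
    refine iSup₂_le fun y hy => (hle y).trans ?_
    exact le_iSup₂_of_le y (fun h => hxt (h ▸ hy)) le_rfl

/-- The dimensions do not exceed `n` because the basis vectors and their conjugates are independent. -/
lemma sum_le : ∑ r, E.size r * fieldDim (E.cplx r) ≤ n := by
  have h := E.linearIndependent_vec.fintype_card_le_finrank
  rw [Module.finrank_fin_fun, Fintype.card_sigma, Fintype.sum_sigma] at h
  refine le_trans (le_of_eq ?_) h
  simp [mul_comm]

/-- The complex span of the rows contains all joint generalized eigenspaces, as it is stable under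
conjugation. -/
lemma span_row : ⊤ ≤ Submodule.span ℂ (Set.range fun x => fun i => (E.row x i : ℂ)) := by
  set S := Submodule.span ℂ (Set.range fun x => fun i => (E.row x i : ℂ)) with hS
  have hconj : ∀ u ∈ S, conjVec u ∈ S := by
    intro u hu
    rw [hS] at hu
    induction hu using Submodule.span_induction with
    | mem u hu =>
      obtain ⟨x, rfl⟩ := hu
      rw [conjVec_eq_self fun i => Complex.ofReal_im _]
      exact Submodule.subset_span ⟨x, rfl⟩
    | zero =>
      rw [conjVec_eq_self (x := (0 : Fin n → ℂ)) fun i => Complex.zero_im]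
      exact S.zero_mem
    | add u v _ _ hu hv =>
      have : conjVec (u + v) = conjVec u + conjVec v := by funext i; simp [conjVec]
      rw [this]
      exact S.add_mem hu hv
    | smul t u _ hu =>
      have : conjVec (t • u) = starRingEnd ℂ t • conjVec u := by funext i; simp [conjVec]
      rw [this]
      exact S.smul_mem _ hu
  have hξ : ∀ r, weightSpace A (E.χ r) ≤ S := by
    intro r
    rw [← E.span_eq, Submodule.span_le]
    rintro _ ⟨a, rfl⟩
    have : E.ξ r a = ∑ c : Fin (fieldDim (E.cplx r)), Complex.I ^ (c : ℕ) •
        fun i => (E.row ⟨r, (a, c)⟩ i : ℂ) := by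
      funext i
      rw [← E.sum_row]
      simp
    rw [this]
    exact S.sum_mem fun c _ => S.smul_mem _ (Submodule.subset_span ⟨_, rfl⟩)
  rw [← iSup_weightSpace A E.comm]
  refine iSup_le fun φ => ?_
  by_cases hφ : weightSpace A φ = ⊥
  · rw [hφ]
    exact bot_le
  · obtain ⟨r, rfl | rfl⟩ := E.complete φ hφ
    · exact hξ r
    · intro u hu
      have h1 : conjVec u ∈ weightSpace A (conjVec (conjVec (E.χ r))) := conjVec_mem_weightSpace hu
      rw [conjVec_conjVec] at h1
      rw [← conjVec_conjVec u]
      exact hconj _ (hξ r h1)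

lemma card_index : Fintype.card (Σ r, Fin (E.size r) × Fin (fieldDim (E.cplx r))) =
    ∑ r, E.size r * fieldDim (E.cplx r) := by
  rw [Fintype.card_sigma]
  simp

lemma dim_eq : ∑ r, E.size r * fieldDim (E.cplx r) = n := by
  refine le_antisymm E.sum_le ?_
  have h := finrank_range_le_card (R := ℂ) fun x => fun i => (E.row x i : ℂ)
  rw [Set.finrank, top_le_iff.mp E.span_row, finrank_top, Module.finrank_fin_fun, card_index] at h
  exact h

/-- The lexicographic numbering. -/
def index : (Σ r, Fin (E.size r) × Fin (fieldDim (E.cplx r))) ≃ Fin n :=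
  (Equiv.sigmaCongrRight fun _ => finProdFinEquiv).trans
    (finSigmaFinEquiv.trans (finCongr E.dim_eq))

/-- The matrix whose rows are the real and imaginary parts of the basis vectors. -/
noncomputable def baseMatrix : Matrix (Fin n) (Fin n) ℝ :=
  Matrix.of fun i => E.row (E.index.symm i)

lemma isUnit_baseMatrix : IsUnit E.baseMatrix := by
  have h1 : LinearIndependent ℂ (E.baseMatrix.map (algebraMap ℝ ℂ)).row := by
    refine linearIndependent_of_top_le_span_of_card_eq_finrank ?_ (by simp)
    refine E.span_row.trans (Submodule.span_mono ?_)
    rintro _ ⟨x, rfl⟩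
    refine ⟨E.index x, ?_⟩
    funext i
    simp [baseMatrix, Matrix.row]
  rw [Matrix.linearIndependent_rows_iff_isUnit, Matrix.isUnit_iff_isUnit_det, ← RingHom.mapMatrix_apply,
    ← RingHom.map_det, isUnit_iff_ne_zero, map_ne_zero] at h1
  rw [Matrix.isUnit_iff_isUnit_det, isUnit_iff_ne_zero]
  exact h1

/-- The block decomposition of an eigensystem. -/
noncomputable abbrev decomposition : BlockDecomposition n where
  B := E.isUnit_baseMatrix.unit
  blocks := E.blocks
  size_pos := E.size_pos
  dim_eq := E.dim_eq

/-- In complex coordinates, the rows of `B` are the basis vectors. -/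
lemma blockRows_B (r : Fin E.blocks.length) :
    E.decomposition.blockRows r E.decomposition.B = Matrix.of (E.ξ r) := by
  ext a i
  rw [BlockDecomposition.blockRows_apply]
  refine Eq.trans (Finset.sum_congr rfl fun c _ => ?_) (E.sum_row r a i)
  have h : E.decomposition.indexEquiv ⟨r, (a, c)⟩ = E.index ⟨r, (a, c)⟩ := rfl
  change Complex.I ^ (c : ℕ) * ((E.row (E.index.symm _) i : ℝ) : ℂ) = _
  rw [h, Equiv.symm_apply_apply]

/-- The block `T` describes the action of `X` on the basis vectors of the block `r`. -/
lemma rowEnd_ξ_iff {r : Fin E.blocks.length} (X : Matrix (Fin n) (Fin n) ℝ)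
    (T : Matrix (Fin (E.size r)) (Fin (E.size r)) ℂ) :
    E.decomposition.blockRows r E.decomposition.B * X.map (algebraMap ℝ ℂ) =
        T * E.decomposition.blockRows r E.decomposition.B ↔
      ∀ a, rowEnd X (E.ξ r a) = ∑ b, T a b • E.ξ r b := by
  rw [blockRows_B, ← Matrix.ext_iff]
  refine forall_congr' fun a => ?_
  rw [funext_iff]
  refine forall_congr' fun i => ?_
  rw [rowEnd_apply, Matrix.mul_apply, Matrix.mul_apply, Finset.sum_apply]
  rfl

lemma exists_triangular (j : Fin k) (r : Fin E.blocks.length) :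
    ∃ N : Matrix (Fin (E.size r)) (Fin (E.size r)) ℂ, (∀ a b, b ≤ a → N a b = 0) ∧
      (E.cplx r = false → ∀ a b, (N a b).im = 0) ∧
      ∀ a, rowEnd (A j) (E.ξ r a) = ∑ b, (E.χ r j • (1 : Matrix (Fin (E.size r)) (Fin (E.size r)) ℂ) + N) a b • E.ξ r b := by
  have h1 : ∀ a, ∃ f : Fin (E.size r) → ℂ, (∀ b, b ≤ a → f b = 0) ∧
      shiftEnd (A j) (E.χ r j) (E.ξ r a) = ∑ b, f b • E.ξ r b := by
    intro a
    obtain ⟨f, hf, h⟩ := (Finsupp.mem_span_image_iff_linearCombination ℂ).mp (E.triangular r a j)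
    refine ⟨f, fun b hb => ?_, ?_⟩
    · by_contra hne
      exact absurd (hf (Finsupp.mem_support_iff.mpr hne)) (not_lt.mpr hb)
    · rw [← h, Finsupp.linearCombination_apply, Finsupp.sum_fintype _ _ (by simp)]
  choose f hf0 hf using h1
  have hrow : ∀ N : Matrix (Fin (E.size r)) (Fin (E.size r)) ℂ, ∀ a,
      shiftEnd (A j) (E.χ r j) (E.ξ r a) = ∑ b, N a b • E.ξ r b →
      rowEnd (A j) (E.ξ r a) = ∑ b, (E.χ r j • (1 : Matrix (Fin (E.size r)) (Fin (E.size r)) ℂ) + N) a b • E.ξ r b := by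
    intro N a h
    simp only [Matrix.add_apply, Matrix.smul_apply, add_smul, Finset.sum_add_distrib, ← h,
      Matrix.one_apply, smul_eq_mul, mul_ite, mul_one, mul_zero, ite_smul, zero_smul,
      Finset.sum_ite_eq, Finset.mem_univ, if_true, shiftEnd_apply]
    abel
  cases hr : E.cplx r with
  | true => exact ⟨Matrix.of f, hf0, by simp, fun a => hrow _ a (hf a)⟩
  | false =>
    -- For real blocks, the real parts of the coefficients serve as well.
    refine ⟨Matrix.of fun a b => ((f a b).re : ℂ), fun a b hab => by simp [hf0 a b hab],
      by simp, fun a => hrow _ a ?_⟩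
    have hχ := E.isRealVec_χ hr j
    have hξ := fun b => E.isRealVec_ξ hr b
    have h2 : ∀ b i, (E.ξ r b i).im = 0 := fun b i => hξ b i
    funext i
    apply Complex.ext
    · rw [hf]
      simp [Finset.sum_apply, h2]
    · simp [shiftEnd_apply, rowEnd_apply, Finset.sum_apply, h2, hχ]

lemma exists_conj_eq (j : Fin k) : ∃ N : E.decomposition.Family, (∀ r a b, b ≤ a → N r a b = 0) ∧
    E.decomposition.IsRealFamily (fun r => E.χ r j • 1 + N r) ∧
    E.decomposition.conj (A j) = E.decomposition.toMatrix fun r => E.χ r j • 1 + N r := by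
  choose N h1 h2 h3 using E.exists_triangular j
  have hreal : E.decomposition.IsRealFamily (fun r => E.χ r j • 1 + N r) := by
    intro r hr a b
    have h4 : (E.χ r j).im = 0 := E.isRealVec_χ hr j
    have h5 : (N r a b).im = 0 := h2 r hr a b
    by_cases hab : a = b
    · subst hab
      simp [h4, h5]
    · simp [h5, hab]
  refine ⟨N, h1, hreal, ?_⟩
  rw [E.decomposition.conj_eq_toMatrix_iff hreal]
  exact fun r => (E.rowEnd_ξ_iff _ _).mpr (h3 r)

lemma conj_mem (j : Fin k) : E.decomposition.conj (A j) ∈ E.decomposition.𝒜 := by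
  obtain ⟨N, h1, h2, h3⟩ := E.exists_conj_eq j
  exact ⟨_, fun r => ⟨h2 r, _, N r, h1 r, rfl⟩, h3.symm⟩

lemma diagScalar_eq (j : Fin k) (r : Fin E.blocks.length) :
    E.decomposition.diagScalar r (A j) = E.χ r j := by
  obtain ⟨N, h1, h2, h3⟩ := E.exists_conj_eq j
  have h4 := E.decomposition.coeff_eq h2 h3 r
  change E.decomposition.coeff r (A j) _ _ = _
  rw [h4, Matrix.add_apply, h1 r _ _ le_rfl]
  simp

/-- An abelian Lie algebra is the linear span of any set of generators. -/
lemma mem_iff_of_lieSpan_eq {𝔥 : LieSubalgebra ℝ (Matrix (Fin n) (Fin n) ℝ)}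
    (hA : ∀ i j, A i * A j = A j * A i)
    (h : LieSubalgebra.lieSpan ℝ (Matrix (Fin n) (Fin n) ℝ) (Set.range A) = 𝔥)
    (X : Matrix (Fin n) (Fin n) ℝ) : X ∈ 𝔥 ↔ ∃ c : Fin k → ℝ, ∑ j, c j • A j = X := by
  have hcomm : ∀ Y ∈ Submodule.span ℝ (Set.range A), ∀ Z ∈ Submodule.span ℝ (Set.range A),
      Y * Z = Z * Y := by
    intro Y hY Z hZ
    obtain ⟨c, rfl⟩ := (Submodule.mem_span_range_iff_exists_fun ℝ).mp hY
    obtain ⟨d, rfl⟩ := (Submodule.mem_span_range_iff_exists_fun ℝ).mp hZ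
    exact Commute.sum_left _ _ _ fun i _ => Commute.sum_right _ _ _ fun j _ =>
      ((show Commute (A i) (A j) from hA i j).smul_right (d j)).smul_left (c i)
  let S : LieSubalgebra ℝ (Matrix (Fin n) (Fin n) ℝ) :=
    { Submodule.span ℝ (Set.range A) with
      lie_mem' := by
        intro Y Z hY hZ
        rw [LieRing.of_associative_ring_bracket, hcomm Y hY Z hZ, sub_self]
        exact Submodule.zero_mem _ }
  rw [← Submodule.mem_span_range_iff_exists_fun ℝ, ← h]
  constructor
  · intro hX
    have : LieSubalgebra.lieSpan ℝ (Matrix (Fin n) (Fin n) ℝ) (Set.range A) ≤ S :=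
      LieSubalgebra.lieSpan_le.mpr Submodule.subset_span
    exact this hX
  · intro hX
    exact Submodule.span_le.mpr (LieSubalgebra.subset_lieSpan (R := ℝ)) hX

lemma isAdapted {𝔥 : LieSubalgebra ℝ (Matrix (Fin n) (Fin n) ℝ)}
    (h𝔥 : LieSubalgebra.lieSpan ℝ (Matrix (Fin n) (Fin n) ℝ) (Set.range A) = 𝔥) :
    E.decomposition.IsAdapted 𝔥 := by
  intro X hX
  obtain ⟨c, rfl⟩ := (mem_iff_of_lieSpan_eq E.comm h𝔥 X).mp hX
  exact E.decomposition.adaptedSubmodule.sum_mem fun j _ =>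
    E.decomposition.adaptedSubmodule.smul_mem _ (E.conj_mem j)

/-- The linear equations that describe `𝔥₀` in terms of the generators. -/
lemma mem_𝔥₀Coords_iff {𝔥 : LieSubalgebra ℝ (Matrix (Fin n) (Fin n) ℝ)}
    (h𝔥 : LieSubalgebra.lieSpan ℝ (Matrix (Fin n) (Fin n) ℝ) (Set.range A) = 𝔥)
    (θ : Fin E.blocks.length → ℝ) :
    θ ∈ E.decomposition.𝔥₀Coords 𝔥 ↔ ∃ c : Fin k → ℝ,
      (∀ r a, ∑ j, (c j : ℂ) • shiftEnd (A j) (Complex.I * ((E.χ r j).im : ℂ)) (E.ξ r a) = 0) ∧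
      ∀ r, ∑ j, c j * (E.χ r j).im = θ r := by
  have hsum : ∀ (c : Fin k → ℝ) r a,
      ∑ j, (c j : ℂ) • shiftEnd (A j) (Complex.I * ((E.χ r j).im : ℂ)) (E.ξ r a) =
        rowEnd (∑ j, c j • A j) (E.ξ r a) -
          (((∑ j, c j * (E.χ r j).im : ℝ) : ℂ) * Complex.I) • E.ξ r a := by
    intro c r a
    have h1 : ∀ s : Finset (Fin k), rowEnd (∑ j ∈ s, c j • A j) =
        ∑ j ∈ s, (c j : ℂ) • rowEnd (A j) := by
      classical
      intro s
      induction s using Finset.induction_on with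
      | empty =>
        apply LinearMap.ext
        intro x
        funext i
        simp [rowEnd_apply]
      | insert j s hj ih =>
        rw [Finset.sum_insert hj, Finset.sum_insert hj, rowEnd_add, rowEnd_smul, ih]
    rw [h1, LinearMap.sum_apply, Complex.ofReal_sum, Finset.sum_mul, Finset.sum_smul,
      ← Finset.sum_sub_distrib]
    refine Finset.sum_congr rfl fun j _ => ?_
    rw [shiftEnd_apply, smul_sub, smul_smul, LinearMap.smul_apply]
    congr 2
    push_cast
    ring
  rw [E.decomposition.mem_𝔥₀Coords_iff (E.isAdapted h𝔥)]
  constructor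
  · rintro ⟨X, hX, hθ⟩
    obtain ⟨c, rfl⟩ := (mem_iff_of_lieSpan_eq E.comm h𝔥 X).mp hX
    have hθ' : ∀ r, ∑ j, c j * (E.χ r j).im = θ r := by
      intro r
      have h1 : E.decomposition.diagScalar r (∑ j, c j • A j) = (θ r : ℂ) * Complex.I := by
        change E.decomposition.coeff r _ _ _ = _
        rw [hθ r]
        simp
      rw [map_sum] at h1
      have h2 := congrArg Complex.im h1
      simpa [E.diagScalar_eq] using h2
    refine ⟨c, fun r a => ?_, hθ'⟩
    have hconj := E.decomposition.conj_eq_toMatrix_coeff (E.isAdapted h𝔥 _ hX)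
    rw [E.decomposition.conj_eq_toMatrix_iff (E.decomposition.isRealFamily_of_mem_admissible
      (E.decomposition.coeff_mem_admissible (E.isAdapted h𝔥 _ hX)))] at hconj
    rw [hsum, (E.rowEnd_ξ_iff _ _).mp (hconj r) a, hθ r, hθ', sub_eq_zero]
    simp [Matrix.one_apply]
  · rintro ⟨c, h0, hθ⟩
    have hX : ∑ j, c j • A j ∈ 𝔥 := (mem_iff_of_lieSpan_eq E.comm h𝔥 _).mpr ⟨c, rfl⟩
    refine ⟨_, hX, ?_⟩
    have hreal : E.decomposition.IsRealFamily fun r => ((θ r : ℂ) * Complex.I) • 1 := by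
      intro r hr a b
      have hχ := E.isRealVec_χ hr
      have hθ0 : θ r = 0 := by
        rw [← hθ r]
        exact Finset.sum_eq_zero fun j _ => by rw [hχ j, mul_zero]
      simp [hθ0]
    refine E.decomposition.coeff_eq hreal ?_
    rw [E.decomposition.conj_eq_toMatrix_iff hreal]
    refine fun r => (E.rowEnd_ξ_iff _ _).mpr fun a => ?_
    have h1 := h0 r a
    rw [hsum, hθ r, sub_eq_zero] at h1
    rw [h1]
    simp [Matrix.one_apply]

end EigenSystem

end AbelianExp

/-! ### The output of the algorithm -/

namespace AbelianExp

section OfFn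

variable {α : Type}

lemma ofFn_finSigma {l : ℕ} (m : Fin l → ℕ) (f : Fin (∑ r, m r) → α) :
    List.ofFn f =
      (List.ofFn fun r => List.ofFn fun x : Fin (m r) => f (finSigmaFinEquiv ⟨r, x⟩)).flatten := by
  induction l with
  | zero =>
    rw [List.ofFn_congr (Fin.sum_univ_zero m)]
    simp
  | succ l ih =>
    rw [List.ofFn_congr (Fin.sum_univ_castSucc m), List.ofFn_add, ih, List.ofFn_succ',
      List.concat_eq_append, List.flatten_append]
    congr 1
    · congr 1
      congr 1
      funext r
      congr 1
      funext x
      congr 1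
      apply Fin.ext
      simp only [Fin.val_cast, Fin.val_castLE, finSigmaFinEquiv_apply]
      rfl
    · simp only [List.flatten_cons, List.flatten_nil, List.append_nil]
      congr 1
      funext x
      congr 1
      apply Fin.ext
      simp only [Fin.val_cast, Fin.val_natAdd, finSigmaFinEquiv_apply]
      rfl

lemma ofFn_finProd {d e : ℕ} (f : Fin (d * e) → α) :
    List.ofFn f =
      (List.ofFn fun a : Fin d => List.ofFn fun c : Fin e => f (finProdFinEquiv (a, c))).flatten := by
  rw [List.ofFn_mul]
  congr 1
  congr 1
  funext a
  congr 1
  funext c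
  congr 1
  apply Fin.ext
  simp [finProdFinEquiv, mul_comm, add_comm]

lemma flatMap_ofFn {β : Type} {l : ℕ} (f : Fin l → α) (g : α → List β) :
    (List.ofFn f).flatMap g = (List.ofFn fun r => g (f r)).flatten := by
  rw [List.flatMap_def, List.map_ofFn]
  rfl

end OfFn

section Reps

variable {k : ℕ}

lemma sameUpToConj_iff (χ φ : Fin k → ℂ) :
    sameUpToConj k (List.ofFn χ) (List.ofFn φ) = true ↔ χ = φ ∨ χ = conjVec φ := by
  have h1 : ∀ P : ℕ → Prop, (∀ j ∈ List.range k, P j) ↔ ∀ j : Fin k, P j := by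
    intro P
    simp only [List.mem_range]
    exact ⟨fun h j => h j j.2, fun h j hj => h ⟨j, hj⟩⟩
  have h2 : ∀ z : ℂ, (z.re : ℂ) + -(Complex.I * (z.im : ℂ)) = starRingEnd ℂ z := by
    intro z
    apply Complex.ext <;> simp
  simp only [sameUpToConj, Bool.or_eq_true, List.all_eq_true, decide_eq_true_eq, h1, getD_ofFn, h2,
    funext_iff, conjVec]

lemma isCplx_iff (χ : Fin k → ℂ) : isCplx k (List.ofFn χ) = true ↔ ¬ IsRealVec χ := by
  simp only [isCplx, List.any_eq_true, List.mem_range, Bool.not_eq_true', decide_eq_false_iff_not,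
    Complex.ofReal_eq_zero, IsRealVec, not_forall]
  constructor
  · rintro ⟨j, hj, h⟩
    exact ⟨⟨j, hj⟩, by rwa [← getD_ofFn χ ⟨j, hj⟩ 0]⟩
  · rintro ⟨j, h⟩
    exact ⟨j, j.2, by rwa [getD_ofFn χ j 0]⟩

/-- The choices of one element of each list, as functions. -/
lemma sections_spec (σ : Fin k → List ℂ) : ∃ X : List (Fin k → ℂ),
    (List.ofFn σ).sections = X.map List.ofFn ∧ ∀ χ, (∀ j, χ j ∈ σ j) → χ ∈ X := by
  have h1 : ∀ l ∈ (List.ofFn σ).sections, List.ofFn (fun j : Fin k => l.getD j 0) = l := by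
    intro l hl
    have h2 := List.mem_sections_length hl
    rw [List.length_ofFn] at h2
    subst h2
    apply List.ext_getElem
    · simp
    · intro i h3 h4
      simp [List.getD]
  refine ⟨(List.ofFn σ).sections.map fun l j => l.getD j 0, ?_, fun χ hχ => ?_⟩
  · rw [List.map_map]
    conv_lhs => rw [← List.map_id (List.ofFn σ).sections]
    exact List.map_congr_left fun l hl => (h1 l hl).symm
  · refine List.mem_map.mpr ⟨List.ofFn χ, ?_, ?_⟩
    · rw [List.mem_sections, List.forall₂_iff_get]
      refine ⟨by simp, fun i h2 h3 => ?_⟩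
      simpa using hχ ⟨i, by simpa using h2⟩
    · funext j
      exact getD_ofFn χ j 0

/-- The list `reps` represents every class of conjugate functions exactly once. -/
lemma reps_spec (X : List (Fin k → ℂ)) : ∃ Y : List (Fin k → ℂ),
    reps k (X.map List.ofFn) = Y.map List.ofFn ∧
    Y.Pairwise (fun χ φ => χ ≠ φ ∧ χ ≠ conjVec φ) ∧
    ∀ χ ∈ X, ∃ φ ∈ Y, χ = φ ∨ χ = conjVec φ := by
  induction X with
  | nil => exact ⟨[], rfl, List.Pairwise.nil, by simp⟩
  | cons χ X ih =>
    obtain ⟨Y, h1, h2, h3⟩ := ih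
    have h4 : reps k ((χ :: X).map List.ofFn) =
        if (Y.map List.ofFn).any (fun χ' => sameUpToConj k (List.ofFn χ) χ') = true then
          Y.map List.ofFn else List.ofFn χ :: Y.map List.ofFn := by
      rw [← h1]
      rfl
    have h5 : (Y.map List.ofFn).any (fun χ' => sameUpToConj k (List.ofFn χ) χ') = true ↔
        ∃ φ ∈ Y, χ = φ ∨ χ = conjVec φ := by
      simp [sameUpToConj_iff]
    by_cases h : ∃ φ ∈ Y, χ = φ ∨ χ = conjVec φ
    · refine ⟨Y, by rw [h4, if_pos (h5.mpr h)], h2, ?_⟩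
      rw [List.forall_mem_cons]
      exact ⟨h, h3⟩
    · refine ⟨χ :: Y, by rw [h4, if_neg (fun h6 => h (h5.mp h6)), List.map_cons], ?_, ?_⟩
      · rw [List.pairwise_cons]
        refine ⟨fun φ hφ => ⟨fun h6 => h ⟨φ, hφ, Or.inl h6⟩, fun h6 => h ⟨φ, hφ, Or.inr h6⟩⟩, h2⟩
      · rw [List.forall_mem_cons]
        refine ⟨⟨χ, List.mem_cons_self, Or.inl rfl⟩, fun φ hφ => ?_⟩
        obtain ⟨ψ, hψ, h6⟩ := h3 φ hφ
        exact ⟨ψ, List.mem_cons_of_mem _ hψ, h6⟩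

end Reps

section EigenBlocks

variable {n k : ℕ}

lemma IsTriangularList.get_mem {A : Fin k → Matrix (Fin n) (Fin n) ℝ} {χ : Fin k → ℂ}
    {W : List (Fin n → ℂ)} (h : IsTriangularList A χ W) (a : Fin W.length) (j : Fin k) :
    shiftEnd (A j) (χ j) (W.get a) ∈ Submodule.span ℂ (W.get '' Set.Ioi a) := by
  induction W with
  | nil => exact a.elim0
  | cons u W ih =>
    have hsub : ∀ s : Set (Fin W.length), W.get '' s = (u :: W).get '' (Fin.succ '' s) := by
      intro s
      rw [Set.image_image]
      rfl
    induction a using Fin.cases with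
    | zero =>
      refine Submodule.span_mono ?_ (h.1 j)
      rw [← range_get, ← Set.image_univ, hsub]
      refine Set.image_mono ?_
      rintro _ ⟨b, -, rfl⟩
      exact Fin.succ_pos b
    | succ a =>
      refine Submodule.span_mono ?_ (ih h.2 a)
      rw [hsub]
      refine Set.image_mono ?_
      rintro _ ⟨b, hb, rfl⟩
      exact Fin.succ_lt_succ_iff.mpr hb

/-- The list that represents an eigensystem. -/
noncomputable def EigenSystem.toList {A : Fin k → Matrix (Fin n) (Fin n) ℝ} (E : EigenSystem A) :
    List (List ℂ × List (List ℂ)) :=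
  List.ofFn fun r => (List.ofFn (E.χ r), List.ofFn fun a => List.ofFn (E.ξ r a))

/-- The algorithm finds all joint eigenvalues, since their components are eigenvalues. -/
lemma eigenBlocks_spec (A : Fin k → Matrix (Fin n) (Fin n) ℝ) (hA : ∀ i j, A i * A j = A j * A i)
    (σ : Fin k → List ℂ)
    (hσ : ∀ j z, z ∈ σ j ↔ z ∈ spectrum ℂ ((A j).map (algebraMap ℝ ℂ))) :
    ∃ E : EigenSystem A,
      eigenBlocks n (List.ofFn fun j => encodeMatrix (A j)) (List.ofFn σ) = E.toList := by
  obtain ⟨X, hX, hXσ⟩ := sections_spec σ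
  obtain ⟨Y, hY, hYne, hYX⟩ := reps_spec X
  choose W hW hWb using block_spec A hA
  classical
  let Bs : List (Fin k → ℂ) := Y.filter fun χ => !(W χ).isEmpty
  have heig : eigenBlocks n (List.ofFn fun j => encodeMatrix (A j)) (List.ofFn σ) =
      Bs.map fun χ => (List.ofFn χ, (W χ).map List.ofFn) := by
    unfold eigenBlocks
    rw [List.length_ofFn, hX, hY, List.map_map, List.filter_map]
    simp only [Bs]
    have h1 : ((fun χ : List ℂ => (χ, block n (List.ofFn fun j => encodeMatrix (A j)) χ)) ∘
        (List.ofFn : (Fin k → ℂ) → List ℂ)) = fun χ => (List.ofFn χ, (W χ).map List.ofFn) := by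
      funext χ
      simp only [Function.comp_apply, hW]
    rw [h1]
    congr 1
    refine List.filter_congr fun χ _ => ?_
    simp
  have hBs : ∀ χ ∈ Bs, W χ ≠ [] := by
    intro χ hχ
    simpa using (List.mem_filter.mp hχ).2
  have hBsne : Bs.Pairwise (fun χ φ => χ ≠ φ ∧ χ ≠ conjVec φ) := hYne.filter _
  let blocks : List (Bool × ℕ) := Bs.map fun χ => (isCplx k (List.ofFn χ), (W χ).length)
  have hlen : blocks.length = Bs.length := List.length_map _
  let ι : Fin blocks.length → Fin Bs.length := Fin.cast hlen
  have hblocks : ∀ r : Fin blocks.length, blocks[r] =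
      (isCplx k (List.ofFn (Bs.get (ι r))), (W (Bs.get (ι r))).length) := by
    intro r
    simp [blocks, ι]
  have hsize : ∀ r : Fin blocks.length, blocks[r].2 = (W (Bs.get (ι r))).length := fun r => by
    rw [hblocks]
  have hrange : ∀ r : Fin blocks.length,
      Set.range (fun a : Fin blocks[r].2 => (W (Bs.get (ι r))).get (Fin.cast (hsize r) a)) =
        {x | x ∈ W (Bs.get (ι r))} := by
    intro r
    rw [← range_get]
    exact (finCongr (hsize r)).surjective.range_comp (W (Bs.get (ι r))).get
  have hmemY : ∀ r, Bs.get (ι r) ∈ Bs := fun r => List.get_mem _ _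
  refine ⟨{ comm := hA
            blocks := blocks
            size_pos := ?_
            χ := fun r => Bs.get (ι r)
            ξ := fun r a => (W (Bs.get (ι r))).get (Fin.cast (hsize r) a)
            indep := ?_
            span_eq := ?_
            triangular := ?_
            cplx_iff := ?_
            real := ?_
            ne := ?_
            complete := ?_ }, ?_⟩
  · intro b hb
    obtain ⟨χ, hχ, rfl⟩ := List.mem_map.mp hb
    exact List.length_pos_iff.mpr (hBs χ hχ)
  · intro r
    exact (hWb _).indep.comp _ (finCongr (hsize r)).injective
  · intro r
    rw [hrange]
    exact (hWb _).span_eq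
  · intro r a j
    refine Submodule.span_mono ?_ ((hWb (Bs.get (ι r))).triangular.get_mem (Fin.cast (hsize r) a) j)
    rintro _ ⟨b, hb, rfl⟩
    exact ⟨Fin.cast (hsize r).symm b, hb, rfl⟩
  · intro r
    rw [hblocks]
    exact isCplx_iff _
  · intro r hr a
    exact (hWb _).real hr _ (List.get_mem _ _)
  · intro r r' hrr'
    have hι : ι r ≠ ι r' := fun h => hrr' (Fin.cast_injective hlen h)
    have hpw := List.pairwise_iff_get.mp hBsne
    rcases lt_or_gt_of_ne hι with h | h
    · exact hpw _ _ h
    · obtain ⟨h1, h2⟩ := hpw _ _ h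
      refine ⟨Ne.symm h1, fun h3 => h2 ?_⟩
      rw [h3, conjVec_conjVec]
  · intro φ hφ
    obtain ⟨χ, hχ, h⟩ := hYX φ (hXσ φ fun j =>
      (hσ j _).mpr (mem_spectrum_of_weightSpace_ne_bot hφ j))
    have hχW : W χ ≠ [] := by
      intro h1
      have h2 : weightSpace A χ = ⊥ := by
        rw [← (hWb χ).span_eq, h1]
        simp [listSpan]
      apply hφ
      rw [eq_bot_iff]
      intro u hu
      rcases h with rfl | rfl
      · rwa [h2] at hu
      · have h3 : conjVec u ∈ weightSpace A (conjVec (conjVec χ)) := conjVec_mem_weightSpace hu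
        rw [conjVec_conjVec, h2, Submodule.mem_bot] at h3
        rw [Submodule.mem_bot, ← conjVec_conjVec u, h3]
        funext i
        simp [conjVec]
    have hmem : χ ∈ Bs := List.mem_filter.mpr ⟨hχ, by simpa using hχW⟩
    obtain ⟨i, hi⟩ := List.mem_iff_get.mp hmem
    exact ⟨Fin.cast hlen.symm i, by rw [← hi] at h; exact h⟩
  · rw [heig]
    unfold EigenSystem.toList
    apply List.ext_getElem
    · simp [hlen]
    · intro i h1 h2
      rw [List.getElem_map, List.getElem_ofFn]
      refine Prod.ext rfl ?_
      apply List.ext_getElem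
      · rw [List.length_map, List.length_ofFn]
        exact (hsize ⟨i, by simpa using h2⟩).symm
      · intro a h3 h4
        rw [List.getElem_map, List.getElem_ofFn]
        rfl

end EigenBlocks

end AbelianExp

namespace AbelianExp

/-- The family of lists `L j` has the linear relation with coefficients `c`, in every position. -/
def IsRelation {k : ℕ} (c : Fin k → ℂ) (L : Fin k → List ℂ) : Prop :=
  ∀ i, ∑ j, c j * (L j).getD i 0 = 0

section Relation

variable {k : ℕ} {c : Fin k → ℂ}

lemma isRelation_append {L M : Fin k → List ℂ} {d : ℕ} (hL : ∀ j, (L j).length = d) :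
    IsRelation c (fun j => L j ++ M j) ↔ IsRelation c L ∧ IsRelation c M := by
  have h1 : ∀ i < d, ∀ j, (L j ++ M j).getD i 0 = (L j).getD i 0 := fun i hi j =>
    List.getD_append _ _ _ _ (by rw [hL]; exact hi)
  have h2 : ∀ i, ∀ j, (L j ++ M j).getD (d + i) 0 = (M j).getD i 0 := by
    intro i j
    rw [List.getD_append_right _ _ _ _ (by rw [hL]; omega), hL, Nat.add_sub_cancel_left]
  constructor
  · intro h
    refine ⟨fun i => ?_, fun i => ?_⟩
    · by_cases hi : i < d
      · simpa only [h1 i hi] using h i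
      · refine Finset.sum_eq_zero fun j _ => ?_
        rw [List.getD_eq_default _ _ (by rw [hL]; omega), mul_zero]
    · simpa only [h2] using h (d + i)
  · rintro ⟨hL0, hM0⟩ i
    by_cases hi : i < d
    · simpa only [h1 i hi] using hL0 i
    · obtain ⟨i, rfl⟩ := Nat.exists_eq_add_of_le (not_lt.mp hi)
      simpa only [h2] using hM0 i

lemma isRelation_flatMap {α : Type} (l : List α) (g : Fin k → α → List ℂ) (d : α → ℕ)
    (hg : ∀ j x, (g j x).length = d x) :
    IsRelation c (fun j => l.flatMap (g j)) ↔ ∀ x ∈ l, IsRelation c fun j => g j x := by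
  induction l with
  | nil => simp [IsRelation]
  | cons x l ih =>
    simp only [List.flatMap_cons, List.forall_mem_cons]
    rw [isRelation_append fun j => hg j x, ih]

lemma isRelation_ofFn {d : ℕ} (f : Fin k → Fin d → ℂ) :
    IsRelation c (fun j => List.ofFn (f j)) ↔ ∑ j, c j • f j = 0 := by
  rw [funext_iff]
  constructor
  · intro h i
    have := h i
    simpa [getD_ofFn, Finset.sum_apply] using this
  · intro h i
    by_cases hi : i < d
    · have := h ⟨i, hi⟩
      simp only [Finset.sum_apply, Pi.smul_apply, smul_eq_mul, Pi.zero_apply] at this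
      refine Eq.trans (Finset.sum_congr rfl fun j _ => ?_) this
      rw [← getD_ofFn (f j) ⟨i, hi⟩ 0]
    · refine Finset.sum_eq_zero fun j _ => ?_
      rw [List.getD_eq_default _ _ (by simpa using hi), mul_zero]

end Relation

/-- A real linear relation between complex vectors is one between their real and imaginary parts. -/
lemma sum_ofReal_smul_eq_zero_iff {k d : ℕ} (c : Fin k → ℝ) (f : Fin k → Fin d → ℂ) :
    ∑ j, (c j : ℂ) • f j = 0 ↔ ∑ j, (c j : ℂ) • (fun i => ((f j i).re : ℂ)) = 0 ∧
      ∑ j, (c j : ℂ) • (fun i => ((f j i).im : ℂ)) = 0 := by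
  simp only [funext_iff, Finset.sum_apply, Pi.smul_apply, Pi.zero_apply, smul_eq_mul,
    Complex.ext_iff, Complex.re_sum, Complex.im_sum, Complex.re_ofReal_mul, Complex.im_ofReal_mul,
    Complex.ofReal_re, Complex.ofReal_im, mul_zero, Finset.sum_const_zero, Complex.zero_re,
    Complex.zero_im, and_true, forall_and]

namespace EigenSystem

variable {n k : ℕ} {A : Fin k → Matrix (Fin n) (Fin n) ℝ} (E : EigenSystem A)

lemma isCplx_χ (r : Fin E.blocks.length) : isCplx k (List.ofFn (E.χ r)) = E.cplx r := by
  rw [Bool.eq_iff_iff, isCplx_iff, E.cplx_iff]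

lemma shape_toList : shape k E.toList = E.blocks := by
  unfold shape toList
  rw [List.map_ofFn]
  have h : ((fun b : List ℂ × List (List ℂ) => (isCplx k b.1, b.2.length)) ∘ fun r =>
      (List.ofFn (E.χ r), List.ofFn fun a => List.ofFn (E.ξ r a))) = fun r => E.blocks[r] := by
    funext r
    simp only [Function.comp_apply, isCplx_χ, List.length_ofFn]
  rw [h]
  exact List.ofFn_getElem

lemma ofFn_index {α : Type} (g : (Σ r, Fin (E.size r) × Fin (fieldDim (E.cplx r))) → α) :
    List.ofFn (fun i => g (E.index.symm i)) = (List.ofFn fun r => (List.ofFn fun a =>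
      List.ofFn fun c => g ⟨r, (a, c)⟩).flatten).flatten := by
  rw [List.ofFn_congr E.dim_eq.symm, ofFn_finSigma]
  congr 1
  congr 1
  funext r
  rw [ofFn_finProd]
  congr 1
  congr 1
  funext a
  congr 1
  funext c
  congr 1
  rw [Equiv.symm_apply_eq]
  rfl

lemma baseRows_toList : baseRows k E.toList = encodeMatrix E.baseMatrix := by
  have h := E.ofFn_index fun x => List.ofFn fun i => ((E.row x i : ℝ) : ℂ)
  unfold encodeMatrix
  refine Eq.trans ?_ h.symm
  unfold baseRows toList
  rw [flatMap_ofFn]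
  congr 1
  congr 1
  funext r
  rw [flatMap_ofFn]
  congr 1
  congr 1
  funext a
  rw [isCplx_χ]
  have h2 : ∀ (b : Bool) (f : ℕ → List ℂ), (if b = true then [f 0, f 1] else [f 0]) =
      List.ofFn fun c : Fin (fieldDim b) => f c := by
    intro b f
    cases b <;> simp [fieldDim, List.ofFn_succ]
  have h3 := h2 (E.cplx r) fun c =>
    List.ofFn fun i => (((if c = 0 then (E.ξ r a i).re else (E.ξ r a i).im : ℝ)) : ℂ)
  simp only [if_true, one_ne_zero, if_false] at h3
  refine Eq.trans ?_ h3
  simp only [reRow, imRow, List.map_ofFn]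
  rfl

/-- The lengths of the lists `defect` do not depend on the matrix. -/
lemma length_defect (bs : List (List ℂ × List (List ℂ))) (j j' : ℕ) (M M' : List (List ℂ)) :
    (defect n bs j M).length = (defect n bs j' M').length := by
  simp [defect, List.length_flatMap, reRow, imRow, shiftRow]

/-- The relations between the lists `defect` are the equations that define `𝔥₀`. -/
lemma isRelation_defect (c : Fin k → ℝ) :
    IsRelation (fun j => (c j : ℂ)) (fun j => defect n E.toList j (encodeMatrix (A j))) ↔
      ∀ r a, ∑ j, (c j : ℂ) • shiftEnd (A j) (Complex.I * ((E.χ r j).im : ℂ)) (E.ξ r a) = 0 := by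
  unfold defect
  rw [isRelation_flatMap _ _ (fun b => (b.2.flatMap fun _ => List.replicate (n + n) ()).length)
    (by intro j b; simp [List.length_flatMap, reRow, imRow, shiftRow])]
  unfold toList
  rw [List.forall_mem_ofFn_iff]
  refine forall_congr' fun r => ?_
  rw [isRelation_flatMap _ _ (fun _ => n + n) (by intro j b; simp [reRow, imRow, shiftRow]),
    List.forall_mem_ofFn_iff]
  refine forall_congr' fun a => ?_
  simp only [getD_ofFn, shiftRow_ofFn, reRow, imRow, List.map_ofFn]
  rw [isRelation_append (d := n) (by simp), isRelation_ofFn, isRelation_ofFn]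
  exact (sum_ofReal_smul_eq_zero_iff c fun j =>
    shiftEnd (A j) (Complex.I * ((E.χ r j).im : ℂ)) (E.ξ r a)).symm

/-- The list `angles` is an echelon basis of the space of coordinates of `𝔥₀`. -/
lemma angles_toList : ∃ (m : ℕ) (v : Fin m → Fin E.blocks.length → ℝ),
    angles n (List.ofFn fun j => encodeMatrix (A j)) E.toList = encodeMatrix v ∧
    IsGaussJordan v ∧ ∀ θ, θ ∈ Submodule.span ℝ (Set.range v) ↔ ∃ c : Fin k → ℝ,
      (∀ r a, ∑ j, (c j : ℂ) • shiftEnd (A j) (Complex.I * ((E.χ r j).im : ℂ)) (E.ξ r a) = 0) ∧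
      ∀ r, ∑ j, c j * (E.χ r j).im = θ r := by
  set p := (defect n E.toList 0 []).length with hp
  have hlen : ∀ j : Fin k, (defect n E.toList j (encodeMatrix (A j))).length = p := fun j =>
    length_defect _ _ _ _ _
  -- The input of the elimination is real.
  let d : Fin k → Fin p → ℝ := fun j i =>
    ((defect n E.toList j (encodeMatrix (A j))).getD i 0).re
  have hreal : ∀ j : Fin k, ∀ z ∈ defect n E.toList j (encodeMatrix (A j)), z.im = 0 := by
    intro j z hz
    simp only [defect, List.mem_flatMap, List.mem_append, reRow, imRow, List.mem_map] at hz
    obtain ⟨b, -, ξ, -, ⟨y, -, rfl⟩ | ⟨y, -, rfl⟩⟩ := hz <;> simp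
  have hd : ∀ j : Fin k, defect n E.toList j (encodeMatrix (A j)) =
      List.ofFn fun i => ((d j i : ℝ) : ℂ) := by
    intro j
    apply List.ext_getElem
    · rw [hlen, List.length_ofFn]
    · intro i h1 h2
      rw [List.getElem_ofFn]
      have h3 := hreal j _ (List.getElem_mem h1)
      simp only [d]
      rw [List.getD_eq_getElem _ _ h1]
      exact Complex.ext (by simp) (by simp [h3])
  let l : List ((Fin p → ℝ) × (Fin E.blocks.length → ℝ)) :=
    List.ofFn fun j => (d j, fun r => (E.χ r j).im)
  have hangles : angles n (List.ofFn fun j => encodeMatrix (A j)) E.toList =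
      (solve p (l.map fun p => (List.ofFn p.1, List.ofFn p.2))).map
        (List.map (Complex.ofRealHom : ℝ →+* ℂ)) := by
    rw [← solve_map]
    unfold angles
    rw [← hp, List.length_ofFn, range_map_eq_ofFn, List.map_ofFn, List.map_ofFn]
    congr 2
    funext j
    refine Prod.ext ?_ ?_
    · change defect n E.toList j ((List.ofFn fun j => encodeMatrix (A j)).getD j []) = _
      rw [getD_ofFn, hd]
      simp [List.map_ofFn, Function.comp_def]
    · simp [toList, List.map_ofFn, Function.comp_def]
  obtain ⟨L, h1, hL, h3⟩ := solve_spec l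
  let v : Fin L.length → Fin E.blocks.length → ℝ := fun j => (L.get j).2
  have hv : Set.range v = {x | x ∈ L.map Prod.snd} := by
    ext x
    constructor
    · rintro ⟨j, rfl⟩
      exact List.mem_map.mpr ⟨L.get j, List.get_mem L j, rfl⟩
    · intro hx
      obtain ⟨a, ha, rfl⟩ := List.mem_map.mp hx
      obtain ⟨j, rfl⟩ := List.mem_iff_get.mp ha
      exact ⟨j, rfl⟩
  refine ⟨L.length, v, ?_, ?_, fun θ => ?_⟩
  · rw [hangles, h1]
    unfold encodeMatrix
    apply List.ext_getElem
    · simp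
    · intro i h4 h5
      simp [v, List.map_ofFn, Function.comp_def]
  · have hmono : StrictMono fun j => (L.get j).1 := fun i j hij =>
      List.pairwise_iff_get.mp hL.sorted _ _ hij
    refine ⟨fun j => (L.get j).1, hmono, fun j => ⟨?_, ?_, ?_⟩⟩
    · intro r hr
      exact hL.lead _ (List.get_mem _ _) r hr
    · have := hL.pivot _ (List.get_mem L j) _ (List.get_mem L j)
      simpa [v] using this
    · intro i hij
      refine (hL.pivot _ (List.get_mem L j) _ (List.get_mem L i)).trans (if_neg fun h => hij ?_)
      exact hmono.injective h.symm
  · rw [hv, h3]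
    have hl : {p | p ∈ l} = Set.range fun j : Fin k => (d j, fun r => (E.χ r j).im) := by
      ext x
      simp [l]
    rw [hl, Submodule.mem_span_range_iff_exists_fun]
    refine exists_congr fun c => ?_
    rw [← E.isRelation_defect c]
    simp only [hd]
    rw [isRelation_ofFn, Prod.ext_iff, Prod.fst_sum, Prod.snd_sum]
    refine and_congr ?_ ?_
    · rw [funext_iff, funext_iff]
      refine forall_congr' fun i => ?_
      simp only [Finset.sum_apply, Pi.smul_apply, Pi.zero_apply, smul_eq_mul, Prod.smul_fst]
      norm_cast
    · rw [funext_iff]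
      refine forall_congr' fun r => ?_
      simp [Finset.sum_apply]

end EigenSystem

end AbelianExp

theorem mainTheorem7 :
    ∃ P : AbelianExp.Prog AbelianExp.inputTy AbelianExp.outputTy,
      ∀ (n k : ℕ) (𝔥 : LieSubalgebra ℝ (Matrix (Fin n) (Fin n) ℝ)) (_ : IsLieAbelian 𝔥)
        (A : Fin k → Matrix (Fin n) (Fin n) ℝ)
        (_ : LieSubalgebra.lieSpan ℝ (Matrix (Fin n) (Fin n) ℝ) (Set.range A) = 𝔥)
        (σ : Fin k → List ℂ)
        (_ : ∀ j z, z ∈ σ j ↔ z ∈ spectrum ℂ ((A j).map (algebraMap ℝ ℂ))),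
        ∃ (D : AbelianExp.BlockDecomposition n) (m : ℕ) (v : Fin m → Fin D.numBlocks → ℝ),
          P.eval (AbelianExp.encodeInput A σ) =
            (AbelianExp.encodeMatrix (D.B : Matrix (Fin n) (Fin n) ℝ),
              (D.blocks, AbelianExp.encodeMatrix v)) ∧
          D.IsAdapted 𝔥 ∧
          AbelianExp.IsGaussJordan v ∧
          (Submodule.span ℝ (Set.range v) : Set (Fin D.numBlocks → ℝ)) = D.𝔥₀Coords 𝔥 ∧
          (IsClosed (AbelianExp.expImage 𝔥) ↔ ∀ j r, ∃ q : ℚ, v j r = (q : ℝ)) := by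
  refine ⟨AbelianExp.Prog.main, fun n k 𝔥 h𝔥 A hA σ hσ => ?_⟩
  have hcomm : ∀ i j, A i * A j = A j * A i := by
    intro i j
    have hi : ∀ i, A i ∈ 𝔥 := fun i => hA ▸ LieSubalgebra.subset_lieSpan ⟨i, rfl⟩
    have h := congrArg Subtype.val (h𝔥.trivial (⟨A i, hi i⟩ : 𝔥) ⟨A j, hi j⟩)
    rw [LieSubalgebra.coe_bracket, LieRing.of_associative_ring_bracket] at h
    exact sub_eq_zero.mp h
  obtain ⟨E, hE⟩ := AbelianExp.eigenBlocks_spec A hcomm σ hσ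
  obtain ⟨m, v, hv, hgj, hspan⟩ := E.angles_toList
  have hset : (Submodule.span ℝ (Set.range v) : Set (Fin E.blocks.length → ℝ)) =
      E.decomposition.𝔥₀Coords 𝔥 := by
    ext θ
    exact (hspan θ).trans (E.mem_𝔥₀Coords_iff hA θ).symm
  have hadapted := E.isAdapted hA
  refine ⟨E.decomposition, m, v, ?_, hadapted, hgj, hset, fun hcl => ?_, fun hrat => ?_⟩
  · rw [AbelianExp.Prog.eval_main]
    have h1 : List.map Prod.fst (AbelianExp.encodeInput A σ).2 =
        List.ofFn fun j => AbelianExp.encodeMatrix (A j) := List.map_ofFn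
    have h2 : List.map Prod.snd (AbelianExp.encodeInput A σ).2 = List.ofFn σ := List.map_ofFn
    have h0 : (AbelianExp.encodeInput A σ).1 = n := rfl
    simp only [h0, h1, h2, hE, List.length_ofFn, E.baseRows_toList, E.shape_toList, hv]
    rfl
  · exact E.decomposition.rational_of_isClosed_expImage hadapted hgj hset hcl
  · exact E.decomposition.isClosed_expImage_of_rational hadapted hset hrat
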